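/- Let $d\ge 1$, $0<\alpha<2$, and let $a:\mathbb Z^d\to[0,\infty)$ be a symmetric probability distribution: $a(-z)=a(z)$, $\sum_z a(z)=1$. Let $p(t,x)$ be the transition probability from $0$ to $x\in\mathbb Z^d$ in time $t$ of the continuous-time random walk on $\mathbb Z^d$ that jumps at rate $1$ with jump distribution $a$, i.e. $p(t,x)=\sum_{n\ge 0}e^{-t}\frac{t^n}{n!}a^{*n}(x)$, where $a^{*n}$ is the $n$-fold convolution power ($a^{*0}=\delta_0$). Put $\hat a(k)=\sum_{z}e^{-i(k,z)}a(z)=\sum_z\cos(k,z)\,a(z)$, $m=d+[\alpha]+1$, and $\dot k=k/|k|$ for $k\neq 0$. Assume: (i) $\hat a$ is of class $C^m$ on $\mathbb R^d\setminus 2\pi\mathbb Z^d$, and in a neighborhood of $k=0$ $$\hat a(k)=1-\sum_{j=0}^{d}b_j(\dot k)|k|^{\alpha+j}+f(k),$$ where $b_j\in C^m(S^{d-1})$, $f$ is of class $C^m$ near $0$, and $f(0)=0$; (ii) $b_0(\dot k)=-\Gamma(-\alpha)\cos\frac{\alpha\pi}{2}\int_{S^{d-1}}a_0(\dot x)\,|(\dot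 x,\dot k)|^{\alpha}\,dS_{\dot x}$ for an even continuous function $a_0$ on $S^{d-1}$ with $a_0>\delta$ for some $\delta>0$ (for $\alpha=1$ the factor $-\Gamma(-\alpha)\cos\frac{\alpha\pi}{2}$ means its limit $\pi/2$; for $d=1$ the integral is the sum over $\{1,-1\}$); (iii) $\hat a(k)<1$ for $0\neq k\in[-\pi,\pi]^d$. Let $$S(y)=\frac1{(2\pi)^d}\int_{\mathbb R^d}e^{i(k,y)-b_0(\dot k)|k|^\alpha}\,dk,\qquad y\in\mathbb R^d.$$ The integral converges absolutely, $S$ is real and strictly positive on $\mathbb R^d$, and it is the density of the $d$-dimensional stable law with characteristic function $e^{-b_0(\dot k)|k|^\alpha}$. Moreover: (1) As $|x|+t\to\infty$, uniformly in $x\in\mathbb Z^d$, $t>0$, $$p(t,x)=\frac1{t^{d/\alpha}}\,S\!\left(\frac{x}{t^{1/\alpha}}\right)(1+o(1)).$$ (2) As both $|x|+t\to\infty$ and $|x|/t^{1/\alpha}\to\infty$, uniformly in $x\in\mathbb Z^d$, $|x|\ge1$, $t>0$, $$p(t,x)=\frac{a_0(\dot x)}{t^{d/\alpha}}\left(\frac{t^{1/\alpha}}{|x|}\right)^{d+\alpha}(1+o(1))=\frac{a_0(\dot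 x)\,t}{|x|^{d+\alpha}}(1+o(1)).$$ -/

import Mathlib

open MeasureTheory

noncomputable section

/-- A point of the lattice `ℤ^d`, seen as a vector of Euclidean space `ℝ^d`. -/
def latticeVec {d : ℕ} (x : Fin d → ℤ) : EuclideanSpace ℝ (Fin d) :=
  WithLp.toLp 2 fun i => (x i : ℝ)

/-- The direction `k / |k|` of a vector `k ≠ 0` (and `0` for `k = 0`, a value that never matters). -/
def direction {d : ℕ} (k : EuclideanSpace ℝ (Fin d)) : EuclideanSpace ℝ (Fin d) :=
  ‖k‖⁻¹ • k

/-- `b ∈ C^n(S^{d-1})`. Only the values of `b` on the unit sphere enter. The function is of class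
`C^n` on the sphere iff its extension to `ℝ^d ∖ {0}`, constant along rays, is of class `C^n`. -/
def IsSphereSmooth {d : ℕ} (n : ℕ) (b : EuclideanSpace ℝ (Fin d) → ℝ) : Prop :=
  ContDiffOn ℝ (n : WithTop ℕ∞) (fun k => b (direction k)) {0}ᶜ

/-- A symmetric probability distribution of jumps on `ℤ^d`. -/
structure IsSymmetricJumpLaw {d : ℕ} (a : (Fin d → ℤ) → ℝ) : Prop where
  nonneg : ∀ z, 0 ≤ a z
  symm : ∀ z, a (-z) = a z
  hasSum_one : HasSum a 1

/-- Distribution of the sum of `n` independent jumps: the `n`-fold convolution power of `a`. -/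
def jumpConvPow {d : ℕ} (a : (Fin d → ℤ) → ℝ) : ℕ → (Fin d → ℤ) → ℝ
  | 0, x => if x = 0 then 1 else 0
  | n + 1, x => ∑' z, jumpConvPow a n (x - z) * a z

/-- Transition probability `p(t,x) = P(x(t) = x | x(0) = 0)` of the continuous-time random walk
that waits an exponential time of rate `1` at each site and then jumps by `z` with probability
`a z`: the number of jumps up to time `t` is Poisson with mean `t`, independent of the jumps. -/
def transitionProb {d : ℕ} (a : (Fin d → ℤ) → ℝ) (t : ℝ) (x : Fin d → ℤ) : ℝ :=
  ∑' n : ℕ, Real.exp (-t) * t ^ n / (n.factorial : ℝ) * jumpConvPow a n x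

/-- The Fourier transform `∑ e^{-i(k,z)} a(z) = ∑ cos(k,z) a(z)` of a symmetric jump law. -/
def jumpFourier {d : ℕ} (a : (Fin d → ℤ) → ℝ) (k : EuclideanSpace ℝ (Fin d)) : ℝ :=
  ∑' z, Real.cos (inner ℝ k (latticeVec z)) * a z

/-- Regularity of the Fourier transform of the jump law, with `m = d + [α] + 1`: it is `C^m` away
from the points of `2π ℤ^d`, and near `k = 0` it equals
`1 - ∑_{j=0}^{d} b_j(k/|k|) |k|^{α+j} + f(k)`, where `b_j ∈ C^m(S^{d-1})`, `f` is `C^m`, `f(0) = 0`.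
-/
structure HasFourierExpansion {d : ℕ} (α : ℝ) (a : (Fin d → ℤ) → ℝ)
    (b : ℕ → EuclideanSpace ℝ (Fin d) → ℝ) : Prop where
  smooth_coeff : ∀ j ≤ d, IsSphereSmooth (d + ⌊α⌋₊ + 1) (b j)
  smooth_away : ContDiffOn ℝ ((d + ⌊α⌋₊ + 1 : ℕ) : WithTop ℕ∞) (jumpFourier a)
    {k | ∀ n : Fin d → ℤ, k ≠ (2 * Real.pi) • latticeVec n}
  expansion : ∃ f : EuclideanSpace ℝ (Fin d) → ℝ,
    ContDiffAt ℝ ((d + ⌊α⌋₊ + 1 : ℕ) : WithTop ℕ∞) f 0 ∧ f 0 = 0 ∧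
    ∀ᶠ k in nhds (0 : EuclideanSpace ℝ (Fin d)),
      jumpFourier a k
        = 1 - ∑ j ∈ Finset.range (d + 1), b j (direction k) * ‖k‖ ^ (α + (j : ℝ)) + f k

/-- The constant `-Γ(-α) cos(απ/2)`, understood as its limit `π/2` for `α = 1`. -/
def stableConst (α : ℝ) : ℝ :=
  if α = 1 then Real.pi / 2 else -Real.Gamma (-α) * Real.cos (α * Real.pi / 2)

/-- `stableConst α * ∫_{S^{d-1}} a₀(x) |(x,k)|^α dS_x`, with respect to the surface measure on the
unit sphere (the counting measure on `{1,-1}` for `d = 1`). -/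
def stableExponent {d : ℕ} (α : ℝ) (a₀ : EuclideanSpace ℝ (Fin d) → ℝ)
    (k : EuclideanSpace ℝ (Fin d)) : ℝ :=
  stableConst α *
    ∫ x : Metric.sphere (0 : EuclideanSpace ℝ (Fin d)) 1,
      a₀ x * |inner ℝ (x : EuclideanSpace ℝ (Fin d)) k| ^ α
        ∂((volume : Measure (EuclideanSpace ℝ (Fin d))).toSphere)

/-- The complex number `(2π)^{-d} ∫_{ℝ^d} exp(i(k,y) - b₀(k/|k|)|k|^α) dk`. -/
def stableFourierIntegral {d : ℕ} (α : ℝ) (b₀ : EuclideanSpace ℝ (Fin d) → ℝ)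
    (y : EuclideanSpace ℝ (Fin d)) : ℂ :=
  (1 / (2 * (Real.pi : ℂ)) ^ d) * ∫ k : EuclideanSpace ℝ (Fin d),
    Complex.exp (Complex.I * ((inner ℝ k y : ℝ) : ℂ) - ((b₀ (direction k) * ‖k‖ ^ α : ℝ) : ℂ))

/-- The function `S`, as a real number. -/
def stableDensity {d : ℕ} (α : ℝ) (b₀ : EuclideanSpace ℝ (Fin d) → ℝ)
    (y : EuclideanSpace ℝ (Fin d)) : ℝ :=
  (stableFourierIntegral α b₀ y).re

end

/-! The Fourier representation controls p(t,x) while x/t^{1/α} stays bounded; far out, the walk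
reaches x by one big jump. Write w(y) = a₀(y/|y|)|y|^{-(d+α)} (`levyDensity`).

Bulk. The Fourier series of p(t,·) is e^{-t(1-â)}. The expansion of â gives t(1-â(t^{-1/α}κ)) →
b₀(κ/|κ|)|κ|^α, and 1-â ≥ c|k|^α on the cube gives a dominating function. Hence t^{d/α}p(t,x) -
S(x/t^{1/α}) → 0 uniformly in x as t → ∞ (`local_limit`). This absolute error suffices where S is
bounded below, but not where S is small.

Jump law. The formula for b₀ is a Lévy–Khintchine formula: b₀(k/|k|)|k|^α = ∫(1-cos(k,y))w(y)dy
(`stableExponent_eq_integral`). Thus a and w have Fourier transforms with the same leading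
singularity at 0, which forces the same tail. Differences of order m with step h = πx/|x|² multiply
both a(x) and w(x) by (-2)^m, whereas the differences of what remains of the symbols contribute only
O(|x|^{-(d+α+σ)}) with some σ > 0 (`jumpLaw_asymptotics`).

Tail. For t ≪ |x|^α cut the jumps at A = η|x|; the two parts of the walk are independent. An
exponential tilt shows that the small jumps cover a distance r with probability at most a constant
times q^{r/(2dA)}, where q = tA^{-α} (`truncatedWalk_tail`, `truncatedWalk_le`), a power as high as
needed when η is small. The big jumps form a compound Poisson law which, near x, is t·a up to
relative errors vanishing with q. Hence p(t,x) ~ t·w(x) (`transitionProb_tail`).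

The density S. Letting t → ∞ with x/t^{1/α} → y in both results gives S(y) ~ w(y) at infinity
(`stableDensity_tail`), so S is integrable and is positive far out; the convolution semigroup
spreads positivity to all of ℝ^d (`stableDensity_pos`).

Uniformity. If |x|/t^{1/α} is large, p and the rescaled S are both close to t·w(x). Otherwise |x|+t
→ ∞ forces t → ∞, and the positive minimum of S on a ball turns the absolute error into a relative
one (`transitionProb_asymptotics`). -/

/-! ### Discrete convolution and its exponential -/

section Convolution

variable {G 𝕜 : Type*} [AddCommGroup G] [RCLike 𝕜]

/-- Discrete convolution on a commutative group. -/
noncomputable def discreteConv (u v : G → 𝕜) (x : G) : 𝕜 := ∑' z, u (x - z) * v z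

open Classical in
/-- Discrete convolution powers. -/
noncomputable def discreteConvPow (c : G → 𝕜) : ℕ → G → 𝕜
  | 0 => fun x => if x = 0 then 1 else 0
  | n + 1 => discreteConv (discreteConvPow c n) c

/-- The exponential of `c` with respect to discrete convolution. -/
noncomputable def convExp (c : G → 𝕜) (x : G) : 𝕜 :=
  ∑' n : ℕ, discreteConvPow c n x / (n.factorial : 𝕜)

lemma summable_shear {f : G × G → 𝕜} :
    Summable (fun p : G × G => f (p.1 - p.2, p.2)) ↔ Summable f := by
  let e : G × G ≃ G × G :=
    ⟨fun p => (p.1 - p.2, p.2), fun p => (p.1 + p.2, p.2), fun p => by simp, fun p => by simp⟩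
  exact e.summable_iff (f := f)

lemma tsum_shear (f : G × G → 𝕜) :
    ∑' p : G × G, f (p.1 - p.2, p.2) = ∑' p, f p := by
  let e : G × G ≃ G × G :=
    ⟨fun p => (p.1 - p.2, p.2), fun p => (p.1 + p.2, p.2), fun p => by simp, fun p => by simp⟩
  exact e.tsum_eq f

/-- The shear (x, z) ↦ (x - z, z) is a bijection, so a convolution is the product family u(x)v(z)
rearranged; summability and multiplicativity of the total mass both come from this. -/
lemma summable_conv_prod {u v : G → 𝕜} (hu : Summable u) (hv : Summable v) :
    Summable fun p : G × G => u (p.1 - p.2) * v p.2 :=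
  (summable_shear (f := fun p : G × G => u p.1 * v p.2)).2
    (summable_mul_of_summable_norm hu.norm hv.norm)

lemma summable_conv_fiber {u v : G → 𝕜} (hu : Summable u) (hv : Summable v) (x : G) :
    Summable fun z => u (x - z) * v z :=
  (summable_conv_prod hu hv).prod_factor x

lemma summable_discreteConv {u v : G → 𝕜} (hu : Summable u) (hv : Summable v) :
    Summable (discreteConv u v) :=
  (summable_conv_prod hu hv).prod

lemma tsum_discreteConv {u v : G → 𝕜} (hu : Summable u) (hv : Summable v) :
    ∑' x, discreteConv u v x = (∑' x, u x) * ∑' x, v x := by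
  rw [tsum_mul_tsum_of_summable_norm hu.norm hv.norm,
    ← tsum_shear (f := fun p : G × G => u p.1 * v p.2),
    (summable_conv_prod hu hv).tsum_prod]
  rfl

lemma norm_discreteConv_le {u v : G → 𝕜} (hu : Summable u) (hv : Summable v) (x : G) :
    ‖discreteConv u v x‖ ≤ discreteConv (fun z => ‖u z‖) (fun z => ‖v z‖) x := by
  have h := (summable_conv_fiber hu hv x).norm
  refine (norm_tsum_le_tsum_norm h).trans (le_of_eq ?_)
  simp only [discreteConv, norm_mul]

lemma tsum_norm_discreteConv_le {u v : G → 𝕜} (hu : Summable u) (hv : Summable v) :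
    ∑' x, ‖discreteConv u v x‖ ≤ (∑' x, ‖u x‖) * ∑' x, ‖v x‖ := by
  rw [← tsum_discreteConv hu.norm hv.norm]
  exact (summable_discreteConv hu hv).norm.tsum_le_tsum (norm_discreteConv_le hu hv)
    (summable_discreteConv hu.norm hv.norm)

lemma summable_discreteConvPow {c : G → 𝕜} (hc : Summable c) (n : ℕ) :
    Summable (discreteConvPow c n) := by
  induction n with
  | zero =>
    refine summable_of_ne_finset_zero (s := {0}) fun x hx => ?_
    simp_all [discreteConvPow]
  | succ n ih => exact summable_discreteConv ih hc

lemma tsum_discreteConvPow {c : G → 𝕜} (hc : Summable c) (n : ℕ) :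
    ∑' x, discreteConvPow c n x = (∑' x, c x) ^ n := by
  induction n with
  | zero => simp [discreteConvPow, tsum_ite_eq]
  | succ n ih =>
    rw [discreteConvPow, tsum_discreteConv (summable_discreteConvPow hc n) hc, ih, pow_succ]

lemma tsum_norm_discreteConvPow_le {c : G → 𝕜} (hc : Summable c) (n : ℕ) :
    ∑' x, ‖discreteConvPow c n x‖ ≤ (∑' x, ‖c x‖) ^ n := by
  induction n with
  | zero =>
    refine le_of_eq ?_
    rw [tsum_eq_single (0 : G) (by intro b hb; simp [discreteConvPow, hb])]
    simp [discreteConvPow]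
  | succ n ih =>
    rw [discreteConvPow, pow_succ]
    refine (tsum_norm_discreteConv_le (summable_discreteConvPow hc n) hc).trans ?_
    gcongr

lemma summable_convExp_prod {c : G → 𝕜} (hc : Summable c) :
    Summable fun p : ℕ × G => discreteConvPow c p.1 p.2 / (p.1.factorial : 𝕜) := by
  have h1 (n : ℕ) : Summable fun x => ‖discreteConvPow c n x / (n.factorial : 𝕜)‖ :=
    ((summable_discreteConvPow hc n).div_const (n.factorial : 𝕜)).norm
  have h2 : Summable fun n : ℕ => ∑' x, ‖discreteConvPow c n x / (n.factorial : 𝕜)‖ := by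
    refine Summable.of_nonneg_of_le (fun n => tsum_nonneg fun _ => norm_nonneg _) (fun n => ?_)
      (Real.summable_pow_div_factorial (∑' x, ‖c x‖))
    simp only [norm_div, tsum_div_const, RCLike.norm_natCast]
    gcongr
    exact tsum_norm_discreteConvPow_le hc n
  exact Summable.of_norm
    ((summable_prod_of_nonneg (f := fun p : ℕ × G =>
      ‖discreteConvPow c p.1 p.2 / (p.1.factorial : 𝕜)‖) (fun _ => norm_nonneg _)).2 ⟨h1, h2⟩)

lemma summable_convExp_fiber {c : G → 𝕜} (hc : Summable c) (x : G) :
    Summable fun n : ℕ => discreteConvPow c n x / (n.factorial : 𝕜) :=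
  (summable_convExp_prod hc).prod_symm.prod_factor x

lemma summable_convExp {c : G → 𝕜} (hc : Summable c) : Summable (convExp c) :=
  (summable_convExp_prod hc).prod_symm.prod

/-- Total mass is multiplicative under convolution, so summing over the group before summing over n
leaves the scalar exponential series. -/
lemma tsum_convExp {c : G → 𝕜} (hc : Summable c) :
    ∑' x, convExp c x = NormedSpace.exp (∑' x, c x) := by
  have h := summable_convExp_prod hc
  have h1 : ∑' x, convExp c x
      = ∑' p : G × ℕ, discreteConvPow c p.2 p.1 / (p.2.factorial : 𝕜) :=
    (h.prod_symm.tsum_prod).symm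
  have h2 : ∑' p : G × ℕ, discreteConvPow c p.2 p.1 / (p.2.factorial : 𝕜)
      = ∑' p : ℕ × G, discreteConvPow c p.1 p.2 / (p.1.factorial : 𝕜) :=
    (Equiv.prodComm G ℕ).tsum_eq
      (fun p : ℕ × G => discreteConvPow c p.1 p.2 / (p.1.factorial : 𝕜))
  rw [h1, h2, h.tsum_prod]
  simp only [tsum_div_const, tsum_discreteConvPow hc]
  rw [NormedSpace.exp_eq_tsum_div]

/-- Twisting by a character commutes with convolution. -/
lemma discreteConv_character {χ : G → 𝕜} (hχ : ∀ x y, χ (x + y) = χ x * χ y) (u v : G → 𝕜)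
    (x : G) :
    discreteConv (fun z => u z * χ z) (fun z => v z * χ z) x = discreteConv u v x * χ x := by
  rw [discreteConv, discreteConv, ← tsum_mul_right]
  refine tsum_congr fun z => ?_
  have : χ x = χ (x - z) * χ z := by rw [← hχ, sub_add_cancel]
  rw [this]; ring

lemma discreteConvPow_character {χ : G → 𝕜} (h0 : χ 0 = 1)
    (hχ : ∀ x y, χ (x + y) = χ x * χ y) (c : G → 𝕜) (n : ℕ) (x : G) :
    discreteConvPow (fun z => c z * χ z) n x = discreteConvPow c n x * χ x := by
  induction n generalizing x with
  | zero =>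
    by_cases hx : x = 0
    · simp [discreteConvPow, hx, h0]
    · simp [discreteConvPow, hx]
  | succ n ih =>
    rw [discreteConvPow, discreteConvPow, ← discreteConv_character hχ]
    congr 1
    funext z
    exact ih z

lemma convExp_character {χ : G → 𝕜} (h0 : χ 0 = 1)
    (hχ : ∀ x y, χ (x + y) = χ x * χ y) (c : G → 𝕜) (x : G) :
    convExp (fun z => c z * χ z) x = convExp c x * χ x := by
  rw [convExp, convExp, ← tsum_mul_right]
  refine tsum_congr fun n => ?_
  rw [discreteConvPow_character h0 hχ]; ring

/-- Only summability of c·χ is required, so χ may be unbounded. Unitary characters give Fourier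
transforms; real exponentials give the exponential moments in `truncatedWalk_exp_moment`. -/
lemma tsum_convExp_character {χ : G → 𝕜} (h0 : χ 0 = 1)
    (hχ : ∀ x y, χ (x + y) = χ x * χ y) {c : G → 𝕜} (hc : Summable fun z => c z * χ z) :
    ∑' x, convExp c x * χ x = NormedSpace.exp (∑' z, c z * χ z) := by
  simp_rw [← convExp_character h0 hχ c]
  exact tsum_convExp hc

lemma summable_convExp_character {χ : G → 𝕜} (h0 : χ 0 = 1)
    (hχ : ∀ x y, χ (x + y) = χ x * χ y) {c : G → 𝕜} (hc : Summable fun z => c z * χ z) :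
    Summable fun x => convExp c x * χ x := by
  simp_rw [← convExp_character h0 hχ c]
  exact summable_convExp hc

section Real

variable {u v c : G → ℝ}

lemma discreteConv_nonneg (hu : ∀ x, 0 ≤ u x) (hv : ∀ x, 0 ≤ v x) (x : G) :
    0 ≤ discreteConv u v x :=
  tsum_nonneg fun _ => mul_nonneg (hu _) (hv _)

lemma discreteConvPow_nonneg (hc : ∀ x, 0 ≤ c x) (n : ℕ) (x : G) :
    0 ≤ discreteConvPow c n x := by
  induction n generalizing x with
  | zero => unfold discreteConvPow; split_ifs <;> norm_num
  | succ n ih => exact discreteConv_nonneg ih hc x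

lemma convExp_nonneg (hc : ∀ x, 0 ≤ c x) (x : G) : 0 ≤ convExp c x :=
  tsum_nonneg fun _ => div_nonneg (discreteConvPow_nonneg hc _ _) (by positivity)

lemma discreteConv_ofReal (u v : G → ℝ) (x : G) :
    discreteConv (fun z => (u z : ℂ)) (fun z => (v z : ℂ)) x = ((discreteConv u v x : ℝ) : ℂ) := by
  simp [discreteConv, Complex.ofReal_tsum]

lemma discreteConvPow_ofReal (c : G → ℝ) (n : ℕ) (x : G) :
    discreteConvPow (fun z => (c z : ℂ)) n x = ((discreteConvPow c n x : ℝ) : ℂ) := by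
  induction n generalizing x with
  | zero => by_cases hx : x = 0 <;> simp [discreteConvPow, hx]
  | succ n ih =>
    rw [discreteConvPow, discreteConvPow, ← discreteConv_ofReal]
    congr 1
    funext z
    exact ih z

lemma convExp_ofReal (c : G → ℝ) (x : G) :
    convExp (fun z => (c z : ℂ)) x = ((convExp c x : ℝ) : ℂ) := by
  simp [convExp, Complex.ofReal_tsum, discreteConvPow_ofReal]

/-- Pointwise bound on convolution powers through the supremum and the total mass. -/
lemma discreteConvPow_succ_le (hc0 : ∀ x, 0 ≤ c x) (hc : Summable c) {M : ℝ}
    (hM : ∀ x, c x ≤ M) (n : ℕ) (x : G) :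
    discreteConvPow c (n + 1) x ≤ M * (∑' z, c z) ^ n := by
  rw [discreteConvPow, ← tsum_discreteConvPow hc n, ← tsum_mul_left,
    ← (Equiv.subLeft x).tsum_eq (fun z => M * discreteConvPow c n z)]
  refine (summable_conv_fiber (summable_discreteConvPow hc n) hc x).tsum_le_tsum (fun z => ?_) ?_
  · rw [mul_comm M]
    exact mul_le_mul_of_nonneg_left (hM z) (discreteConvPow_nonneg hc0 n _)
  · exact (Equiv.subLeft x).summable_iff.2 ((summable_discreteConvPow hc n).mul_left M)

lemma discreteConvPow_one (x : G) : discreteConvPow c 1 x = c x := by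
  rw [discreteConvPow, discreteConv, tsum_eq_single x]
  · simp [discreteConvPow]
  · intro z hz
    have : x - z ≠ 0 := sub_ne_zero.2 (Ne.symm hz)
    simp [discreteConvPow, this]

open Classical in
/-- Second-order remainder in the convolution exponential. -/
lemma convExp_remainder (hc0 : ∀ x, 0 ≤ c x) (hc : Summable c) {M : ℝ}
    (hM : ∀ x, c x ≤ M) (x : G) :
    0 ≤ convExp c x - (if x = 0 then 1 else 0) - c x ∧
      convExp c x - (if x = 0 then 1 else 0) - c x ≤ M * (Real.exp (∑' z, c z) - 1) := by
  set Λ := ∑' z, c z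
  have hΛ : 0 ≤ Λ := tsum_nonneg hc0
  have hM0 : 0 ≤ M := (hc0 0).trans (hM 0)
  have hs := summable_convExp_fiber hc x
  have h1 : convExp c x - (if x = 0 then 1 else 0) - c x
      = ∑' n : ℕ, discreteConvPow c (n + 2) x / ((n + 2).factorial : ℝ) := by
    rw [convExp, ← hs.sum_add_tsum_nat_add 2]
    simp only [Finset.sum_range_succ, Finset.sum_range_zero, discreteConvPow_one]
    simp only [discreteConvPow]
    simp only [Nat.factorial]
    norm_num
    ring
  have hs2 := (summable_nat_add_iff 2).2 hs
  have he : Real.exp Λ - 1 = ∑' n : ℕ, Λ ^ (n + 1) / ((n + 1).factorial : ℝ) := by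
    rw [Real.exp_eq_exp_ℝ, NormedSpace.exp_eq_tsum_div]
    beta_reduce
    rw [← (Real.summable_pow_div_factorial Λ).sum_add_tsum_nat_add 1]
    simp
  have hs3 := (summable_nat_add_iff 1).2 (Real.summable_pow_div_factorial Λ)
  rw [h1]
  refine ⟨tsum_nonneg fun n => div_nonneg (discreteConvPow_nonneg hc0 _ _) (by positivity), ?_⟩
  rw [he, ← tsum_mul_left]
  refine hs2.tsum_le_tsum (fun n => ?_) (hs3.mul_left M)
  rw [mul_div_assoc']
  -- Weakening (n+2)! to (n+1)! turns the majorant into the series of e^Λ without its constant term.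
  have hle : (((n + 1).factorial : ℕ) : ℝ) ≤ ((n + 2).factorial : ℕ) := by
    exact_mod_cast Nat.factorial_le (by omega)
  refine div_le_div₀ (by positivity) (discreteConvPow_succ_le hc0 hc hM (n + 1) x)
    (by positivity) hle

end Real

end Convolution

/-! ### Fourier series on the lattice -/

section LatticeFourier

variable {d : ℕ}

lemma latticeVec_add (x y : Fin d → ℤ) : latticeVec (x + y) = latticeVec x + latticeVec y := by
  ext i; simp [latticeVec]

lemma latticeVec_neg (x : Fin d → ℤ) : latticeVec (-x) = -latticeVec x := by
  ext i; simp [latticeVec]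

lemma latticeVec_sub (x y : Fin d → ℤ) : latticeVec (x - y) = latticeVec x - latticeVec y := by
  ext i; simp [latticeVec]

lemma latticeVec_zero : latticeVec (0 : Fin d → ℤ) = 0 := by
  ext i; simp [latticeVec]

/-- The character `z ↦ e^{i(k,z)}` of the lattice. -/
noncomputable def latticeChar (k : EuclideanSpace ℝ (Fin d)) (z : Fin d → ℤ) : ℂ :=
  Complex.exp (Complex.I * ((inner ℝ k (latticeVec z) : ℝ) : ℂ))

lemma latticeChar_zero (k : EuclideanSpace ℝ (Fin d)) : latticeChar k 0 = 1 := by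
  simp [latticeChar, latticeVec_zero]

lemma latticeChar_add (k : EuclideanSpace ℝ (Fin d)) (z w : Fin d → ℤ) :
    latticeChar k (z + w) = latticeChar k z * latticeChar k w := by
  simp [latticeChar, latticeVec_add, inner_add_right, mul_add, Complex.exp_add]

lemma latticeChar_add_left (k h : EuclideanSpace ℝ (Fin d)) (z : Fin d → ℤ) :
    latticeChar (k + h) z = latticeChar k z * latticeChar h z := by
  simp [latticeChar, inner_add_left, mul_add, Complex.exp_add]

lemma norm_latticeChar (k : EuclideanSpace ℝ (Fin d)) (z : Fin d → ℤ) :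
    ‖latticeChar k z‖ = 1 := by
  rw [latticeChar, mul_comm, Complex.norm_exp_ofReal_mul_I]

lemma continuous_latticeChar (z : Fin d → ℤ) :
    Continuous fun k : EuclideanSpace ℝ (Fin d) => latticeChar k z := by
  unfold latticeChar; fun_prop

/-- The fundamental cube `[-π, π]^d`. -/
def piCube (d : ℕ) : Set (EuclideanSpace ℝ (Fin d)) := {k | ∀ i, |k i| ≤ Real.pi}

lemma isCompact_piCube : IsCompact (piCube d) := by
  have h : piCube d = (WithLp.toLp 2) '' (Set.Icc (fun _ : Fin d => -Real.pi) fun _ => Real.pi) := by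
    ext k
    constructor
    · intro hk
      exact ⟨WithLp.ofLp k, ⟨fun i => (abs_le.1 (hk i)).1, fun i => (abs_le.1 (hk i)).2⟩, rfl⟩
    · rintro ⟨y, hy, rfl⟩ i
      exact abs_le.2 ⟨hy.1 i, hy.2 i⟩
  rw [h]
  exact isCompact_Icc.image (PiLp.continuous_toLp 2 _)

lemma measurableSet_piCube : MeasurableSet (piCube d) := isCompact_piCube.isClosed.measurableSet

lemma integral_exp_int_mul (n : ℤ) :
    ∫ x in Set.Icc (-Real.pi) Real.pi, Complex.exp (Complex.I * ((x * n : ℝ) : ℂ))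
      = if n = 0 then ((2 * Real.pi : ℝ) : ℂ) else 0 := by
  have hpi := Real.pi_pos
  rw [integral_Icc_eq_integral_Ioc, ← intervalIntegral.integral_of_le (by linarith)]
  split_ifs with hn
  · simp [hn]; ring
  · have hc : Complex.I * (n : ℂ) ≠ 0 := by simp [hn, Complex.I_ne_zero]
    have h1 : ∀ x : ℝ, Complex.exp (Complex.I * ((x * n : ℝ) : ℂ))
        = Complex.exp (Complex.I * (n : ℂ) * x) := by
      intro x; congr 1; push_cast; ring
    simp_rw [h1]
    rw [integral_exp_mul_complex hc]
    have h2 : Complex.exp (Complex.I * (n : ℂ) * (Real.pi : ℝ))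
        = Complex.exp (Complex.I * (n : ℂ) * ((-Real.pi : ℝ) : ℂ)) := by
      rw [Complex.exp_eq_exp_iff_exists_int]
      exact ⟨n, by push_cast; ring⟩
    rw [h2]; simp

lemma integral_latticeChar (z : Fin d → ℤ) :
    ∫ k in piCube d, latticeChar k z = if z = 0 then ((2 * Real.pi) ^ d : ℂ) else 0 := by
  rw [← integral_indicator measurableSet_piCube,
    ← (PiLp.volume_preserving_toLp (Fin d)).integral_comp
      (MeasurableEquiv.toLp 2 (Fin d → ℝ)).measurableEmbedding]
  have h : ∀ y : Fin d → ℝ, (piCube d).indicator (fun k => latticeChar k z) (WithLp.toLp 2 y)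
      = ∏ i, (Set.Icc (-Real.pi) Real.pi).indicator
        (fun x : ℝ => Complex.exp (Complex.I * ((x * z i : ℝ) : ℂ))) (y i) := by
    intro y
    by_cases hy : WithLp.toLp 2 y ∈ piCube d
    · rw [Set.indicator_of_mem hy]
      have hy' : ∀ i, y i ∈ Set.Icc (-Real.pi) Real.pi := fun i => abs_le.1 (hy i)
      simp_rw [Set.indicator_of_mem (hy' _)]
      rw [← Complex.exp_sum, latticeChar, ← Finset.mul_sum]
      congr 2
      simp [latticeVec, PiLp.inner_apply, mul_comm]
    · rw [Set.indicator_of_notMem hy]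
      have : ∃ i, y i ∉ Set.Icc (-Real.pi) Real.pi := by
        by_contra hcon
        push Not at hcon
        exact hy fun i => abs_le.2 (hcon i)
      obtain ⟨i, hi⟩ := this
      rw [Finset.prod_eq_zero (Finset.mem_univ i)]
      rw [Set.indicator_of_notMem hi]
  simp_rw [h]
  rw [integral_fintype_prod_volume_eq_prod (fun i => (Set.Icc (-Real.pi) Real.pi).indicator
        (fun x : ℝ => Complex.exp (Complex.I * ((x * z i : ℝ) : ℂ))))]
  simp_rw [integral_indicator measurableSet_Icc, integral_exp_int_mul]
  split_ifs with hz
  · simp [hz]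
  · obtain ⟨i, hi⟩ := Function.ne_iff.1 hz
    exact Finset.prod_eq_zero (Finset.mem_univ i) (by simpa using hi)

/-- The Fourier series with coefficients `u`. -/
noncomputable def latticeFourier (u : (Fin d → ℤ) → ℂ) (k : EuclideanSpace ℝ (Fin d)) : ℂ :=
  ∑' z, u z * latticeChar k z

lemma summable_mul_latticeChar {u : (Fin d → ℤ) → ℂ} (hu : Summable u)
    (k : EuclideanSpace ℝ (Fin d)) : Summable fun z => u z * latticeChar k z := by
  refine Summable.of_norm ?_
  simp_rw [norm_mul, norm_latticeChar, mul_one]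
  exact hu.norm

lemma continuous_latticeFourier {u : (Fin d → ℤ) → ℂ} (hu : Summable u) :
    Continuous (latticeFourier u) := by
  refine continuous_tsum (fun z => (continuous_latticeChar z).const_mul _) hu.norm fun z k => ?_
  simp [norm_latticeChar]

/-- Recovering the coefficients of an absolutely convergent Fourier series. -/
lemma coeff_latticeFourier {u : (Fin d → ℤ) → ℂ} (hu : Summable u) (x : Fin d → ℤ) :
    ∫ k in piCube d, latticeFourier u k * latticeChar k (-x) = (2 * Real.pi) ^ d * u x := by
  have hfin : IsFiniteMeasure (volume.restrict (piCube d)) :=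
    ⟨by simpa using isCompact_piCube.measure_lt_top⟩
  have h1 : ∀ k, latticeFourier u k * latticeChar k (-x)
      = ∑' z, u z * latticeChar k (z - x) := by
    intro k
    rw [latticeFourier, ← tsum_mul_right]
    refine tsum_congr fun z => ?_
    rw [sub_eq_add_neg, latticeChar_add]; ring
  simp_rw [h1]
  have h2 := hasSum_integral_of_summable_integral_norm (μ := volume.restrict (piCube d))
    (F := fun z k => u z * latticeChar k (z - x))
    (fun z => ((continuous_latticeChar (z - x)).const_mul _).continuousOn.integrableOn_compact
      isCompact_piCube) (by
      simp_rw [norm_mul, norm_latticeChar, mul_one, integral_const]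
      exact hu.norm.mul_left _)
  rw [← h2.tsum_eq, tsum_eq_single x]
  · rw [integral_const_mul, integral_latticeChar]; simp [mul_comm]
  · intro z hz
    rw [integral_const_mul, integral_latticeChar, if_neg (sub_ne_zero.2 hz), mul_zero]

lemma latticeFourier_injective {u v : (Fin d → ℤ) → ℂ} (hu : Summable u) (hv : Summable v)
    (h : ∀ k, latticeFourier u k = latticeFourier v k) : u = v := by
  funext x
  have h1 := coeff_latticeFourier hu x
  simp_rw [h, coeff_latticeFourier hv x] at h1
  have hp : ((2 * Real.pi) ^ d : ℂ) ≠ 0 :=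
    pow_ne_zero _ (mul_ne_zero two_ne_zero (by exact_mod_cast Real.pi_ne_zero))
  exact (mul_left_cancel₀ hp h1).symm

lemma latticeFourier_discreteConv {u v : (Fin d → ℤ) → ℂ} (hu : Summable u) (hv : Summable v)
    (k : EuclideanSpace ℝ (Fin d)) :
    latticeFourier (discreteConv u v) k = latticeFourier u k * latticeFourier v k := by
  rw [latticeFourier, latticeFourier, latticeFourier,
    ← tsum_discreteConv (summable_mul_latticeChar hu k) (summable_mul_latticeChar hv k)]
  exact tsum_congr fun x => (discreteConv_character (latticeChar_add k) u v x).symm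

lemma latticeFourier_convExp {u : (Fin d → ℤ) → ℂ} (hu : Summable u)
    (k : EuclideanSpace ℝ (Fin d)) :
    latticeFourier (convExp u) k = Complex.exp (latticeFourier u k) := by
  rw [latticeFourier, tsum_convExp_character (latticeChar_zero k) (latticeChar_add k)
    (summable_mul_latticeChar hu k), Complex.exp_eq_exp_ℂ, latticeFourier]

lemma latticeFourier_add {u v : (Fin d → ℤ) → ℂ} (hu : Summable u) (hv : Summable v)
    (k : EuclideanSpace ℝ (Fin d)) :
    latticeFourier (fun z => u z + v z) k = latticeFourier u k + latticeFourier v k := by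
  simp_rw [latticeFourier, add_mul]
  exact (summable_mul_latticeChar hu k).tsum_add (summable_mul_latticeChar hv k)

/-- The convolution exponential turns sums into convolutions. -/
lemma convExp_add {u v : (Fin d → ℤ) → ℝ} (hu : Summable u) (hv : Summable v) :
    convExp (fun z => u z + v z) = discreteConv (convExp u) (convExp v) := by
  have hu' : Summable fun z => (u z : ℂ) := Complex.summable_ofReal.2 hu
  have hv' : Summable fun z => (v z : ℂ) := Complex.summable_ofReal.2 hv
  have h : convExp (fun z => (u z : ℂ) + (v z : ℂ))
      = discreteConv (convExp fun z => (u z : ℂ)) (convExp fun z => (v z : ℂ)) := by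
    -- Both sides have the Fourier series e^{û+v̂}, and an absolutely convergent series determines
    -- its coefficients; no binomial expansion of convolution powers is needed.
    refine latticeFourier_injective (summable_convExp (hu'.add hv'))
      (summable_discreteConv (summable_convExp hu') (summable_convExp hv')) fun k => ?_
    rw [latticeFourier_convExp (hu'.add hv'), latticeFourier_add hu' hv', Complex.exp_add,
      latticeFourier_discreteConv (summable_convExp hu') (summable_convExp hv'),
      latticeFourier_convExp hu', latticeFourier_convExp hv']
  funext x
  have h1 := congrFun h x
  simp_rw [← Complex.ofReal_add] at h1
  rw [convExp_ofReal (fun z => u z + v z), funext (convExp_ofReal u), funext (convExp_ofReal v),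
    discreteConv_ofReal] at h1
  exact_mod_cast h1

lemma summable_mul_latticeChar_sub_one {u : (Fin d → ℤ) → ℂ} (hu : Summable u)
    (h : EuclideanSpace ℝ (Fin d)) : Summable fun z => u z * (latticeChar h z - 1) := by
  simp_rw [mul_sub, mul_one]
  exact (summable_mul_latticeChar hu h).sub hu

lemma fwdDiff_latticeFourier {u : (Fin d → ℤ) → ℂ} (hu : Summable u)
    (h : EuclideanSpace ℝ (Fin d)) :
    fwdDiff h (latticeFourier u) = latticeFourier fun z => u z * (latticeChar h z - 1) := by
  funext k
  simp_rw [fwdDiff, latticeFourier]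
  rw [← (summable_mul_latticeChar hu (k + h)).tsum_sub (summable_mul_latticeChar hu k)]
  refine tsum_congr fun z => ?_
  rw [latticeChar_add_left]; ring

/-- Iterated differences of a Fourier series multiply the coefficients by `(e^{i(h,z)} - 1)^m`. -/
lemma fwdDiff_iter_latticeFourier (m : ℕ) {u : (Fin d → ℤ) → ℂ} (hu : Summable u)
    (h : EuclideanSpace ℝ (Fin d)) :
    Summable (fun z => u z * (latticeChar h z - 1) ^ m) ∧
    (fwdDiff h)^[m] (latticeFourier u)
      = latticeFourier fun z => u z * (latticeChar h z - 1) ^ m := by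
  induction m generalizing u with
  | zero => simpa using hu
  | succ m ih =>
    have := ih (summable_mul_latticeChar_sub_one hu h)
    simp_rw [pow_succ', ← mul_assoc]
    rw [Function.iterate_succ_apply, fwdDiff_latticeFourier hu]
    exact this

/-- Averaging the terms at z and -z cancels the sines, because the law is symmetric. -/
lemma latticeFourier_jumpLaw {a : (Fin d → ℤ) → ℝ} (ha : IsSymmetricJumpLaw a)
    (k : EuclideanSpace ℝ (Fin d)) :
    latticeFourier (fun z => (a z : ℂ)) k = (jumpFourier a k : ℂ) := by
  have hs : Summable fun z => (a z : ℂ) := Complex.summable_ofReal.2 ha.hasSum_one.summable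
  have h1 := summable_mul_latticeChar hs k
  have h2 : latticeFourier (fun z => (a z : ℂ)) k = ∑' z, (a z : ℂ) * latticeChar k (-z) := by
    rw [latticeFourier, ← (Equiv.neg (Fin d → ℤ)).tsum_eq]
    simp [ha.symm]
  have h1' : Summable fun z => (a z : ℂ) * latticeChar k (-z) := by
    have := (Equiv.neg (Fin d → ℤ)).summable_iff.2 h1
    simpa [Function.comp_def, ha.symm] using this
  have h3 : 2 * latticeFourier (fun z => (a z : ℂ)) k = 2 * (jumpFourier a k : ℂ) := by
    rw [two_mul]
    nth_rw 2 [h2]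
    rw [latticeFourier, ← h1.tsum_add h1', jumpFourier, Complex.ofReal_tsum, ← tsum_mul_left]
    refine tsum_congr fun z => ?_
    rw [latticeChar, latticeChar, latticeVec_neg, inner_neg_right]
    push_cast
    rw [Complex.cos]
    rw [show Complex.I * -((inner ℝ k (latticeVec z) : ℝ) : ℂ)
      = -((inner ℝ k (latticeVec z) : ℝ) : ℂ) * Complex.I by ring,
      mul_comm Complex.I]
    ring
  exact mul_left_cancel₀ two_ne_zero h3

end LatticeFourier

/-! ### Transition probabilities as a convolution exponential -/

section TransitionProbability

variable {d : ℕ} {a : (Fin d → ℤ) → ℝ}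

lemma jumpConvPow_eq (a : (Fin d → ℤ) → ℝ) (n : ℕ) : jumpConvPow a n = discreteConvPow a n := by
  induction n with
  | zero => funext x; simp [jumpConvPow, discreteConvPow]
  | succ n ih => funext x; simp [jumpConvPow, discreteConvPow, discreteConv, ih]

lemma discreteConvPow_const_mul (t : ℝ) (a : (Fin d → ℤ) → ℝ) (n : ℕ) (x : Fin d → ℤ) :
    discreteConvPow (fun z => t * a z) n x = t ^ n * discreteConvPow a n x := by
  induction n generalizing x with
  | zero => simp [discreteConvPow]
  | succ n ih =>
    simp only [discreteConvPow, discreteConv, ih, ← tsum_mul_left]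
    exact tsum_congr fun z => by ring

lemma transitionProb_eq (a : (Fin d → ℤ) → ℝ) (t : ℝ) (x : Fin d → ℤ) :
    transitionProb a t x = Real.exp (-t) * convExp (fun z => t * a z) x := by
  rw [transitionProb, convExp, ← tsum_mul_left]
  refine tsum_congr fun n => ?_
  rw [jumpConvPow_eq, discreteConvPow_const_mul]; ring

lemma summable_transitionProb (ha : Summable a) (t : ℝ) : Summable (transitionProb a t) := by
  rw [funext (transitionProb_eq a t)]
  exact (summable_convExp (ha.mul_left t)).mul_left _

/-- Fourier representation of the transition probabilities. -/
lemma integral_transitionProb (ha : IsSymmetricJumpLaw a) (t : ℝ) (x : Fin d → ℤ) :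
    ∫ k in piCube d, (Real.exp (-(t * (1 - jumpFourier a k))) : ℂ) * latticeChar k (-x)
      = (2 * Real.pi) ^ d * (transitionProb a t x : ℂ) := by
  have hs : Summable fun z => ((t * a z : ℝ) : ℂ) :=
    Complex.summable_ofReal.2 (ha.hasSum_one.summable.mul_left t)
  have hp : Summable fun z => (transitionProb a t z : ℂ) :=
    Complex.summable_ofReal.2 (summable_transitionProb ha.hasSum_one.summable t)
  rw [← coeff_latticeFourier hp]
  congr 1
  funext k
  congr 1
  have h1 : latticeFourier (fun z => ((t * a z : ℝ) : ℂ)) k = t * (jumpFourier a k : ℂ) := by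
    rw [← latticeFourier_jumpLaw ha, latticeFourier, latticeFourier, ← tsum_mul_left]
    exact tsum_congr fun z => by push_cast; ring
  have h2 : latticeFourier (fun z => (transitionProb a t z : ℂ)) k
      = Complex.exp (-t) * latticeFourier (convExp fun z => ((t * a z : ℝ) : ℂ)) k := by
    rw [latticeFourier, latticeFourier, ← tsum_mul_left]
    refine tsum_congr fun z => ?_
    rw [transitionProb_eq, convExp_ofReal fun z => t * a z]
    push_cast; ring
  rw [h2, latticeFourier_convExp hs, h1, ← Complex.exp_add]
  push_cast
  congr 1; ring

end TransitionProbability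

universe u

/-! ### Bounds on iterated finite differences -/

section FiniteDifferences

lemma hasFDerivAt_fwdDiff_iter {V W : Type*} [NormedAddCommGroup V] [NormedSpace ℝ V]
    [NormedAddCommGroup W] [NormedSpace ℝ W] {g : V → W} {g' : V → V →L[ℝ] W} (h : V) (n : ℕ)
    {k : V} (hg : ∀ j ≤ n, HasFDerivAt g (g' (k + j • h)) (k + j • h)) :
    HasFDerivAt ((fwdDiff h)^[n] g) ((fwdDiff h)^[n] g' k) k := by
  have h1 : (fwdDiff h)^[n] g = fun y => ∑ j ∈ Finset.range (n + 1),
      ((-1 : ℤ) ^ (n - j) * (n.choose j : ℤ)) • g (y + j • h) :=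
    funext fun y => fwdDiff_iter_eq_sum_shift h g n y
  rw [h1, fwdDiff_iter_eq_sum_shift]
  refine HasFDerivAt.fun_sum fun j hj => ?_
  have h2 := (hasFDerivAt_comp_add_right (j • h)).2 (hg j (by simpa [Nat.lt_succ_iff] using hj))
  have h3 := h2.const_smul (((-1 : ℤ) ^ (n - j) * (n.choose j : ℤ) : ℤ) : ℝ)
  simp only [Int.cast_smul_eq_zsmul] at h3
  exact h3

/-- The `n`-th difference of a `C^n` function with step `h` is locally `O(‖h‖^n)`. -/
lemma fwdDiff_iter_le_of_contDiffOn {V : Type u} [NormedAddCommGroup V] [NormedSpace ℝ V]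
    {U : Set V} (hU : IsOpen U) (n : ℕ) {W : Type u}
    [NormedAddCommGroup W] [NormedSpace ℝ W] {g : V → W} (hg : ContDiffOn ℝ n g U) {u : V}
    (hu : u ∈ U) :
    ∃ r > 0, ∃ C : ℝ, 0 ≤ C ∧
      ∀ k ∈ Metric.ball u r, ∀ h : V, ‖h‖ ≤ r → ‖(fwdDiff h)^[n] g k‖ ≤ C * ‖h‖ ^ n := by
  induction n generalizing W with
  | zero =>
    have hc : ContinuousAt g u := (hg.continuousOn).continuousAt (hU.mem_nhds hu)
    obtain ⟨r, hr, hb⟩ := Metric.continuousAt_iff.1 hc 1 one_pos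
    refine ⟨r, hr, ‖g u‖ + 1, by positivity, fun k hk h _ => ?_⟩
    have h1 : ‖g k - g u‖ < 1 := by rw [← dist_eq_norm]; exact hb hk
    have h2 : ‖g k‖ ≤ ‖g u‖ + ‖g k - g u‖ := norm_le_insert' _ _
    simp only [Function.iterate_zero, id, pow_zero, mul_one]
    linarith
  | succ n ih =>
    -- The induction passes from `g` to its derivative, with values in `V →L[ℝ] W`; this is why the
    -- target is generalized and V, W share a universe.
    have hg' : ContDiffOn ℝ n (fderiv ℝ g) U :=
      hg.fderiv_of_isOpen hU (by norm_cast)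
    obtain ⟨r₀, hr₀, C, hC, hb⟩ := ih hg'
    obtain ⟨δ, hδ, hball⟩ := Metric.isOpen_iff.1 hU u hu
    set ρ := min r₀ δ with hρ
    have hρ0 : 0 < ρ := lt_min hr₀ hδ
    have hn : (0 : ℝ) < n + 3 := by positivity
    -- With r = ρ/(n+3), the ball of radius 2r contains k and k + h, and its points shifted by up to
    -- n steps h stay within (n+2)r ≤ ρ of u. The mean value inequality on that convex ball then
    -- gains one factor ‖h‖.
    refine ⟨ρ / (n + 3), by positivity, C, hC, fun k hk h hh => ?_⟩
    have hscale : (n + 3) * (ρ / (n + 3)) = ρ := by field_simp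
    set r := ρ / (n + 3) with hr
    have hr0 : 0 < r := by positivity
    have hnr : 0 ≤ (n : ℝ) * r := by positivity
    rw [Function.iterate_succ_apply', fwdDiff, pow_succ, ← mul_assoc]
    have hder : ∀ y ∈ Metric.ball u (2 * r),
        HasFDerivWithinAt ((fwdDiff h)^[n] g) ((fwdDiff h)^[n] (fderiv ℝ g) y)
          (Metric.ball u (2 * r)) y := by
      intro y hy
      refine (hasFDerivAt_fwdDiff_iter h n fun j hj => ?_).hasFDerivWithinAt
      have hmem : y + j • h ∈ U := by
        refine hball ?_
        rw [Metric.mem_ball, dist_eq_norm] at hy ⊢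
        have h1 : ‖j • h‖ ≤ n * r := by
          refine (norm_nsmul_le).trans ?_
          have : (j : ℝ) ≤ n := by exact_mod_cast hj
          gcongr
        calc ‖y + j • h - u‖ = ‖(y - u) + j • h‖ := by congr 1; abel
          _ ≤ ‖y - u‖ + ‖j • h‖ := norm_add_le _ _
          _ < 2 * r + n * r := by linarith
          _ ≤ ρ := by linarith
          _ ≤ δ := min_le_right _ _
      exact ((hg.differentiableOn (by simp)).differentiableAt (hU.mem_nhds hmem)).hasFDerivAt
    have hbd : ∀ y ∈ Metric.ball u (2 * r), ‖(fwdDiff h)^[n] (fderiv ℝ g) y‖ ≤ C * ‖h‖ ^ n := by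
      intro y hy
      refine hb y (Metric.ball_subset_ball ?_ hy) h ?_
      · have : ρ ≤ r₀ := min_le_left _ _
        linarith
      · have : ρ ≤ r₀ := min_le_left _ _
        linarith
    have hk1 : k ∈ Metric.ball u (2 * r) := Metric.ball_subset_ball (by linarith) hk
    have hk2 : k + h ∈ Metric.ball u (2 * r) := by
      rw [Metric.mem_ball, dist_eq_norm] at hk ⊢
      calc ‖k + h - u‖ = ‖(k - u) + h‖ := by congr 1; abel
        _ ≤ ‖k - u‖ + ‖h‖ := norm_add_le _ _
        _ < 2 * r := by linarith
    have := (convex_ball u (2 * r)).norm_image_sub_le_of_norm_hasFDerivWithin_le hder hbd hk1 hk2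
    simpa using this

/-- Uniform version of the bound on differences over a compact set. -/
lemma fwdDiff_iter_le_of_isCompact {V : Type u} [NormedAddCommGroup V] [NormedSpace ℝ V]
    {U K : Set V} (hU : IsOpen U) (hK : IsCompact K) (hKU : K ⊆ U) (n : ℕ) {W : Type u}
    [NormedAddCommGroup W] [NormedSpace ℝ W] {g : V → W} (hg : ContDiffOn ℝ n g U) :
    ∃ r > 0, ∃ C : ℝ, 0 ≤ C ∧
      ∀ k ∈ K, ∀ h : V, ‖h‖ ≤ r → ‖(fwdDiff h)^[n] g k‖ ≤ C * ‖h‖ ^ n := by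
  refine hK.induction_on (p := fun K => ∃ r > 0, ∃ C : ℝ, 0 ≤ C ∧
      ∀ k ∈ K, ∀ h : V, ‖h‖ ≤ r → ‖(fwdDiff h)^[n] g k‖ ≤ C * ‖h‖ ^ n) ?_ ?_ ?_ ?_
  · exact ⟨1, one_pos, 0, le_rfl, by simp⟩
  · rintro s t hst ⟨r, hr, C, hC, hb⟩
    exact ⟨r, hr, C, hC, fun k hk => hb k (hst hk)⟩
  · rintro s t ⟨r, hr, C, hC, hb⟩ ⟨r', hr', C', hC', hb'⟩
    refine ⟨min r r', lt_min hr hr', C + C', by positivity, ?_⟩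
    rintro k (hk | hk) h hh
    · refine (hb k hk h (hh.trans (min_le_left _ _))).trans ?_
      gcongr; linarith
    · refine (hb' k hk h (hh.trans (min_le_right _ _))).trans ?_
      gcongr; linarith
  · intro x hx
    obtain ⟨r, hr, C, hC, hb⟩ := fwdDiff_iter_le_of_contDiffOn hU n hg (hKU hx)
    exact ⟨Metric.ball x r, mem_nhdsWithin_of_mem_nhds (Metric.ball_mem_nhds x hr), r, hr, C, hC, hb⟩

lemma norm_fwdDiff_iter_le {V W : Type*} [AddCommMonoid V] [NormedAddCommGroup W] {g : V → W}
    (n : ℕ) {h k : V} {M : ℝ} (hM : ∀ j ≤ n, ‖g (k + j • h)‖ ≤ M) :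
    ‖(fwdDiff h)^[n] g k‖ ≤ 2 ^ n * M := by
  induction n generalizing k with
  | zero => simpa using hM 0 le_rfl
  | succ n ih =>
    rw [Function.iterate_succ_apply', fwdDiff]
    have h1 : ‖(fwdDiff h)^[n] g (k + h)‖ ≤ 2 ^ n * M := by
      refine ih fun j hj => ?_
      have := hM (j + 1) (by omega)
      rwa [add_smul, one_smul, add_comm (j • h), ← add_assoc] at this
    have h2 : ‖(fwdDiff h)^[n] g k‖ ≤ 2 ^ n * M := ih fun j hj => hM j (by omega)
    refine (norm_sub_le _ _).trans ?_
    rw [pow_succ]; linarith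

lemma fwdDiff_iter_smul {V W : Type*} [AddCommGroup V] [Module ℝ V] [AddCommGroup W]
    (g : V → W) (c : ℝ) (h k : V) (n : ℕ) :
    (fwdDiff (c • h))^[n] g (c • k) = (fwdDiff h)^[n] (fun y => g (c • y)) k := by
  rw [fwdDiff_iter_eq_sum_shift, fwdDiff_iter_eq_sum_shift]
  refine Finset.sum_congr rfl fun j _ => ?_
  rw [smul_add, smul_comm c j h]

/-- Differences of a positively homogeneous function that is smooth away from the origin. -/
lemma fwdDiff_iter_le_of_homogeneous {V : Type} [NormedAddCommGroup V] [NormedSpace ℝ V]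
    [FiniteDimensional ℝ V] {g : V → ℝ} {β : ℝ} (hβ : 0 < β) (n : ℕ)
    (hg : ContDiffOn ℝ n g {0}ᶜ) (hhom : ∀ c : ℝ, 0 < c → ∀ k, g (c • k) = c ^ β * g k)
    (h0 : g 0 = 0) :
    ∃ C : ℝ, 0 ≤ C ∧ ∀ γ : ℝ, γ ≤ 0 → β - n ≤ γ → ∀ h k : V, k ≠ 0 →
      |(fwdDiff h)^[n] g k| ≤ C * (‖h‖ ^ (β - γ) * ‖k‖ ^ γ) := by
  have hS : IsCompact (Metric.sphere (0 : V) 1) := isCompact_sphere 0 1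
  have hSU : Metric.sphere (0 : V) 1 ⊆ {0}ᶜ := by
    intro x hx hx0
    simp_all
  obtain ⟨r', hr', C₁, hC₁, hb⟩ := fwdDiff_iter_le_of_isCompact isOpen_compl_singleton hS hSU n hg
  obtain ⟨M, hM⟩ := hS.exists_bound_of_continuousOn (hg.continuousOn.mono hSU)
  have hgrow : ∀ k : V, |g k| ≤ max M 0 * ‖k‖ ^ β := by
    intro k
    by_cases hk : k = 0
    · simp [hk, h0, Real.zero_rpow hβ.ne']
    have hk' : 0 < ‖k‖ := norm_pos_iff.2 hk
    have h1 : g k = ‖k‖ ^ β * g (‖k‖⁻¹ • k) := by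
      rw [← hhom _ hk', smul_smul, mul_inv_cancel₀ hk'.ne', one_smul]
    have h2 : ‖g (‖k‖⁻¹ • k)‖ ≤ M := hM _ (by simp [norm_smul, hk'.ne'])
    rw [h1, abs_mul, abs_of_nonneg (by positivity), mul_comm]
    have : |g (‖k‖⁻¹ • k)| ≤ max M 0 := h2.trans (le_max_left _ _)
    gcongr
  set r := min r' 1 with hr
  have hr0 : 0 < r := lt_min hr' one_pos
  have hr1 : r ≤ 1 := min_le_right _ _
  set M₀ := max M 0 with hM₀
  have hM₀0 : 0 ≤ M₀ := le_max_right _ _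
  -- One constant serves every γ in [β-n, 0]: γ trades decay in k against the power of h. Later
  -- choices make ‖k‖^γ integrable either at infinity or at the origin.
  refine ⟨C₁ + 2 ^ n * (M₀ * (r⁻¹ + n) ^ β * r ^ (β - n)), by positivity, fun γ hγ hγ' h k hk => ?_⟩
  have hk' : 0 < ‖k‖ := norm_pos_iff.2 hk
  -- For a step short relative to k, homogeneity moves k to the unit sphere, where the C^n bound
  -- gives (‖h‖/‖k‖)^n. As this ratio is at most 1, the exponent may be lowered to β-γ ≤ n.
  rcases le_or_gt ‖h‖ (r * ‖k‖) with hcase | hcase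
  · have h1 : (fwdDiff h)^[n] g k
        = ‖k‖ ^ β * (fwdDiff (‖k‖⁻¹ • h))^[n] g (‖k‖⁻¹ • k) := by
      have h2 := fwdDiff_iter_smul g ‖k‖ (‖k‖⁻¹ • h) (‖k‖⁻¹ • k) n
      simp only [smul_smul, mul_inv_cancel₀ hk'.ne', one_smul] at h2
      rw [h2]
      have h3 : (fun y => g (‖k‖ • y)) = ‖k‖ ^ β • g := by
        funext y; simp [hhom _ hk']
      rw [h3, fwdDiff_iter_const_smul]
      simp
    have h2 : ‖‖k‖⁻¹ • h‖ = ‖h‖ / ‖k‖ := by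
      rw [norm_smul, norm_inv, norm_norm]; ring
    have h3 : ‖h‖ / ‖k‖ ≤ r := by rw [div_le_iff₀ hk']; exact hcase
    have h4 := hb (‖k‖⁻¹ • k) (by simp [norm_smul, hk'.ne']) (‖k‖⁻¹ • h)
      (by rw [h2]; exact h3.trans (min_le_left _ _))
    rw [h2, Real.norm_eq_abs] at h4
    rcases eq_or_ne h 0 with hh0 | hh0
    · have hn : n ≠ 0 := by
        rintro rfl
        norm_num at hγ'
        linarith
      have h5 : |(fwdDiff (‖k‖⁻¹ • h))^[n] g (‖k‖⁻¹ • k)| ≤ 0 := by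
        simpa [hh0, hn] using h4
      rw [h1, abs_mul, le_antisymm h5 (abs_nonneg _), mul_zero]
      positivity
    have hh' : 0 < ‖h‖ := norm_pos_iff.2 hh0
    have h5 : (‖h‖ / ‖k‖) ^ n ≤ (‖h‖ / ‖k‖) ^ (β - γ) := by
      rw [← Real.rpow_natCast]
      exact Real.rpow_le_rpow_of_exponent_ge (by positivity) (h3.trans hr1) (by linarith)
    rw [h1, abs_mul, abs_of_pos (Real.rpow_pos_of_pos hk' β)]
    calc ‖k‖ ^ β * |(fwdDiff (‖k‖⁻¹ • h))^[n] g (‖k‖⁻¹ • k)|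
        ≤ ‖k‖ ^ β * (C₁ * (‖h‖ / ‖k‖) ^ (β - γ)) := by
          gcongr; exact h4.trans (by gcongr)
      _ = C₁ * (‖h‖ ^ (β - γ) * ‖k‖ ^ γ) := by
          rw [Real.div_rpow hh'.le hk'.le, Real.rpow_sub hk' β γ]
          have := (Real.rpow_pos_of_pos hk' β).ne'
          have := (Real.rpow_pos_of_pos hk' γ).ne'
          field_simp
      _ ≤ _ := by
          gcongr
          exact le_add_of_nonneg_right (by positivity)
  -- For a long step the sampled points may meet the singularity at 0, so only the growth O(‖h‖^β)
  -- of each value is used; γ ≤ 0 and r‖k‖ < ‖h‖ convert it into the required product.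
  · have hh' : 0 < ‖h‖ := lt_of_le_of_lt (by positivity) hcase
    have h1 : |(fwdDiff h)^[n] g k| ≤ 2 ^ n * (M₀ * ((r⁻¹ + n) * ‖h‖) ^ β) := by
      rw [← Real.norm_eq_abs]
      refine norm_fwdDiff_iter_le n fun j hj => ?_
      refine (hgrow _).trans ?_
      have h2 : ‖k‖ ≤ r⁻¹ * ‖h‖ := by
        rw [inv_mul_eq_div, le_div_iff₀ hr0]; linarith
      have h3 : ‖k + j • h‖ ≤ (r⁻¹ + n) * ‖h‖ := by
        refine (norm_add_le _ _).trans ?_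
        have h4 : ‖j • h‖ ≤ n * ‖h‖ := by
          refine norm_nsmul_le.trans ?_
          have : (j : ℝ) ≤ n := by exact_mod_cast hj
          gcongr
        linarith
      gcongr
    have h2 : r ^ (β - n) * ‖k‖ ^ γ * ‖h‖ ^ (β - γ) ≥ ‖h‖ ^ β := by
      have h3 : ‖h‖ ^ γ ≤ (r * ‖k‖) ^ γ :=
        Real.rpow_le_rpow_of_nonpos (by positivity) hcase.le hγ
      have h4 : r ^ γ ≤ r ^ (β - n) := Real.rpow_le_rpow_of_exponent_ge hr0 hr1 hγ'
      rw [Real.mul_rpow hr0.le hk'.le] at h3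
      calc ‖h‖ ^ β = ‖h‖ ^ γ * ‖h‖ ^ (β - γ) := by rw [← Real.rpow_add hh']; congr 1; ring
        _ ≤ (r ^ (β - n) * ‖k‖ ^ γ) * ‖h‖ ^ (β - γ) := by
          gcongr
          exact h3.trans (by gcongr)
    rw [Real.mul_rpow (by positivity) hh'.le] at h1
    refine h1.trans ?_
    calc 2 ^ n * (M₀ * ((r⁻¹ + n) ^ β * ‖h‖ ^ β))
        ≤ 2 ^ n * (M₀ * ((r⁻¹ + n) ^ β * (r ^ (β - n) * ‖k‖ ^ γ * ‖h‖ ^ (β - γ)))) := by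
          gcongr
      _ = 2 ^ n * (M₀ * (r⁻¹ + n) ^ β * r ^ (β - n)) * (‖h‖ ^ (β - γ) * ‖k‖ ^ γ) := by ring
      _ ≤ _ := by
          gcongr
          exact le_add_of_nonneg_left hC₁

end FiniteDifferences

/-! ### The one-dimensional integral behind the constant of the exponent -/

section StableConstant

/-- The integrand is the real part of e^{-ur} - e^{(-u+i)r}, so the value is 1/u - u/(1+u²). -/
lemma integral_exp_neg_mul_one_sub_cos {u : ℝ} (hu : 0 < u) :
    IntegrableOn (fun r : ℝ => (1 - Real.cos r) * Real.exp (-(r * u))) (Set.Ioi 0) ∧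
    ∫ r in Set.Ioi 0, (1 - Real.cos r) * Real.exp (-(r * u)) = 1 / (u * (1 + u ^ 2)) := by
  have hre : ((-u : ℂ) + Complex.I).re < 0 := by simpa using hu
  have hre' : (-u : ℂ).re < 0 := by simpa using hu
  have h1 := integrableOn_exp_mul_complex_Ioi hre 0
  have h2 := integrableOn_exp_mul_complex_Ioi hre' 0
  have e1 : ∀ r : ℝ, (1 - Real.cos r) * Real.exp (-(r * u))
      = (Complex.exp ((-u : ℂ) * r) - Complex.exp (((-u : ℂ) + Complex.I) * r)).re := by
    intro r
    have h3 : ((-u : ℂ) + Complex.I) * r = ((-(r * u) : ℝ) : ℂ) + (r : ℂ) * Complex.I := by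
      push_cast; ring
    have h4 : (-u : ℂ) * r = ((-(r * u) : ℝ) : ℂ) := by push_cast; ring
    rw [h3, h4, Complex.sub_re, Complex.exp_add, ← Complex.ofReal_exp, Complex.re_ofReal_mul,
      Complex.exp_ofReal_mul_I_re, Complex.ofReal_re]
    ring
  have hI : IntegrableOn (fun r : ℝ => Complex.exp ((-u : ℂ) * r)
      - Complex.exp (((-u : ℂ) + Complex.I) * r)) (Set.Ioi 0) := h2.sub h1
  simp_rw [e1]
  refine ⟨hI.re, ?_⟩
  have h5 := integral_re hI
  simp only [RCLike.re_eq_complex_re] at h5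
  rw [h5, integral_sub h2 h1, integral_exp_mul_complex_Ioi hre, integral_exp_mul_complex_Ioi hre']
  simp only [Complex.ofReal_zero, mul_zero, Complex.exp_zero]
  have h6 : -1 / (-(u : ℂ) + Complex.I) = (u + Complex.I) / (1 + u ^ 2) := by
    have hne : (-(u : ℂ) + Complex.I) ≠ 0 := by
      intro h; rw [h] at hre; simp at hre
    have hne2 : (1 + (u : ℂ) ^ 2) ≠ 0 := by
      have : (1 + u ^ 2 : ℝ) ≠ 0 := by positivity
      exact_mod_cast this
    rw [div_eq_div_iff hne hne2]
    ring_nf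
    rw [Complex.I_sq]; ring
  have h7 : -1 / (-(u : ℂ)) = ((1 / u : ℝ) : ℂ) := by push_cast; rw [neg_div_neg_eq]
  rw [h6, h7]
  have h8 : ((u : ℂ) + Complex.I) / (1 + (u : ℂ) ^ 2) = ((u / (1 + u ^ 2) : ℝ) : ℂ)
      + ((1 / (1 + u ^ 2) : ℝ) : ℂ) * Complex.I := by push_cast; ring
  rw [h8, Complex.sub_re, Complex.add_re, Complex.ofReal_re, Complex.ofReal_re,
    Complex.re_ofReal_mul, Complex.I_re]
  have : (1 + u ^ 2) ≠ 0 := by positivity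
  field_simp
  ring

/-- The constant is computed with integrals valued in [0,∞], where interchanging the order of
integration needs only measurability. -/
lemma lintegral_eq_ofReal {f : ℝ → ℝ} {c : ℝ} (hf : ∀ r ∈ Set.Ioi (0 : ℝ), 0 ≤ f r)
    (hi : IntegrableOn f (Set.Ioi 0)) (hc : ∫ r in Set.Ioi 0, f r = c) :
    ∫⁻ r in Set.Ioi 0, ENNReal.ofReal (f r) = ENNReal.ofReal c := by
  rw [← hc, ofReal_integral_eq_lintegral_ofReal hi]
  exact (ae_restrict_iff' measurableSet_Ioi).2 (Filter.Eventually.of_forall hf)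

lemma integrableOn_rpow_mul_exp_neg_mul {s r : ℝ} (hs : 0 < s) (hr : 0 < r) :
    IntegrableOn (fun u : ℝ => u ^ (s - 1) * Real.exp (-(r * u))) (Set.Ioi 0) := by
  -- A non-integrable function has Bochner integral 0, but the Gamma formula gives a positive value.
  by_contra h
  have h1 := Real.integral_rpow_mul_exp_neg_mul_Ioi hs hr
  rw [integral_undef h] at h1
  have := Real.Gamma_pos_of_pos hs
  have : 0 < (1 / r) ^ s * Real.Gamma s := by positivity
  linarith

lemma lintegral_rpow_mul_exp_neg_mul {s r : ℝ} (hs : 0 < s) (hr : 0 < r) :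
    ∫⁻ u in Set.Ioi 0, ENNReal.ofReal (u ^ (s - 1) * Real.exp (-(r * u)))
      = ENNReal.ofReal (r ^ (-s) * Real.Gamma s) := by
  refine lintegral_eq_ofReal (fun u hu => ?_) (integrableOn_rpow_mul_exp_neg_mul hs hr) ?_
  · have : (0 : ℝ) < u := hu
    positivity
  · rw [Real.integral_rpow_mul_exp_neg_mul_Ioi hs hr, one_div, Real.inv_rpow hr.le,
      Real.rpow_neg hr.le]

/-- `∫₀^∞ u^{α-1} / (1+u²) du = Γ(α/2) Γ(1-α/2) / 2`. -/
lemma lintegral_rpow_div_one_add_sq {α : ℝ} (hα₀ : 0 < α) (hα₂ : α < 2) :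
    ∫⁻ u in Set.Ioi 0, ENNReal.ofReal (u ^ (α - 1) * (1 / (1 + u ^ 2)))
      = ENNReal.ofReal (Real.Gamma (α / 2) * Real.Gamma (1 - α / 2) / 2) := by
  have hG1 := Real.Gamma_pos_of_pos (show 0 < α / 2 by linarith)
  have hG2 := Real.Gamma_pos_of_pos (show 0 < 1 - α / 2 by linarith)
  -- Write 1/(1+u²) as ∫ e^{-(1+u²)w} dw and swap: the u-integral becomes a Gaussian moment giving
  -- Γ(α/2)/2, and the w-integral gives Γ(1-α/2).
  have h1 : ∀ u : ℝ, 0 < u → ENNReal.ofReal (u ^ (α - 1) * (1 / (1 + u ^ 2)))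
      = ∫⁻ w in Set.Ioi 0, ENNReal.ofReal (u ^ (α - 1) * Real.exp (-((1 + u ^ 2) * w))) := by
    intro u hu
    have h2 := lintegral_rpow_mul_exp_neg_mul (s := 1) (r := 1 + u ^ 2) one_pos (by positivity)
    simp only [sub_self, Real.rpow_zero, one_mul, Real.Gamma_one, mul_one] at h2
    simp_rw [ENNReal.ofReal_mul (show 0 ≤ u ^ (α - 1) by positivity)]
    rw [lintegral_const_mul _ (by fun_prop), h2, Real.rpow_neg_one, one_div]
  have h3 : ∀ w : ℝ, 0 < w →
      ∫⁻ u in Set.Ioi 0, ENNReal.ofReal (u ^ (α - 1) * Real.exp (-((1 + u ^ 2) * w)))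
      = ENNReal.ofReal (Real.Gamma (α / 2) / 2)
        * ENNReal.ofReal (w ^ ((1 - α / 2) - 1) * Real.exp (-(1 * w))) := by
    intro w hw
    have h4 := integral_rpow_mul_exp_neg_mul_rpow (p := 2) (q := α - 1) (b := w) two_pos
      (by linarith) hw
    have h5 : ∫⁻ u in Set.Ioi 0, ENNReal.ofReal (u ^ (α - 1) * Real.exp (-w * u ^ (2 : ℝ)))
        = ENNReal.ofReal (w ^ (-(α - 1 + 1) / 2) * (1 / 2) * Real.Gamma ((α - 1 + 1) / 2)) := by
      refine lintegral_eq_ofReal (fun u hu => ?_) ?_ h4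
      · have : (0 : ℝ) < u := hu
        positivity
      · by_contra h
        have h6 := h4
        rw [integral_undef h] at h6
        rw [sub_add_cancel] at h6
        have : 0 < w ^ (-α / 2) * (1 / 2) * Real.Gamma (α / 2) := by positivity
        linarith
    have h7 : ∀ u : ℝ, ENNReal.ofReal (u ^ (α - 1) * Real.exp (-((1 + u ^ 2) * w)))
        = ENNReal.ofReal (Real.exp (-w))
          * ENNReal.ofReal (u ^ (α - 1) * Real.exp (-w * u ^ (2 : ℝ))) := by
      intro u
      rw [← ENNReal.ofReal_mul (Real.exp_pos _).le]
      congr 1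
      rw [mul_left_comm, ← Real.exp_add]
      congr 2
      rw [Real.rpow_two]; ring
    simp_rw [h7]
    rw [lintegral_const_mul _ (by fun_prop), h5, sub_add_cancel,
      ← ENNReal.ofReal_mul (Real.exp_pos _).le, ← ENNReal.ofReal_mul (by positivity)]
    congr 1
    rw [show 1 - α / 2 - 1 = -α / 2 by ring, one_mul]
    ring
  rw [setLIntegral_congr_fun measurableSet_Ioi fun u hu => h1 u hu,
    lintegral_lintegral_swap (by fun_prop),
    setLIntegral_congr_fun measurableSet_Ioi fun w hw => h3 w hw,
    lintegral_const_mul _ (by fun_prop),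
    lintegral_rpow_mul_exp_neg_mul (by linarith) one_pos, ← ENNReal.ofReal_mul (by positivity),
    Real.one_rpow, one_mul]
  congr 1; ring

/-- The reflection formula at α/2 and at -α, together with the double-angle formula, removes the
pole of Γ(-α) at α = 1. The new form is visibly positive on (0,2) and is the one the integrals
produce. -/
lemma stableConst_eq {α : ℝ} (hα₀ : 0 < α) (hα₂ : α < 2) :
    stableConst α
      = Real.Gamma (α / 2) * Real.Gamma (1 - α / 2) / 2 / Real.Gamma (1 + α) := by
  have hs : 0 < Real.sin (Real.pi * (α / 2)) :=
    Real.sin_pos_of_pos_of_lt_pi (by have := Real.pi_pos; positivity)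
      (by have := Real.pi_pos; nlinarith)
  rw [Real.Gamma_mul_Gamma_one_sub, stableConst]
  split_ifs with h
  · subst h
    rw [show (1 : ℝ) + 1 = 2 by norm_num, Real.Gamma_two, show Real.pi * (1 / 2) = Real.pi / 2 by
      ring, Real.sin_pi_div_two]
    ring
  · have hG : Real.Gamma (1 + α) ≠ 0 := (Real.Gamma_pos_of_pos (by linarith)).ne'
    have h1 := Real.Gamma_mul_Gamma_one_sub (-α)
    rw [sub_neg_eq_add, show Real.pi * -α = -(2 * (Real.pi * (α / 2))) by ring, Real.sin_neg,
      Real.sin_two_mul] at h1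
    -- On (0,2) the cosine vanishes only at α = 1, the excluded case, so it cancels against the
    -- factor from the double angle.
    have hc : Real.cos (Real.pi * (α / 2)) ≠ 0 := by
      intro h0
      rw [Real.cos_eq_zero_iff] at h0
      obtain ⟨n, hn⟩ := h0
      have hpi := Real.pi_pos
      have h2 : α = 2 * n + 1 := by
        have : Real.pi * (α / 2) = Real.pi * ((2 * n + 1) / 2) := by rw [hn]; ring
        have := mul_left_cancel₀ hpi.ne' this
        linarith
      have h3 : (n : ℝ) < 1 := by linarith
      have h4 : (-1 : ℝ) < n := by linarith
      have h5 : n = 0 := by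
        have h6 : n < 1 := by exact_mod_cast h3
        have h7 : -1 < n := by exact_mod_cast h4
        omega
      rw [h5] at h2
      exact h (by simpa using h2)
    have h2 : Real.Gamma (-α) = Real.pi / -(2 * Real.sin (Real.pi * (α / 2))
        * Real.cos (Real.pi * (α / 2))) / Real.Gamma (1 + α) := by
      rw [← h1, mul_div_cancel_right₀ _ hG]
    rw [h2, show α * Real.pi / 2 = Real.pi * (α / 2) by ring]
    generalize Real.cos (Real.pi * (α / 2)) = c at *
    generalize Real.sin (Real.pi * (α / 2)) = s at *
    field_simp

lemma stableConst_pos {α : ℝ} (hα₀ : 0 < α) (hα₂ : α < 2) : 0 < stableConst α := by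
  rw [stableConst_eq hα₀ hα₂]
  have hG1 := Real.Gamma_pos_of_pos (show 0 < α / 2 by linarith)
  have hG2 := Real.Gamma_pos_of_pos (show 0 < 1 - α / 2 by linarith)
  have hG := Real.Gamma_pos_of_pos (show 0 < 1 + α by linarith)
  positivity

/-- `∫₀^∞ (1 - cos r) r^{-1-α} dr = -Γ(-α) cos(απ/2)`. -/
lemma lintegral_one_sub_cos_mul_rpow {α : ℝ} (hα₀ : 0 < α) (hα₂ : α < 2) :
    ∫⁻ r in Set.Ioi 0, ENNReal.ofReal ((1 - Real.cos r) * r ^ (-(1 + α)))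
      = ENNReal.ofReal (stableConst α) := by
  have hG := Real.Gamma_pos_of_pos (show 0 < 1 + α by linarith)
  have hcos : ∀ r, 0 ≤ 1 - Real.cos r := fun r => sub_nonneg.2 (Real.cos_le_one r)
  -- Represent r^{-(1+α)} as Γ(1+α)^{-1} ∫ u^α e^{-ru} du; after swapping, the r-integral is the
  -- Laplace transform of 1 - cos.
  have h1 : ∀ r : ℝ, 0 < r → ENNReal.ofReal ((1 - Real.cos r) * r ^ (-(1 + α)))
      = ENNReal.ofReal (Real.Gamma (1 + α))⁻¹ * ∫⁻ u in Set.Ioi 0,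
        ENNReal.ofReal (u ^ α * ((1 - Real.cos r) * Real.exp (-(r * u)))) := by
    intro r hr
    have h2 := lintegral_rpow_mul_exp_neg_mul (s := 1 + α) (r := r) (by linarith) hr
    rw [add_sub_cancel_left] at h2
    have h4 : ∀ u : ℝ, u ^ α * ((1 - Real.cos r) * Real.exp (-(r * u)))
        = (1 - Real.cos r) * (u ^ α * Real.exp (-(r * u))) := fun u => by ring
    simp_rw [h4, ENNReal.ofReal_mul (hcos r)]
    rw [lintegral_const_mul _ (by fun_prop), h2, ← ENNReal.ofReal_mul (hcos r),
      ← ENNReal.ofReal_mul (hcos r), ← ENNReal.ofReal_mul (inv_pos.2 hG).le]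
    congr 1
    field_simp
  have h3 : ∀ u : ℝ, 0 < u →
      ∫⁻ r in Set.Ioi 0, ENNReal.ofReal (u ^ α * ((1 - Real.cos r) * Real.exp (-(r * u))))
      = ENNReal.ofReal (u ^ (α - 1) * (1 / (1 + u ^ 2))) := by
    intro u hu
    obtain ⟨hi, he⟩ := integral_exp_neg_mul_one_sub_cos hu
    have h4 := lintegral_eq_ofReal (fun r _ => mul_nonneg (hcos r) (Real.exp_pos _).le) hi he
    simp_rw [ENNReal.ofReal_mul (show 0 ≤ u ^ α by positivity)]
    rw [lintegral_const_mul _ (by fun_prop), h4, ← ENNReal.ofReal_mul (by positivity)]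
    congr 1
    rw [Real.rpow_sub_one hu.ne']
    have : 1 + u ^ 2 ≠ 0 := by positivity
    field_simp
  rw [setLIntegral_congr_fun measurableSet_Ioi fun r hr => h1 r hr,
    lintegral_const_mul _ (by fun_prop), lintegral_lintegral_swap (by fun_prop),
    setLIntegral_congr_fun measurableSet_Ioi fun u hu => h3 u hu,
    lintegral_rpow_div_one_add_sq hα₀ hα₂, ← ENNReal.ofReal_mul (by positivity),
    stableConst_eq hα₀ hα₂]
  congr 1
  ring

lemma lintegral_one_sub_cos_mul {α : ℝ} (hα₀ : 0 < α) (hα₂ : α < 2) (s : ℝ) :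
    ∫⁻ r in Set.Ioi 0, ENNReal.ofReal ((1 - Real.cos (r * s)) * r ^ (-(1 + α)))
      = ENNReal.ofReal (stableConst α * |s| ^ α) := by
  rcases eq_or_ne s 0 with rfl | hs
  · simp [Real.zero_rpow hα₀.ne']
  have hs' : 0 < |s| := abs_pos.2 hs
  set g : ℝ → ENNReal := (Set.Ioi 0).indicator
    fun r => ENNReal.ofReal ((1 - Real.cos r) * r ^ (-(1 + α))) with hg
  have hgm : Measurable g := by
    refine Measurable.indicator ?_ measurableSet_Ioi
    fun_prop
  have h1 : ∀ r : ℝ, (Set.Ioi (0 : ℝ)).indicator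
      (fun r => ENNReal.ofReal ((1 - Real.cos (r * s)) * r ^ (-(1 + α)))) r
      = ENNReal.ofReal (|s| ^ (1 + α)) * g (|s| * r) := by
    intro r
    by_cases hr : 0 < r
    · have hr' : |s| * r ∈ Set.Ioi (0 : ℝ) := mul_pos hs' hr
      rw [hg, Set.indicator_of_mem (Set.mem_Ioi.2 hr), Set.indicator_of_mem hr',
        ← ENNReal.ofReal_mul (by positivity), Real.mul_rpow hs'.le hr.le]
      congr 1
      have h2 : Real.cos (|s| * r) = Real.cos (r * s) := by
        rw [← Real.cos_abs (r * s), abs_mul, abs_of_pos hr, mul_comm]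
      rw [h2, Real.rpow_neg hs'.le]
      have := (Real.rpow_pos_of_pos hs' (1 + α)).ne'
      field_simp
    · have hr' : |s| * r ∉ Set.Ioi (0 : ℝ) := by
        rw [Set.mem_Ioi, mul_pos_iff_of_pos_left hs']; exact hr
      rw [hg, Set.indicator_of_notMem (show r ∉ Set.Ioi (0 : ℝ) from hr), Set.indicator_of_notMem hr', mul_zero]
  have h3 : ∫⁻ r, g (|s| * r) = ENNReal.ofReal |s|⁻¹ * ENNReal.ofReal (stableConst α) := by
    rw [← lintegral_map hgm (measurable_const_mul _), Real.map_volume_mul_left hs'.ne',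
      lintegral_smul_measure, hg, lintegral_indicator measurableSet_Ioi,
      lintegral_one_sub_cos_mul_rpow hα₀ hα₂, abs_of_pos (inv_pos.2 hs'), smul_eq_mul]
  rw [← lintegral_indicator measurableSet_Ioi]
  simp_rw [h1]
  rw [lintegral_const_mul _ (show Measurable fun r => g (|s| * r) from
    hgm.comp (measurable_const_mul _)), h3,
    ← ENNReal.ofReal_mul (by positivity), ← ENNReal.ofReal_mul (by positivity)]
  congr 1
  rw [Real.rpow_add hs', Real.rpow_one]
  field_simp

end StableConstant

/-! ### Polar coordinates -/

section PolarCoordinates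

variable {d : ℕ}

lemma lintegral_polar (hd : 1 ≤ d) {f : EuclideanSpace ℝ (Fin d) → ENNReal} (hf : Measurable f) :
    ∫⁻ y, f y = ∫⁻ x : Metric.sphere (0 : EuclideanSpace ℝ (Fin d)) 1,
      (∫⁻ r in Set.Ioi (0 : ℝ), ENNReal.ofReal (r ^ (d - 1)) * f (r • (x : EuclideanSpace ℝ (Fin d))))
      ∂(volume : Measure (EuclideanSpace ℝ (Fin d))).toSphere := by
  have : Nonempty (Fin d) := ⟨⟨0, hd⟩⟩
  have : Nontrivial (EuclideanSpace ℝ (Fin d)) := inferInstance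
  have hmp := (volume : Measure (EuclideanSpace ℝ (Fin d))).measurePreserving_homeomorphUnitSphereProd
  have hm : Measurable fun p : Metric.sphere (0 : EuclideanSpace ℝ (Fin d)) 1 × Set.Ioi (0 : ℝ) =>
      f ((p.2 : ℝ) • (p.1 : EuclideanSpace ℝ (Fin d))) := by
    refine hf.comp ?_
    fun_prop
  have h1 : ∫⁻ y, f y = ∫⁻ y : ({0}ᶜ : Set (EuclideanSpace ℝ (Fin d))), f y
      ∂(Measure.comap Subtype.val volume) := by
    rw [lintegral_subtype_comap (measurableSet_singleton _).compl, restrict_compl_singleton]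
  have h2 : ∀ y : ({0}ᶜ : Set (EuclideanSpace ℝ (Fin d))),
      f y = f (((homeomorphUnitSphereProd _ y).2 : ℝ) •
        ((homeomorphUnitSphereProd _ y).1 : EuclideanSpace ℝ (Fin d))) := by
    intro y
    have hy : ‖(y : EuclideanSpace ℝ (Fin d))‖ ≠ 0 := norm_ne_zero_iff.2 y.2
    simp [smul_smul, hy]
  rw [h1, lintegral_congr h2, hmp.lintegral_comp hm, lintegral_prod _ hm.aemeasurable]
  refine lintegral_congr fun x => ?_
  have hmx : Measurable fun r : Set.Ioi (0 : ℝ) => f ((r : ℝ) • (x : EuclideanSpace ℝ (Fin d))) :=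
    hf.comp (by fun_prop)
  rw [Measure.volumeIoiPow, lintegral_withDensity_eq_lintegral_mul _ (by fun_prop) hmx]
  simp only [Pi.mul_apply, finrank_euclideanSpace, Fintype.card_fin]
  rw [lintegral_subtype_comap measurableSet_Ioi
    (fun r : ℝ => ENNReal.ofReal (r ^ (d - 1)) * f (r • (x : EuclideanSpace ℝ (Fin d))))]

end PolarCoordinates

/-! ### The homogeneous Lévy density -/

section Tail

variable {d : ℕ} {α : ℝ} {a₀ : EuclideanSpace ℝ (Fin d) → ℝ}

/-- The homogeneous density `a₀(y/|y|) |y|^{-(d+α)}` of the Lévy measure. -/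
noncomputable def levyDensity (α : ℝ) (a₀ : EuclideanSpace ℝ (Fin d) → ℝ)
    (y : EuclideanSpace ℝ (Fin d)) : ℝ :=
  a₀ (direction y) * ‖y‖ ^ (-((d : ℝ) + α))

lemma norm_direction {k : EuclideanSpace ℝ (Fin d)} (hk : k ≠ 0) : ‖direction k‖ = 1 := by
  simp [direction, norm_smul, norm_ne_zero_iff.2 hk]

lemma direction_mem_sphere {k : EuclideanSpace ℝ (Fin d)} (hk : k ≠ 0) :
    direction k ∈ Metric.sphere (0 : EuclideanSpace ℝ (Fin d)) 1 := by
  simpa using norm_direction hk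

lemma direction_smul {c : ℝ} (hc : 0 < c) (k : EuclideanSpace ℝ (Fin d)) :
    direction (c • k) = direction k := by
  simp only [direction, norm_smul, smul_smul, Real.norm_eq_abs, abs_of_pos hc]
  congr 1
  field_simp

lemma direction_neg (k : EuclideanSpace ℝ (Fin d)) : direction (-k) = -direction k := by
  simp [direction]

lemma direction_of_mem_sphere {x : EuclideanSpace ℝ (Fin d)}
    (hx : x ∈ Metric.sphere (0 : EuclideanSpace ℝ (Fin d)) 1) : direction x = x := by
  have : ‖x‖ = 1 := by simpa using hx
  simp [direction, this]

lemma norm_smul_direction (k : EuclideanSpace ℝ (Fin d)) : ‖k‖ • direction k = k := by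
  by_cases hk : k = 0
  · simp [hk]
  · simp [direction, smul_smul, norm_ne_zero_iff.2 hk]

lemma continuousOn_direction :
    ContinuousOn (direction : EuclideanSpace ℝ (Fin d) → EuclideanSpace ℝ (Fin d)) {0}ᶜ := by
  unfold direction
  refine ContinuousOn.smul (ContinuousOn.inv₀ continuous_norm.continuousOn ?_) continuousOn_id
  intro k hk
  exact norm_ne_zero_iff.2 hk

lemma continuousOn_comp_direction (ha₀ : ContinuousOn a₀ (Metric.sphere 0 1)) :
    ContinuousOn (fun y => a₀ (direction y)) {0}ᶜ :=
  ha₀.comp continuousOn_direction fun _ hk => direction_mem_sphere hk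

lemma continuousOn_levyDensity (ha₀ : ContinuousOn a₀ (Metric.sphere 0 1)) :
    ContinuousOn (levyDensity α a₀) {0}ᶜ :=
  (continuousOn_comp_direction ha₀).mul
    (continuous_norm.continuousOn.rpow_const fun _ hk => Or.inl (norm_ne_zero_iff.2 hk))

lemma measurable_levyDensity (ha₀ : ContinuousOn a₀ (Metric.sphere 0 1)) :
    Measurable (levyDensity α a₀) :=
  measurable_of_continuousOn_compl_singleton 0 (continuousOn_levyDensity ha₀)

lemma levyDensity_neg (ha₀ : ∀ x ∈ Metric.sphere (0 : EuclideanSpace ℝ (Fin d)) 1, a₀ (-x) = a₀ x)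
    (y : EuclideanSpace ℝ (Fin d)) : levyDensity α a₀ (-y) = levyDensity α a₀ y := by
  by_cases hy : y = 0
  · simp [hy]
  · rw [levyDensity, levyDensity, direction_neg, ha₀ _ (direction_mem_sphere hy), norm_neg]

lemma levyDensity_smul {c : ℝ} (hc : 0 < c) (y : EuclideanSpace ℝ (Fin d)) :
    levyDensity α a₀ (c • y) = c ^ (-((d : ℝ) + α)) * levyDensity α a₀ y := by
  rw [levyDensity, levyDensity, direction_smul hc, norm_smul, Real.norm_eq_abs, abs_of_pos hc,
    Real.mul_rpow hc.le (norm_nonneg _)]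
  ring

lemma levyDensity_nonneg (hdα : 0 < d + α) (hpos : ∀ x ∈ Metric.sphere (0 : EuclideanSpace ℝ (Fin d)) 1, 0 ≤ a₀ x)
    (y : EuclideanSpace ℝ (Fin d)) : 0 ≤ levyDensity α a₀ y := by
  by_cases hy : y = 0
  -- The vector `direction 0 = 0` is off the sphere, so a₀ has no known sign there; the convention
  -- 0^s = 0 for s ≠ 0 settles the origin.
  · rw [levyDensity, hy, norm_zero, Real.zero_rpow (by linarith), mul_zero]
  · exact mul_nonneg (hpos _ (direction_mem_sphere hy)) (by positivity)

/-- In polar coordinates r^{d-1}·r^{-(d+α)} = r^{-(1+α)}, so along each ray x the integral is the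
one-dimensional one with frequency (x,k). This is where the form of b₀ acquires its probabilistic
meaning. -/
lemma lintegral_one_sub_cos_mul_levyDensity (hd : 1 ≤ d) (hα₀ : 0 < α) (hα₂ : α < 2)
    (ha₀ : ContinuousOn a₀ (Metric.sphere 0 1))
    (hpos : ∀ x ∈ Metric.sphere (0 : EuclideanSpace ℝ (Fin d)) 1, 0 ≤ a₀ x)
    (k : EuclideanSpace ℝ (Fin d)) :
    ∫⁻ y, ENNReal.ofReal ((1 - Real.cos (inner ℝ k y)) * levyDensity α a₀ y)
      = ENNReal.ofReal (stableExponent α a₀ k) := by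
  have hm : Measurable fun y => (1 - Real.cos (inner ℝ k y)) * levyDensity α a₀ y :=
    Measurable.mul (by fun_prop) (measurable_levyDensity ha₀)
  have hsc := (stableConst_pos hα₀ hα₂).le
  rw [lintegral_polar hd hm.ennreal_ofReal]
  have h1 : ∀ x : Metric.sphere (0 : EuclideanSpace ℝ (Fin d)) 1,
      ∫⁻ r in Set.Ioi (0 : ℝ), ENNReal.ofReal (r ^ (d - 1)) *
        ENNReal.ofReal ((1 - Real.cos (inner ℝ k (r • (x : EuclideanSpace ℝ (Fin d)))))
          * levyDensity α a₀ (r • (x : EuclideanSpace ℝ (Fin d))))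
      = ENNReal.ofReal (stableConst α * (a₀ x * |inner ℝ (x : EuclideanSpace ℝ (Fin d)) k| ^ α)) := by
    intro x
    have hx : ‖(x : EuclideanSpace ℝ (Fin d))‖ = 1 := by simp
    have h2 : ∀ r ∈ Set.Ioi (0 : ℝ), ENNReal.ofReal (r ^ (d - 1)) *
        ENNReal.ofReal ((1 - Real.cos (inner ℝ k (r • (x : EuclideanSpace ℝ (Fin d)))))
          * levyDensity α a₀ (r • (x : EuclideanSpace ℝ (Fin d))))
        = ENNReal.ofReal (a₀ x) * ENNReal.ofReal
          ((1 - Real.cos (r * inner ℝ (x : EuclideanSpace ℝ (Fin d)) k)) * r ^ (-(1 + α))) := by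
      intro r hr
      have hr0 : (0 : ℝ) < r := hr
      rw [← ENNReal.ofReal_mul (by positivity), ← ENNReal.ofReal_mul (hpos _ x.2),
        levyDensity_smul hr0, levyDensity, direction_of_mem_sphere x.2, hx, Real.one_rpow, mul_one,
        inner_smul_right, real_inner_comm]
      congr 1
      have h3 : r ^ (-(1 + α)) = r ^ (d - 1) * r ^ (-((d : ℝ) + α)) := by
        rw [← Real.rpow_natCast, ← Real.rpow_add hr0, Nat.cast_sub hd]
        congr 1; push_cast; ring
      rw [h3]; ring
    rw [setLIntegral_congr_fun measurableSet_Ioi h2, lintegral_const_mul _ (by fun_prop),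
      lintegral_one_sub_cos_mul hα₀ hα₂, ← ENNReal.ofReal_mul (hpos _ x.2)]
    congr 1; ring
  have hcont : Continuous fun x : Metric.sphere (0 : EuclideanSpace ℝ (Fin d)) 1 =>
      stableConst α * (a₀ x * |inner ℝ (x : EuclideanSpace ℝ (Fin d)) k| ^ α) := by
    refine continuous_const.mul ((continuousOn_iff_continuous_domRestrict.1 ha₀).mul ?_)
    refine Continuous.rpow_const ?_ fun _ => Or.inr hα₀.le
    fun_prop
  rw [lintegral_congr h1, ← ofReal_integral_eq_lintegral_ofReal
    (hcont.integrable_of_hasCompactSupport (HasCompactSupport.of_compactSpace _))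
    (Filter.Eventually.of_forall fun x => mul_nonneg hsc
      (mul_nonneg (hpos _ x.2) (by positivity))), stableExponent, integral_const_mul]

end Tail

/-! ### Plane waves and Fourier inversion -/

section PlaneWaves

variable {d : ℕ}

/-- The plane wave `e^{i(k,y)}`. -/
noncomputable def planeWave (k y : EuclideanSpace ℝ (Fin d)) : ℂ :=
  Complex.exp (Complex.I * ((inner ℝ k y : ℝ) : ℂ))

lemma latticeChar_eq_planeWave (k : EuclideanSpace ℝ (Fin d)) (z : Fin d → ℤ) :
    latticeChar k z = planeWave k (latticeVec z) := rfl

lemma norm_planeWave (k y : EuclideanSpace ℝ (Fin d)) : ‖planeWave k y‖ = 1 := by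
  rw [planeWave, mul_comm, Complex.norm_exp_ofReal_mul_I]

lemma planeWave_add_left (k h y : EuclideanSpace ℝ (Fin d)) :
    planeWave (k + h) y = planeWave k y * planeWave h y := by
  simp [planeWave, inner_add_left, mul_add, Complex.exp_add]

lemma planeWave_add_right (k x y : EuclideanSpace ℝ (Fin d)) :
    planeWave k (x + y) = planeWave k x * planeWave k y := by
  simp [planeWave, inner_add_right, mul_add, Complex.exp_add]

lemma planeWave_neg_right (k y : EuclideanSpace ℝ (Fin d)) :
    planeWave k (-y) = starRingEnd ℂ (planeWave k y) := by
  simp [planeWave, ← Complex.exp_conj]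

lemma planeWave_neg_left (k y : EuclideanSpace ℝ (Fin d)) :
    planeWave (-k) y = planeWave k (-y) := by
  simp [planeWave]

lemma planeWave_comm (k y : EuclideanSpace ℝ (Fin d)) : planeWave k y = planeWave y k := by
  simp [planeWave, real_inner_comm]

lemma planeWave_smul_left (c : ℝ) (k y : EuclideanSpace ℝ (Fin d)) :
    planeWave (c • k) y = planeWave k (c • y) := by
  simp [planeWave, inner_smul_left, inner_smul_right]

lemma planeWave_re (k y : EuclideanSpace ℝ (Fin d)) :
    (planeWave k y).re = Real.cos (inner ℝ k y) := by
  rw [planeWave, mul_comm, Complex.exp_ofReal_mul_I_re]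

lemma continuous_planeWave_left (y : EuclideanSpace ℝ (Fin d)) :
    Continuous fun k => planeWave k y := by
  unfold planeWave; fun_prop

lemma continuous_planeWave_right (k : EuclideanSpace ℝ (Fin d)) :
    Continuous fun y => planeWave k y := by
  unfold planeWave; fun_prop

lemma norm_planeWave_sub_one_sq (k y : EuclideanSpace ℝ (Fin d)) :
    ‖planeWave k y - 1‖ ^ 2 = 2 * (1 - Real.cos (inner ℝ k y)) := by
  rw [← Complex.normSq_eq_norm_sq, planeWave, mul_comm, Complex.exp_mul_I, Complex.normSq_apply,
    ← Complex.ofReal_cos, ← Complex.ofReal_sin]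
  simp only [Complex.sub_re, Complex.add_re, Complex.ofReal_re, Complex.mul_re, Complex.I_re,
    Complex.ofReal_im, Complex.I_im, Complex.one_re, Complex.sub_im, Complex.add_im,
    Complex.mul_im, Complex.one_im]
  have := Real.sin_sq_add_cos_sq (inner ℝ k y)
  ring_nf
  nlinarith

lemma fwdDiff_iter_planeWave (h k y : EuclideanSpace ℝ (Fin d)) (m : ℕ) :
    (fwdDiff h)^[m] (fun κ => planeWave κ y) k = planeWave k y * (planeWave h y - 1) ^ m := by
  induction m generalizing k with
  | zero => simp
  | succ m ih =>
    rw [Function.iterate_succ_apply', fwdDiff, ih, ih, planeWave_add_left]; ring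

lemma ofReal_fwdDiff_iter {V : Type*} [AddCommMonoid V] (h : V) (m : ℕ) (f : V → ℝ) (k : V) :
    (((fwdDiff h)^[m] f k : ℝ) : ℂ) = (fwdDiff h)^[m] (fun κ => (f κ : ℂ)) k := by
  simp [fwdDiff_iter_eq_sum_shift]

lemma re_fwdDiff_iter {V : Type*} [AddCommMonoid V] (h : V) (m : ℕ) (f : V → ℂ) (k : V) :
    ((fwdDiff h)^[m] f k).re = (fwdDiff h)^[m] (fun κ => (f κ).re) k := by
  simp_rw [fwdDiff_iter_eq_sum_shift, Complex.re_sum]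
  refine Finset.sum_congr rfl fun j _ => ?_
  generalize ((-1 : ℤ) ^ (m - j) * (m.choose j : ℤ)) = n
  simp

/-- Pointwise Fourier inversion for the convention `∫ e^{i(k,y)} G(y) dy`. -/
lemma integral_planeWave_inversion {G : EuclideanSpace ℝ (Fin d) → ℂ} (hG : Integrable G)
    (hG' : Integrable fun k => ∫ y, planeWave k y * G y) {x : EuclideanSpace ℝ (Fin d)}
    (hx : ContinuousAt G x) :
    ∫ k, (∫ y, planeWave k y * G y) * planeWave k (-x) = (2 * Real.pi) ^ d * G x := by
  have hpi := Real.pi_pos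
  -- The substitution k = -2πw carries the convention e^{-2πi(y,w)} into e^{i(k,y)}; its Jacobian
  -- produces the factor (2π)^d.
  have hF : ∀ w, FourierTransform.fourier G w
      = (fun k => ∫ y, planeWave k y * G y) ((-2 * Real.pi) • w) := by
    intro w
    rw [Real.fourier_eq']
    refine integral_congr_ae (Filter.Eventually.of_forall fun y => ?_)
    simp only [smul_eq_mul, planeWave, inner_smul_left, real_inner_comm]
    congr 2
    push_cast; simp; ring
  have hne : (-2 * Real.pi) ≠ 0 := by nlinarith
  have hFi : Integrable (FourierTransform.fourier G) := by
    rw [funext hF]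
    exact hG'.comp_smul hne
  have h1 := hG.fourierInv_fourier_eq hFi hx
  rw [Real.fourierInv_eq'] at h1
  have h2 : ∀ w, Complex.exp (((2 * Real.pi * inner ℝ w x : ℝ) : ℂ) * Complex.I)
      • FourierTransform.fourier G w
      = (fun k => (∫ y, planeWave k y * G y) * planeWave k (-x)) ((-2 * Real.pi) • w) := by
    intro w
    rw [hF, smul_eq_mul, mul_comm]
    beta_reduce
    congr 1
    rw [planeWave_smul_left]
    simp only [planeWave, inner_smul_right, inner_neg_right]
    congr 1
    push_cast; ring
  simp_rw [h2] at h1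
  rw [Measure.integral_comp_smul volume
    (fun k => (∫ y, planeWave k y * G y) * planeWave k (-x))] at h1
  simp only [finrank_euclideanSpace, Fintype.card_fin] at h1
  have h3 : |((-2 * Real.pi) ^ d)⁻¹| = ((2 * Real.pi) ^ d)⁻¹ := by
    rw [abs_inv, abs_pow, abs_mul, abs_of_pos hpi]
    norm_num
  rw [h3, Complex.real_smul] at h1
  rw [← h1]
  push_cast
  rw [mul_inv_cancel_left₀]
  exact pow_ne_zero _ (mul_ne_zero two_ne_zero (by exact_mod_cast hpi.ne'))

end PlaneWaves

/-! ### Integrability of powers of the norm -/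

section Radial

variable {d : ℕ}

lemma integrableOn_norm_rpow_ball (hd : 1 ≤ d) {γ : ℝ} (hγ : -(d : ℝ) < γ) (ρ : ℝ) :
    IntegrableOn (fun k : EuclideanSpace ℝ (Fin d) => ‖k‖ ^ γ) (Metric.ball 0 ρ) := by
  have : Nonempty (Fin d) := ⟨⟨0, hd⟩⟩
  rw [integrableOn_fun_norm_addHaar volume (f := fun r => r ^ γ)]
  simp only [finrank_euclideanSpace, Fintype.card_fin, smul_eq_mul]
  rcases le_or_gt ρ 0 with hρ | hρ
  · simp [Set.Ioo_eq_empty (not_lt.2 hρ)]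
  have h1 : IntegrableOn (fun r : ℝ => r ^ ((d : ℝ) - 1 + γ)) (Set.Ioo 0 ρ) :=
    (intervalIntegral.integrableOn_Ioo_rpow_iff hρ).2 (by linarith)
  refine h1.congr_fun (fun r hr => ?_) measurableSet_Ioo
  beta_reduce
  rw [Real.rpow_add hr.1, ← Real.rpow_natCast, Nat.cast_sub hd, Nat.cast_one]

lemma integrableOn_norm_rpow_compl_ball (hd : 1 ≤ d) {γ : ℝ} (hγ : γ < -(d : ℝ)) {ρ : ℝ}
    (hρ : 0 < ρ) :
    IntegrableOn (fun k : EuclideanSpace ℝ (Fin d) => ‖k‖ ^ γ) (Metric.ball 0 ρ)ᶜ := by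
  have : Nonempty (Fin d) := ⟨⟨0, hd⟩⟩
  have h0 : (fun k : EuclideanSpace ℝ (Fin d) => (Metric.ball 0 ρ)ᶜ.indicator (fun k => ‖k‖ ^ γ) k)
      = fun k => (Set.Ici ρ).indicator (fun r => r ^ γ) ‖k‖ := by
    funext k
    simp [Set.indicator]
  rw [← integrable_indicator_iff measurableSet_ball.compl]
  change Integrable fun k : EuclideanSpace ℝ (Fin d) => (Metric.ball 0 ρ)ᶜ.indicator _ k
  rw [h0, integrable_fun_norm_addHaar volume]
  simp only [finrank_euclideanSpace, Fintype.card_fin, smul_eq_mul]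
  have h1 : IntegrableOn (fun r : ℝ => r ^ ((d : ℝ) - 1 + γ)) (Set.Ici ρ) :=
    (integrableOn_Ici_iff_integrableOn_Ioi).2 (integrableOn_Ioi_rpow_of_lt (by linarith) hρ)
  have h2 : (fun r : ℝ => r ^ (d - 1) * (Set.Ici ρ).indicator (fun r => r ^ γ) r)
      = (Set.Ici ρ).indicator (fun r : ℝ => r ^ ((d : ℝ) - 1 + γ)) := by
    funext r
    by_cases hr : r ∈ Set.Ici ρ
    · have hr0 : 0 < r := hρ.trans_le hr
      rw [Set.indicator_of_mem hr, Set.indicator_of_mem hr, Real.rpow_add hr0,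
        ← Real.rpow_natCast, Nat.cast_sub hd, Nat.cast_one]
    · rw [Set.indicator_of_notMem hr, Set.indicator_of_notMem hr, mul_zero]
  rw [h2]
  exact ((integrable_indicator_iff measurableSet_Ici).2 h1).integrableOn

end Radial

/-! ### Lévy–Khintchine representation and its differences -/

section LevyKhintchine

variable {d : ℕ} {α : ℝ} {a₀ : EuclideanSpace ℝ (Fin d) → ℝ}

lemma stableExponent_nonneg (hα₀ : 0 < α) (hα₂ : α < 2)
    (hpos : ∀ x ∈ Metric.sphere (0 : EuclideanSpace ℝ (Fin d)) 1, 0 ≤ a₀ x)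
    (k : EuclideanSpace ℝ (Fin d)) : 0 ≤ stableExponent α a₀ k :=
  mul_nonneg (stableConst_pos hα₀ hα₂).le
    (integral_nonneg fun x => mul_nonneg (hpos _ x.2) (by positivity))

lemma one_sub_cos_mul_levyDensity_nonneg (hα₀ : 0 < α)
    (hpos : ∀ x ∈ Metric.sphere (0 : EuclideanSpace ℝ (Fin d)) 1, 0 ≤ a₀ x)
    (k y : EuclideanSpace ℝ (Fin d)) :
    0 ≤ (1 - Real.cos (inner ℝ k y)) * levyDensity α a₀ y :=
  mul_nonneg (sub_nonneg.2 (Real.cos_le_one _)) (levyDensity_nonneg (by positivity) hpos y)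

lemma integrable_one_sub_cos_mul_levyDensity (hd : 1 ≤ d) (hα₀ : 0 < α) (hα₂ : α < 2)
    (ha₀ : ContinuousOn a₀ (Metric.sphere 0 1))
    (hpos : ∀ x ∈ Metric.sphere (0 : EuclideanSpace ℝ (Fin d)) 1, 0 ≤ a₀ x)
    (k : EuclideanSpace ℝ (Fin d)) :
    Integrable fun y => (1 - Real.cos (inner ℝ k y)) * levyDensity α a₀ y := by
  refine (lintegral_ofReal_ne_top_iff_integrable ?_ ?_).1 ?_
  · exact (Measurable.mul (by fun_prop) (measurable_levyDensity ha₀)).aestronglyMeasurable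
  · exact Filter.Eventually.of_forall (one_sub_cos_mul_levyDensity_nonneg hα₀ hpos k)
  · rw [lintegral_one_sub_cos_mul_levyDensity hd hα₀ hα₂ ha₀ hpos]
    exact ENNReal.ofReal_ne_top

/-- The Lévy–Khintchine representation of the stable exponent. -/
lemma stableExponent_eq_integral (hd : 1 ≤ d) (hα₀ : 0 < α) (hα₂ : α < 2)
    (ha₀ : ContinuousOn a₀ (Metric.sphere 0 1))
    (hpos : ∀ x ∈ Metric.sphere (0 : EuclideanSpace ℝ (Fin d)) 1, 0 ≤ a₀ x)
    (k : EuclideanSpace ℝ (Fin d)) :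
    stableExponent α a₀ k = ∫ y, (1 - Real.cos (inner ℝ k y)) * levyDensity α a₀ y := by
  rw [integral_eq_lintegral_of_nonneg_ae
    (Filter.Eventually.of_forall (one_sub_cos_mul_levyDensity_nonneg hα₀ hpos k))
    (integrable_one_sub_cos_mul_levyDensity hd hα₀ hα₂ ha₀ hpos k).aestronglyMeasurable,
    lintegral_one_sub_cos_mul_levyDensity hd hα₀ hα₂ ha₀ hpos,
    ENNReal.toReal_ofReal (stableExponent_nonneg hα₀ hα₂ hpos k)]

/-- Neither w nor the symbol is integrable, but two factors e^{i(h,y)} - 1 equal 2(1-cos(h,y)) in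
modulus, which tames w at 0, and the remaining m-2 factors are bounded by 2. -/
lemma integrable_planeWave_sub_one_pow_mul_levyDensity (hd : 1 ≤ d) (hα₀ : 0 < α) (hα₂ : α < 2)
    (ha₀ : ContinuousOn a₀ (Metric.sphere 0 1))
    (hpos : ∀ x ∈ Metric.sphere (0 : EuclideanSpace ℝ (Fin d)) 1, 0 ≤ a₀ x)
    {m : ℕ} (hm : 2 ≤ m) (h : EuclideanSpace ℝ (Fin d)) :
    Integrable fun y => (planeWave h y - 1) ^ m * (levyDensity α a₀ y : ℂ) := by
  refine ((integrable_one_sub_cos_mul_levyDensity hd hα₀ hα₂ ha₀ hpos h).const_mul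
    (2 ^ (m - 2) * 2)).mono' ?_ ?_
  · refine Measurable.aestronglyMeasurable (Measurable.mul ?_
      (Complex.measurable_ofReal.comp (measurable_levyDensity ha₀)))
    exact ((continuous_planeWave_right h).sub continuous_const |>.pow m).measurable
  · refine Filter.Eventually.of_forall fun y => ?_
    have hw := levyDensity_nonneg (α := α) (by positivity) hpos y
    rw [norm_mul, norm_pow, Complex.norm_real, Real.norm_of_nonneg hw]
    obtain ⟨n, rfl⟩ := Nat.exists_eq_add_of_le hm
    have h2 : ‖planeWave h y - 1‖ ≤ 2 := by
      refine (norm_sub_le _ _).trans ?_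
      rw [norm_planeWave]; norm_num
    rw [add_comm 2 n, Nat.add_sub_cancel, pow_add, norm_planeWave_sub_one_sq]
    have h3 : ‖planeWave h y - 1‖ ^ n ≤ 2 ^ n := by gcongr
    have h4 := one_sub_cos_mul_levyDensity_nonneg (α := α) hα₀ hpos h y
    calc ‖planeWave h y - 1‖ ^ n * (2 * (1 - Real.cos (inner ℝ h y))) * levyDensity α a₀ y
        = ‖planeWave h y - 1‖ ^ n * (2 * ((1 - Real.cos (inner ℝ h y)) * levyDensity α a₀ y)) := by
          ring
      _ ≤ 2 ^ n * (2 * ((1 - Real.cos (inner ℝ h y)) * levyDensity α a₀ y)) := by gcongr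
      _ = _ := by ring

/-- Differences of the stable exponent are Fourier transforms of integrable functions. -/
lemma integral_planeWave_levyDensity (hd : 1 ≤ d) (hα₀ : 0 < α) (hα₂ : α < 2)
    (ha₀ : ContinuousOn a₀ (Metric.sphere 0 1))
    (hpos : ∀ x ∈ Metric.sphere (0 : EuclideanSpace ℝ (Fin d)) 1, 0 ≤ a₀ x)
    (heven : ∀ x ∈ Metric.sphere (0 : EuclideanSpace ℝ (Fin d)) 1, a₀ (-x) = a₀ x)
    {m : ℕ} (hm : 2 ≤ m) (h k : EuclideanSpace ℝ (Fin d)) :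
    ∫ y, planeWave k y * ((planeWave h y - 1) ^ m * (levyDensity α a₀ y : ℂ))
      = -(((fwdDiff h)^[m] (stableExponent α a₀) k : ℝ) : ℂ) := by
  have hi := integrable_planeWave_sub_one_pow_mul_levyDensity hd hα₀ hα₂ ha₀ hpos hm h
  have hi' : Integrable fun y =>
      planeWave k y * ((planeWave h y - 1) ^ m * (levyDensity α a₀ y : ℂ)) :=
    hi.bdd_mul (c := 1) (continuous_planeWave_right k).aestronglyMeasurable
      (Filter.Eventually.of_forall fun y => (norm_planeWave k y).le)
  apply Complex.ext
  · have h1 : (∫ y, planeWave k y * ((planeWave h y - 1) ^ m * (levyDensity α a₀ y : ℂ))).re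
        = ∫ y, (planeWave k y * ((planeWave h y - 1) ^ m * (levyDensity α a₀ y : ℂ))).re :=
      (integral_re hi').symm
    rw [h1, Complex.neg_re, Complex.ofReal_re, fwdDiff_iter_eq_sum_shift]
    simp_rw [stableExponent_eq_integral hd hα₀ hα₂ ha₀ hpos, ← Int.cast_smul_eq_zsmul ℝ,
      smul_eq_mul, ← integral_const_mul]
    rw [← integral_finsetSum _ fun j _ =>
      (integrable_one_sub_cos_mul_levyDensity hd hα₀ hα₂ ha₀ hpos _).const_mul _, ← integral_neg]
    refine integral_congr_ae (Filter.Eventually.of_forall fun y => ?_)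
    beta_reduce
    have h2 : (planeWave k y * ((planeWave h y - 1) ^ m * (levyDensity α a₀ y : ℂ))).re
        = (fwdDiff h)^[m] (fun κ => Real.cos (inner ℝ κ y)) k * levyDensity α a₀ y := by
      rw [← mul_assoc, Complex.re_mul_ofReal, ← fwdDiff_iter_planeWave, re_fwdDiff_iter]
      simp_rw [planeWave_re]
    -- A difference of positive order kills the constant 1, so only minus the cosine, the real part
    -- of the plane wave, survives.
    have h3 : (fwdDiff h)^[m] (fun κ => 1 - Real.cos (inner ℝ κ y)) k
        = -(fwdDiff h)^[m] (fun κ => Real.cos (inner ℝ κ y)) k := by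
      have h4 : (fun κ => 1 - Real.cos (inner ℝ κ y))
          = (fun _ => (1 : ℝ)) + (-1 : ℝ) • fun κ => Real.cos (inner ℝ κ y) := by
        funext κ; simp [sub_eq_add_neg]
      have h5 : (fwdDiff h)^[m] (fun _ : EuclideanSpace ℝ (Fin d) => (1 : ℝ)) = 0 := by
        obtain ⟨n, rfl⟩ := Nat.exists_eq_add_of_le' (by omega : 1 ≤ m)
        rw [Function.iterate_add_apply, Function.iterate_one, fwdDiff_const]
        funext κ
        simp [fwdDiff_iter_eq_sum_shift]
      rw [h4, fwdDiff_iter_add, fwdDiff_iter_const_smul, h5]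
      simp
    rw [h2, ← neg_eq_iff_eq_neg, ← neg_mul, ← h3, fwdDiff_iter_eq_sum_shift, Finset.sum_mul]
    refine Finset.sum_congr rfl fun j _ => ?_
    rw [← Int.cast_smul_eq_zsmul ℝ, smul_eq_mul]
    ring
  -- The substitution y ↦ -y conjugates the integrand since w is even, so the integral is real.
  · have h1 := integral_neg_eq_self
      (fun y => planeWave k y * ((planeWave h y - 1) ^ m * (levyDensity α a₀ y : ℂ))) volume
    have h2 : ∀ y, planeWave k (-y) * ((planeWave h (-y) - 1) ^ m * (levyDensity α a₀ (-y) : ℂ))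
        = starRingEnd ℂ
          (planeWave k y * ((planeWave h y - 1) ^ m * (levyDensity α a₀ y : ℂ))) := by
      intro y
      simp [planeWave_neg_right, levyDensity_neg heven]
    simp_rw [h2] at h1
    rw [integral_conj] at h1
    have h3 := congrArg Complex.im h1
    simp only [Complex.conj_im] at h3
    simp only [Complex.neg_im, Complex.ofReal_im, neg_zero]
    linarith

end LevyKhintchine

/-! ### Standing hypotheses and the stable exponent -/

section Setup

/-- A symmetric jump law whose Fourier transform has a stable expansion at the origin, with
positive angular density `a₀`. -/
structure IsStableWalk {d : ℕ} (α : ℝ) (a : (Fin d → ℤ) → ℝ)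
    (b : ℕ → EuclideanSpace ℝ (Fin d) → ℝ) (a₀ : EuclideanSpace ℝ (Fin d) → ℝ) : Prop where
  one_le : 1 ≤ d
  pos : 0 < α
  lt_two : α < 2
  jumpLaw : IsSymmetricJumpLaw a
  expansion : HasFourierExpansion α a b
  cont : ContinuousOn a₀ (Metric.sphere 0 1)
  even : ∀ x ∈ Metric.sphere (0 : EuclideanSpace ℝ (Fin d)) 1, a₀ (-x) = a₀ x
  lower : ∃ δ : ℝ, 0 < δ ∧ ∀ x ∈ Metric.sphere (0 : EuclideanSpace ℝ (Fin d)) 1, δ < a₀ x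
  coeff_zero : ∀ k ∈ Metric.sphere (0 : EuclideanSpace ℝ (Fin d)) 1, b 0 k = stableExponent α a₀ k
  lt_one : ∀ k : EuclideanSpace ℝ (Fin d), (∀ i, |k i| ≤ Real.pi) → k ≠ 0 → jumpFourier a k < 1

variable {d : ℕ} {α : ℝ} {a : (Fin d → ℤ) → ℝ} {b : ℕ → EuclideanSpace ℝ (Fin d) → ℝ}
  {a₀ : EuclideanSpace ℝ (Fin d) → ℝ}

lemma stableExponent_smul {c : ℝ} (hc : 0 < c) (k : EuclideanSpace ℝ (Fin d)) :
    stableExponent α a₀ (c • k) = c ^ α * stableExponent α a₀ k := by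
  rw [stableExponent, stableExponent, mul_left_comm]
  congr 1
  rw [← integral_const_mul]
  congr 1
  funext x
  rw [inner_smul_right, abs_mul, abs_of_pos hc, Real.mul_rpow hc.le (abs_nonneg _)]
  ring

lemma stableExponent_zero (hα₀ : 0 < α) :
    stableExponent α a₀ (0 : EuclideanSpace ℝ (Fin d)) = 0 := by
  simp [stableExponent, Real.zero_rpow hα₀.ne']

lemma stableExponent_neg (k : EuclideanSpace ℝ (Fin d)) :
    stableExponent α a₀ (-k) = stableExponent α a₀ k := by
  simp [stableExponent]

/-- The homogeneous term `b_j(k/|k|) |k|^{α+j}` of the expansion. -/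
noncomputable def homTerm (α : ℝ) (b : ℕ → EuclideanSpace ℝ (Fin d) → ℝ) (j : ℕ)
    (k : EuclideanSpace ℝ (Fin d)) : ℝ :=
  b j (direction k) * ‖k‖ ^ (α + (j : ℝ))

lemma homTerm_smul {c : ℝ} (hc : 0 < c) (j : ℕ) (k : EuclideanSpace ℝ (Fin d)) :
    homTerm α b j (c • k) = c ^ (α + j) * homTerm α b j k := by
  rw [homTerm, homTerm, direction_smul hc, norm_smul, Real.norm_eq_abs, abs_of_pos hc,
    Real.mul_rpow hc.le (norm_nonneg _)]
  ring

lemma homTerm_zero_right (hα₀ : 0 < α) (j : ℕ) :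
    homTerm α b j (0 : EuclideanSpace ℝ (Fin d)) = 0 := by
  have : α + j ≠ 0 := by positivity
  simp [homTerm, Real.zero_rpow this]

lemma contDiffOn_homTerm {n j : ℕ} (h : IsSphereSmooth n (b j)) :
    ContDiffOn ℝ n (homTerm α b j) ({0}ᶜ : Set (EuclideanSpace ℝ (Fin d))) := by
  refine ContDiffOn.mul h ?_
  refine ContDiffOn.rpow_const_of_ne (contDiffOn_id.norm ℝ fun k hk => hk) fun k hk => ?_
  exact norm_ne_zero_iff.2 hk

/-- The order m = d+⌊α⌋+1 is the least integer above d+α. The strict excess makes ‖k‖^{α-m}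
integrable at infinity and leaves room for a power saving in the tail of a. -/
lemma dim_add_lt_order (d : ℕ) (α : ℝ) : (d : ℝ) + α < ((d + ⌊α⌋₊ + 1 : ℕ) : ℝ) := by
  have := Nat.lt_floor_add_one α
  push_cast
  linarith

namespace IsStableWalk

lemma dim_add_pos (W : IsStableWalk α a b a₀) : 0 < (d : ℝ) + α := by
  have := W.pos
  positivity

lemma nonneg_a₀ (W : IsStableWalk α a b a₀) : ∀ x ∈ Metric.sphere (0 : EuclideanSpace ℝ (Fin d)) 1, 0 ≤ a₀ x := by
  obtain ⟨δ, hδ, h⟩ := W.lower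
  exact fun x hx => (hδ.trans (h x hx)).le

lemma exponent_eq (W : IsStableWalk α a b a₀) (k : EuclideanSpace ℝ (Fin d)) :
    b 0 (direction k) * ‖k‖ ^ α = stableExponent α a₀ k := by
  by_cases hk : k = 0
  · simp [hk, stableExponent_zero W.pos, Real.zero_rpow W.pos.ne']
  · have h1 := W.coeff_zero _ (direction_mem_sphere hk)
    rw [h1, mul_comm, ← stableExponent_smul (norm_pos_iff.2 hk), norm_smul_direction]

lemma homTerm_zero (W : IsStableWalk α a b a₀) : homTerm α b 0 = stableExponent α a₀ := by
  funext k
  rw [← W.exponent_eq k]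
  simp [homTerm]

lemma le_dim_add (W : IsStableWalk α a b a₀) : ((d + ⌊α⌋₊ + 1 : ℕ) : ℝ) ≤ d + α + 1 := by
  have := Nat.floor_le W.pos.le
  push_cast
  linarith

lemma two_le_order (W : IsStableWalk α a b a₀) : 2 ≤ d + ⌊α⌋₊ + 1 := by
  have := W.one_le
  omega

lemma contDiffOn_stableExponent (W : IsStableWalk α a b a₀) :
    ContDiffOn ℝ ((d + ⌊α⌋₊ + 1 : ℕ) : WithTop ℕ∞) (stableExponent α a₀) {0}ᶜ := by
  rw [← W.homTerm_zero]
  exact contDiffOn_homTerm (W.expansion.smooth_coeff 0 (Nat.zero_le _))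

/-- Two-sided bounds on the exponent. -/
lemma exponent_bounds (W : IsStableWalk α a b a₀) : ∃ c C : ℝ, 0 < c ∧ 0 < C ∧ ∀ k : EuclideanSpace ℝ (Fin d),
    c * ‖k‖ ^ α ≤ stableExponent α a₀ k ∧ stableExponent α a₀ k ≤ C * ‖k‖ ^ α := by
  have hS : IsCompact (Metric.sphere (0 : EuclideanSpace ℝ (Fin d)) 1) := isCompact_sphere 0 1
  have hSU : Metric.sphere (0 : EuclideanSpace ℝ (Fin d)) 1 ⊆ {0}ᶜ := by
    intro x hx hx0
    simp_all
  have : Nonempty (Fin d) := ⟨⟨0, W.one_le⟩⟩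
  have hne : (Metric.sphere (0 : EuclideanSpace ℝ (Fin d)) 1).Nonempty :=
    NormedSpace.sphere_nonempty.2 zero_le_one
  have hc := W.contDiffOn_stableExponent.continuousOn.mono hSU
  have hpos : ∀ k : EuclideanSpace ℝ (Fin d), k ≠ 0 → 0 < stableExponent α a₀ k := by
    intro k hk
    rw [stableExponent_eq_integral W.one_le W.pos W.lt_two W.cont W.nonneg_a₀]
    have hnn := one_sub_cos_mul_levyDensity_nonneg (α := α) W.pos W.nonneg_a₀ k
    rw [integral_pos_iff_support_of_nonneg hnn
      (integrable_one_sub_cos_mul_levyDensity W.one_le W.pos W.lt_two W.cont W.nonneg_a₀ k)]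
    -- On the open strip 0 < (k,y) < 1 both 1-cos(k,y) and w are positive, which makes the
    -- Lévy–Khintchine integral positive.
    have hopen : IsOpen ({y | 0 < inner ℝ k y} ∩ {y | inner ℝ k y < 1} :
        Set (EuclideanSpace ℝ (Fin d))) :=
      (isOpen_lt continuous_const (by fun_prop)).inter (isOpen_lt (by fun_prop) continuous_const)
    have hk2 : 0 < ‖k‖ ^ 2 := by have := norm_pos_iff.2 hk; positivity
    have hnemp : ({y | 0 < inner ℝ k y} ∩ {y | inner ℝ k y < 1} :
        Set (EuclideanSpace ℝ (Fin d))).Nonempty := by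
      refine ⟨((1 / 2) / ‖k‖ ^ 2) • k, ?_, ?_⟩ <;>
      · simp only [Set.mem_ofPred_eq, inner_smul_right, real_inner_self_eq_norm_sq]
        rw [div_mul_cancel₀ _ hk2.ne']
        norm_num
    refine (hopen.measure_pos volume hnemp).trans_le (measure_mono ?_)
    rintro y ⟨hy1, hy2⟩
    have hy0 : y ≠ 0 := by
      rintro rfl
      simp at hy1
    obtain ⟨δ, hδ, hlow⟩ := W.lower
    have h1 : 0 < levyDensity α a₀ y := by
      have := norm_pos_iff.2 hy0
      have := hδ.trans (hlow _ (direction_mem_sphere hy0))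
      unfold levyDensity
      positivity
    have h2 : Real.cos (inner ℝ k y) < 1 := by
      rw [← Real.cos_zero]
      refine Real.cos_lt_cos_of_nonneg_of_le_pi le_rfl ?_ hy1
      have := Real.pi_gt_three
      have : inner ℝ k y < 1 := hy2
      linarith
    exact (mul_pos (sub_pos.2 h2) h1).ne'
  obtain ⟨k₀, hk₀, hmin⟩ := hS.exists_isMinOn hne hc
  obtain ⟨k₁, hk₁, hmax⟩ := hS.exists_isMaxOn hne hc
  refine ⟨stableExponent α a₀ k₀, stableExponent α a₀ k₁, hpos _ (hSU hk₀), hpos _ (hSU hk₁),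
    fun k => ?_⟩
  by_cases hk : k = 0
  · simp [hk, stableExponent_zero W.pos, Real.zero_rpow W.pos.ne']
  · have h1 : stableExponent α a₀ k = ‖k‖ ^ α * stableExponent α a₀ (direction k) := by
      rw [← stableExponent_smul (norm_pos_iff.2 hk), norm_smul_direction]
    have h2 : stableExponent α a₀ k₀ ≤ stableExponent α a₀ (direction k) :=
      hmin (direction_mem_sphere hk)
    have h3 : stableExponent α a₀ (direction k) ≤ stableExponent α a₀ k₁ :=
      hmax (direction_mem_sphere hk)
    rw [h1, mul_comm (‖k‖ ^ α)]
    constructor <;> gcongr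

lemma continuous_stableExponent (W : IsStableWalk α a b a₀) :
    Continuous (stableExponent α a₀ : EuclideanSpace ℝ (Fin d) → ℝ) := by
  rw [continuous_iff_continuousAt]
  intro k
  by_cases hk : k = 0
  · subst hk
    obtain ⟨c, C, hc, hC, hb⟩ := W.exponent_bounds
    rw [ContinuousAt, stableExponent_zero W.pos]
    have hlim : Filter.Tendsto (fun k : EuclideanSpace ℝ (Fin d) => C * ‖k‖ ^ α) (nhds 0)
        (nhds 0) := by
      have h1 : ContinuousAt (fun k : EuclideanSpace ℝ (Fin d) => C * ‖k‖ ^ α) 0 :=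
        (continuous_const.mul (continuous_norm.rpow_const fun _ => Or.inr W.pos.le)).continuousAt
      simpa [ContinuousAt, Real.zero_rpow W.pos.ne'] using h1
    exact squeeze_zero (fun k => stableExponent_nonneg W.pos W.lt_two W.nonneg_a₀ k)
      (fun k => (hb k).2) hlim
  · exact W.contDiffOn_stableExponent.continuousOn.continuousAt
      (isOpen_compl_singleton.mem_nhds hk)

lemma fwdDiff_iter_stableExponent_le (W : IsStableWalk α a b a₀) :
    ∃ C : ℝ, 0 ≤ C ∧ ∀ γ : ℝ, γ ≤ 0 → α - ((d + ⌊α⌋₊ + 1 : ℕ) : ℝ) ≤ γ →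
      ∀ h k : EuclideanSpace ℝ (Fin d), k ≠ 0 →
      |(fwdDiff h)^[d + ⌊α⌋₊ + 1] (stableExponent α a₀) k| ≤ C * (‖h‖ ^ (α - γ) * ‖k‖ ^ γ) :=
  fwdDiff_iter_le_of_homogeneous W.pos _ W.contDiffOn_stableExponent
    (fun _ hc k => stableExponent_smul hc k) (stableExponent_zero W.pos)

end IsStableWalk

end Setup

/-! ### Differences of the symbol of the jump law -/

section JumpTail

variable {d : ℕ} {α : ℝ} {a : (Fin d → ℤ) → ℝ} {b : ℕ → EuclideanSpace ℝ (Fin d) → ℝ}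
  {a₀ : EuclideanSpace ℝ (Fin d) → ℝ}

lemma fwdDiff_iter_congr {V G : Type*} [AddCommMonoid V] [AddCommGroup G] {g g' : V → G} {n : ℕ}
    {h k : V} (H : ∀ j ≤ n, g (k + j • h) = g' (k + j • h)) :
    (fwdDiff h)^[n] g k = (fwdDiff h)^[n] g' k := by
  rw [fwdDiff_iter_eq_sum_shift, fwdDiff_iter_eq_sum_shift]
  exact Finset.sum_congr rfl fun j hj => by rw [H j (by simpa [Nat.lt_succ_iff] using hj)]

lemma fwdDiff_iter_const_eq_zero {V G : Type*} [AddCommMonoid V] [AddCommGroup G] {n : ℕ}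
    (hn : 1 ≤ n) (h k : V) (c : G) : (fwdDiff h)^[n] (fun _ => c) k = 0 := by
  obtain ⟨n, rfl⟩ := Nat.exists_eq_add_of_le' hn
  rw [Function.iterate_add_apply, Function.iterate_one, fwdDiff_const]
  simp [fwdDiff_iter_eq_sum_shift]

/-- The lattice 2πℤ^d is the zero set of the continuous function Σ(1-cos kᵢ). -/
lemma isOpen_compl_dualLattice :
    IsOpen {k : EuclideanSpace ℝ (Fin d) | ∀ n : Fin d → ℤ, k ≠ (2 * Real.pi) • latticeVec n} := by
  have h : {k : EuclideanSpace ℝ (Fin d) | ∀ n : Fin d → ℤ, k ≠ (2 * Real.pi) • latticeVec n}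
      = {k | ∑ i, (1 - Real.cos (k i)) ≠ 0} := by
    ext k
    simp only [Set.mem_ofPred_eq, ne_eq]
    rw [Finset.sum_eq_zero_iff_of_nonneg fun i _ => sub_nonneg.2 (Real.cos_le_one _)]
    simp only [Finset.mem_univ, forall_const]
    constructor
    · intro hk hcos
      have h1 : ∀ i, ∃ n : ℤ, (n : ℝ) * (2 * Real.pi) = k i := fun i =>
        (Real.cos_eq_one_iff _).1 (by linarith [hcos i])
      choose n hn using h1
      refine hk n ?_
      ext i
      simp [latticeVec, ← hn i, mul_comm]
    · intro hk n hn
      refine hk fun i => ?_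
      have : k i = (n i : ℝ) * (2 * Real.pi) := by simp [hn, latticeVec, mul_comm]
      rw [this, (Real.cos_eq_one_iff _).2 ⟨n i, rfl⟩, sub_self]
  rw [h]
  exact isOpen_ne_fun (by fun_prop) continuous_const

lemma eq_zero_of_mem_piCube {k : EuclideanSpace ℝ (Fin d)} (hk : k ∈ piCube d) {n : Fin d → ℤ}
    (hn : k = (2 * Real.pi) • latticeVec n) : k = 0 := by
  have hpi := Real.pi_pos
  have h1 : n = 0 := by
    funext i
    have h2 := hk i
    have h3 : k i = 2 * Real.pi * (n i : ℝ) := by simp [hn, latticeVec]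
    rw [h3, abs_mul, abs_of_pos (by positivity)] at h2
    have h4 : |(n i : ℝ)| < 1 := by nlinarith
    have h5 : |n i| < 1 := by exact_mod_cast h4
    simpa using Int.abs_lt_one_iff.1 h5
  rw [hn, h1, latticeVec_zero, smul_zero]

namespace IsStableWalk

lemma fwdDiff_iter_jumpFourier_away (W : IsStableWalk α a b a₀) {ρ : ℝ} (hρ : 0 < ρ) :
    ∃ r > 0, ∃ C : ℝ, 0 ≤ C ∧ ∀ k ∈ piCube d \ Metric.ball 0 ρ, ∀ h : EuclideanSpace ℝ (Fin d),
      ‖h‖ ≤ r →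
      ‖(fwdDiff h)^[d + ⌊α⌋₊ + 1] (jumpFourier a) k‖ ≤ C * ‖h‖ ^ (d + ⌊α⌋₊ + 1) := by
  refine fwdDiff_iter_le_of_isCompact isOpen_compl_dualLattice
    (isCompact_piCube.diff Metric.isOpen_ball) ?_ _ W.expansion.smooth_away
  -- The origin is the only point of 2πℤ^d in the cube, so removing a ball leaves a compact set on
  -- which â is smooth.
  rintro k ⟨hk, hkρ⟩ n hn
  refine hkρ ?_
  rw [eq_zero_of_mem_piCube hk hn]
  exact Metric.mem_ball_self hρ

/-- Adding the exponent to â cancels its leading singularity and leaves the terms of degree at least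
α+1 and the smooth f. The bound gains ‖h‖^σ beyond the order ‖h‖^{d+α} of the main term while
remaining integrable in k at 0. -/
lemma fwdDiff_iter_jumpFourier_near (W : IsStableWalk α a b a₀) {σ : ℝ} (hσ : 0 < σ)
    (hσ' : d + α + 2 * σ = ((d + ⌊α⌋₊ + 1 : ℕ) : ℝ)) :
    ∃ ρ > 0, ρ ≤ 1 ∧ ∃ r > 0, ∃ C : ℝ, 0 ≤ C ∧ ∀ k ∈ Metric.ball (0 : EuclideanSpace ℝ (Fin d)) ρ,
      k ≠ 0 → ∀ h : EuclideanSpace ℝ (Fin d), ‖h‖ ≤ r →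
      ‖(fwdDiff h)^[d + ⌊α⌋₊ + 1] (jumpFourier a) k
          + (fwdDiff h)^[d + ⌊α⌋₊ + 1] (stableExponent α a₀) k‖
        ≤ C * ‖h‖ ^ (d + α + σ) * (‖k‖ ^ (1 - (d : ℝ) - σ) + 1) := by
  set m := d + ⌊α⌋₊ + 1 with hm
  have hm1 : 1 ≤ m := by omega
  have hσ1 : 2 * σ ≤ 1 := by have := W.le_dim_add; rw [← hm] at this; linarith
  obtain ⟨f, hf, hf0, hexp⟩ := W.expansion.expansion
  obtain ⟨u, hu, hfu⟩ := hf.contDiffOn le_rfl fun h => absurd h (by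
    rw [← hm]; exact_mod_cast ENat.natCast_ne_top m)
  have hu' : interior u ∈ nhds (0 : EuclideanSpace ℝ (Fin d)) := interior_mem_nhds.2 (by
    simpa using hu)
  obtain ⟨ρ₁, hρ₁, hball₁⟩ := Metric.eventually_nhds_iff_ball.1 hexp
  obtain ⟨r₂, hr₂, C₂, hC₂, hb₂⟩ := fwdDiff_iter_le_of_contDiffOn isOpen_interior m
    (hfu.mono interior_subset) (mem_of_mem_nhds hu')
  have hg : ∀ j ∈ Finset.Icc 1 d, ∃ C : ℝ, 0 ≤ C ∧
      ∀ h k : EuclideanSpace ℝ (Fin d), k ≠ 0 → |(fwdDiff h)^[m] (homTerm α b j) k|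
        ≤ C * (‖h‖ ^ (d + α + σ) * ‖k‖ ^ ((j : ℝ) - d - σ)) := by
    intro j hj
    obtain ⟨hj1, hjd⟩ := Finset.mem_Icc.1 hj
    have hj1' : (1 : ℝ) ≤ j := by exact_mod_cast hj1
    have hjd' : (j : ℝ) ≤ d := by exact_mod_cast hjd
    obtain ⟨C, hC, hb⟩ := fwdDiff_iter_le_of_homogeneous (β := α + j)
      (by have := W.pos; positivity) m
      (contDiffOn_homTerm (α := α) (W.expansion.smooth_coeff j hjd))
      (fun c hc k => homTerm_smul hc j k) (homTerm_zero_right W.pos j)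
    refine ⟨C, hC, fun h k hk => ?_⟩
    -- The choice γ = j-d-σ lies between β-m = j-d-2σ and 0, the latter because j ≤ d; it makes the
    -- power of ‖h‖ equal to d+α+σ for every j.
    have := hb ((j : ℝ) - d - σ) (by linarith) (by linarith) h k hk
    rwa [show α + (j : ℝ) - ((j : ℝ) - d - σ) = d + α + σ by ring] at this
  choose! Cg hCg hbg using hg
  have hm0 : (0 : ℝ) < 2 * (m + 1) := by positivity
  refine ⟨min (min (ρ₁ / 2) r₂) 1, by positivity, min_le_right _ _,
    min (min (ρ₁ / (2 * (m + 1))) r₂) 1, by positivity, C₂ + ∑ j ∈ Finset.Icc 1 d, Cg j,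
    add_nonneg hC₂ (Finset.sum_nonneg hCg), fun k hk hk0 h hh => ?_⟩
  have hk' : ‖k‖ < min (min (ρ₁ / 2) r₂) 1 := by simpa using hk
  have hk1 : ‖k‖ < ρ₁ / 2 := hk'.trans_le ((min_le_left _ _).trans (min_le_left _ _))
  have hk2 : ‖k‖ < r₂ := hk'.trans_le ((min_le_left _ _).trans (min_le_right _ _))
  have hk3 : ‖k‖ ≤ 1 := (hk'.trans_le (min_le_right _ _)).le
  have hh1 : ‖h‖ ≤ ρ₁ / (2 * (m + 1)) := hh.trans ((min_le_left _ _).trans (min_le_left _ _))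
  have hh2 : ‖h‖ ≤ r₂ := hh.trans ((min_le_left _ _).trans (min_le_right _ _))
  have hh3 : ‖h‖ ≤ 1 := hh.trans (min_le_right _ _)
  have hkpos : 0 < ‖k‖ := norm_pos_iff.2 hk0
  have hmem : ∀ j ≤ m, k + j • h ∈ Metric.ball (0 : EuclideanSpace ℝ (Fin d)) ρ₁ := by
    intro j hj
    rw [mem_ball_zero_iff]
    have h1 : ‖j • h‖ ≤ m * (ρ₁ / (2 * (m + 1))) := by
      refine norm_nsmul_le.trans ?_
      have : (j : ℝ) ≤ m := by exact_mod_cast hj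
      gcongr
    have h2 : (m : ℝ) * (ρ₁ / (2 * (m + 1))) ≤ ρ₁ / 2 := by
      rw [mul_div_assoc', div_le_div_iff₀ hm0 two_pos]
      nlinarith
    have := norm_add_le k (j • h)
    linarith
  have hexp' : (fwdDiff h)^[m] (jumpFourier a) k
      = -(fwdDiff h)^[m] (stableExponent α a₀) k
        - ∑ j ∈ Finset.Icc 1 d, (fwdDiff h)^[m] (homTerm α b j) k + (fwdDiff h)^[m] f k := by
    have h1 : (fwdDiff h)^[m] (jumpFourier a) k = (fwdDiff h)^[m]
        ((fun _ => (1 : ℝ)) + (-1 : ℝ) • (∑ j ∈ Finset.range (d + 1), homTerm α b j) + f) k := by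
      refine fwdDiff_iter_congr fun j hj => ?_
      rw [hball₁ _ (hmem j hj)]
      simp [homTerm, sub_eq_add_neg]
    have h2 : Finset.range (d + 1) = insert 0 (Finset.Icc 1 d) := by
      ext j; simp; omega
    rw [h1, fwdDiff_iter_add, fwdDiff_iter_add, fwdDiff_iter_const_smul, fwdDiff_iter_finsetSum,
      h2, Finset.sum_insert (by simp), W.homTerm_zero]
    simp only [Pi.add_apply, Pi.smul_apply, Finset.sum_apply, smul_eq_mul,
      fwdDiff_iter_const_eq_zero hm1]
    ring
  rw [hexp', show ∀ A B D : ℝ, -A - B + D + A = D - B by intros; ring]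
  have hA : ‖h‖ ^ m ≤ ‖h‖ ^ (d + α + σ) := by
    rcases eq_or_ne h 0 with rfl | hne
    · rw [norm_zero, zero_pow (by omega)]
      positivity
    · rw [← Real.rpow_natCast]
      exact Real.rpow_le_rpow_of_exponent_ge (norm_pos_iff.2 hne) hh3 (by linarith)
  have hf1 : ‖(fwdDiff h)^[m] f k‖ ≤ C₂ * ‖h‖ ^ (d + α + σ) :=
    (hb₂ k (by simpa using hk2) h hh2).trans (by gcongr)
  have hg1 : ‖∑ j ∈ Finset.Icc 1 d, (fwdDiff h)^[m] (homTerm α b j) k‖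
      ≤ (∑ j ∈ Finset.Icc 1 d, Cg j) * (‖h‖ ^ (d + α + σ) * ‖k‖ ^ (1 - (d : ℝ) - σ)) := by
    rw [Finset.sum_mul]
    refine norm_sum_le_of_le _ fun j hj => (hbg j hj h k hk0).trans ?_
    have := hCg j hj
    have hj1 : (1 : ℝ) ≤ j := by exact_mod_cast (Finset.mem_Icc.1 hj).1
    have h3 : ‖k‖ ^ ((j : ℝ) - d - σ) ≤ ‖k‖ ^ (1 - (d : ℝ) - σ) :=
      Real.rpow_le_rpow_of_exponent_ge hkpos hk3 (by linarith)
    gcongr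
  have hCs : 0 ≤ ∑ j ∈ Finset.Icc 1 d, Cg j := Finset.sum_nonneg hCg
  have hkp : 0 ≤ ‖k‖ ^ (1 - (d : ℝ) - σ) := by positivity
  have hhp : 0 ≤ ‖h‖ ^ (d + α + σ) := by positivity
  have hfin := norm_sub_le ((fwdDiff h)^[m] f k)
    (∑ j ∈ Finset.Icc 1 d, (fwdDiff h)^[m] (homTerm α b j) k)
  have e1 := mul_nonneg (mul_nonneg hC₂ hhp) hkp
  have e2 := mul_nonneg hCs hhp
  nlinarith

/-- The m-th difference decays like ‖k‖^{α-m} with m-α > d. Integrability permits pointwise Fourier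
inversion. -/
lemma integrable_fwdDiff_iter_stableExponent (W : IsStableWalk α a b a₀)
    (h : EuclideanSpace ℝ (Fin d)) :
    Integrable ((fwdDiff h)^[d + ⌊α⌋₊ + 1] (stableExponent α a₀)) := by
  obtain ⟨C, hC, hb⟩ := W.fwdDiff_iter_stableExponent_le
  set m := d + ⌊α⌋₊ + 1 with hm
  have hlt := dim_add_lt_order d α
  rw [← hm] at hlt
  have hcont : Continuous ((fwdDiff h)^[m] (stableExponent α a₀)) := by
    rw [show (fwdDiff h)^[m] (stableExponent α a₀) = fun k => _ from
      funext fun k => fwdDiff_iter_eq_sum_shift h _ m k]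
    have := W.continuous_stableExponent
    fun_prop
  have hd0 : (0 : ℝ) ≤ d := by positivity
  rw [← integrableOn_univ, ← Set.union_compl_self (Metric.ball (0 : EuclideanSpace ℝ (Fin d)) 1),
    integrableOn_union]
  constructor
  · exact (hcont.continuousOn.integrableOn_compact (isCompact_closedBall 0 1)).mono_set
      Metric.ball_subset_closedBall
  · refine ((integrableOn_norm_rpow_compl_ball W.one_le (γ := α - m) (by linarith)
      one_pos).const_mul (C * ‖h‖ ^ (m : ℝ))).mono' hcont.aestronglyMeasurable ?_
    refine (ae_restrict_iff' measurableSet_ball.compl).2 (Filter.Eventually.of_forall fun k hk => ?_)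
    have hk0 : k ≠ 0 := by rintro rfl; simp at hk
    have := hb (α - m) (by linarith) le_rfl h k hk0
    rw [Real.norm_eq_abs]
    refine this.trans (le_of_eq ?_)
    rw [sub_sub_cancel]; ring

end IsStableWalk

end JumpTail

/-! ### Tail of the jump law -/

section JumpAsymptotics

variable {d : ℕ} {α : ℝ} {a : (Fin d → ℤ) → ℝ} {b : ℕ → EuclideanSpace ℝ (Fin d) → ℝ}
  {a₀ : EuclideanSpace ℝ (Fin d) → ℝ}

namespace IsStableWalk

/-- The first-order tail of the jump law with a power-saving error. -/
lemma jumpLaw_asymptotics (W : IsStableWalk α a b a₀) :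
    ∃ σ > 0, ∃ C R : ℝ, 0 ≤ C ∧ 0 < R ∧ ∀ x : Fin d → ℤ, R ≤ ‖latticeVec x‖ →
      |a x - levyDensity α a₀ (latticeVec x)| ≤ C * ‖latticeVec x‖ ^ (-((d : ℝ) + α + σ)) := by
  have hpi := Real.pi_pos
  have hlt := dim_add_lt_order d α
  have hd0 : (0 : ℝ) ≤ d := by positivity
  have hα := W.pos
  -- σ is half of the excess of the order m over d+α: one half is the saving, the other keeps the
  -- exponents strict.
  obtain ⟨σ, hσ⟩ : ∃ σ : ℝ, d + α + 2 * σ = ((d + ⌊α⌋₊ + 1 : ℕ) : ℝ) :=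
    ⟨(((d + ⌊α⌋₊ + 1 : ℕ) : ℝ) - (d + α)) / 2, by ring⟩
  have hσ0 : 0 < σ := by linarith
  obtain ⟨ρ, hρ, hρ1, r₁, hr₁, C₁, hC₁, hnear⟩ := W.fwdDiff_iter_jumpFourier_near hσ0 hσ
  obtain ⟨r₂, hr₂, C₂, hC₂, haway⟩ := W.fwdDiff_iter_jumpFourier_away hρ
  obtain ⟨C₃, hC₃, hexp⟩ := W.fwdDiff_iter_stableExponent_le
  have hFi := W.integrable_fwdDiff_iter_stableExponent
  have hm2 := W.two_le_order
  have hle := W.le_dim_add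
  have hw := fun h k => integral_planeWave_levyDensity W.one_le W.pos W.lt_two W.cont W.nonneg_a₀
    W.even hm2 h k
  have hwi := fun h => integrable_planeWave_sub_one_pow_mul_levyDensity W.one_le W.pos W.lt_two
    W.cont W.nonneg_a₀ hm2 h
  set m := d + ⌊α⌋₊ + 1 with hm
  set B := Metric.ball (0 : EuclideanSpace ℝ (Fin d)) ρ with hB
  have hBQ : B ⊆ piCube d := by
    intro k hk i
    have h1 : ‖k‖ < ρ := by simpa [hB] using hk
    have h2 : |k i| ≤ ‖k‖ := by simpa using PiLp.norm_apply_le k i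
    linarith [Real.pi_gt_three]
  have hBm : MeasurableSet B := measurableSet_ball
  have hQm : MeasurableSet (piCube d) := measurableSet_piCube
  have hfinQ : volume (piCube d) ≠ ⊤ := isCompact_piCube.measure_lt_top.ne
  have hI1 : IntegrableOn (fun k : EuclideanSpace ℝ (Fin d) => ‖k‖ ^ (1 - (d : ℝ) - σ) + 1) B :=
    (integrableOn_norm_rpow_ball W.one_le (by linarith) ρ).add
      (integrableOn_const (measure_ball_lt_top).ne)
  have hI2 : IntegrableOn (fun k : EuclideanSpace ℝ (Fin d) => ‖k‖ ^ (α - m)) Bᶜ :=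
    integrableOn_norm_rpow_compl_ball W.one_le (by linarith) hρ
  set J₁ := ∫ k in B, (‖k‖ ^ (1 - (d : ℝ) - σ) + 1) with hJ₁
  set J₂ := ∫ k in Bᶜ, ‖k‖ ^ (α - m) with hJ₂
  have hJ₁0 : 0 ≤ J₁ := integral_nonneg fun k => by positivity
  have hJ₂0 : 0 ≤ J₂ := integral_nonneg fun k => by positivity
  set V := volume.real (piCube d) with hV
  have hV0 : 0 ≤ V := measureReal_nonneg
  set r := min (min r₁ r₂) 1 with hr
  have hr0 : 0 < r := lt_min (lt_min hr₁ hr₂) one_pos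
  refine ⟨σ, hσ0, (C₂ * V + C₁ * J₁ + C₃ * J₂) * Real.pi ^ (d + α + σ), Real.pi / r, by positivity,
    by positivity, fun x hx => ?_⟩
  set v := latticeVec x with hv
  have hX : 0 < ‖v‖ := lt_of_lt_of_le (by positivity) hx
  have hv0 : v ≠ 0 := norm_pos_iff.1 hX
  -- This step gives (h,x) = π, so e^{i(h,x)} - 1 = -2 at the very point x to be recovered, while
  -- ‖h‖ = π/‖x‖ turns powers of h into decay in x.
  set h : EuclideanSpace ℝ (Fin d) := (Real.pi / ‖v‖ ^ 2) • v with hh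
  have hhn : ‖h‖ = Real.pi / ‖v‖ := by
    rw [hh, norm_smul, Real.norm_eq_abs, abs_of_pos (by positivity)]
    field_simp
  have hhr : ‖h‖ ≤ r := by
    rw [hhn, div_le_iff₀ hX]
    rwa [div_le_iff₀ hr0, mul_comm] at hx
  have hh0 : 0 < ‖h‖ := by rw [hhn]; positivity
  have hphase : planeWave h v = -1 := by
    have : inner ℝ h v = Real.pi := by
      rw [hh, inner_smul_left, real_inner_self_eq_norm_sq]
      simp only [conj_trivial]
      field_simp
    rw [planeWave, this, mul_comm, Complex.exp_pi_mul_I]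
  -- the two exact identities
  have hs : Summable fun z => (a z : ℂ) :=
    Complex.summable_ofReal.2 W.jumpLaw.hasSum_one.summable
  obtain ⟨hs1, hs2⟩ := fwdDiff_iter_latticeFourier m hs h
  have hcast : ∀ k, (fwdDiff h)^[m] (latticeFourier fun z => (a z : ℂ)) k
      = (((fwdDiff h)^[m] (jumpFourier a) k : ℝ) : ℂ) := by
    intro k
    rw [ofReal_fwdDiff_iter, funext (latticeFourier_jumpLaw W.jumpLaw)]
  have e1 : ∫ k in piCube d, (((fwdDiff h)^[m] (jumpFourier a) k : ℝ) : ℂ) * planeWave k (-v)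
      = (2 * Real.pi) ^ d * ((a x : ℂ) * (-2) ^ m) := by
    have := coeff_latticeFourier hs1 x
    rw [← hs2] at this
    simp_rw [hcast, latticeChar_eq_planeWave, latticeVec_neg] at this
    rw [this, ← hv, hphase]
    norm_num
  have e2 : ∫ k, (((fwdDiff h)^[m] (stableExponent α a₀) k : ℝ) : ℂ) * planeWave k (-v)
      = -((2 * Real.pi) ^ d * ((levyDensity α a₀ v : ℂ) * (-2) ^ m)) := by
    have h1 : ContinuousAt (fun y => (planeWave h y - 1) ^ m * (levyDensity α a₀ y : ℂ)) v := by
      refine ContinuousAt.mul ?_ ?_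
      · exact ((continuous_planeWave_right h).sub continuous_const |>.pow m).continuousAt
      · exact Complex.continuous_ofReal.continuousAt.comp
          ((continuousOn_levyDensity W.cont).continuousAt (isOpen_compl_singleton.mem_nhds hv0))
    have h2 := integral_planeWave_inversion (hwi h) (by
      simp_rw [hw h]
      exact (hFi h).ofReal.neg) h1
    simp_rw [hw h, hphase, neg_mul, integral_neg] at h2
    rw [← neg_eq_iff_eq_neg, h2]
    norm_num
    ring
  set DA : EuclideanSpace ℝ (Fin d) → ℂ :=
    fun k => (((fwdDiff h)^[m] (jumpFourier a) k : ℝ) : ℂ) * planeWave k (-v) with hDA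
  set DF : EuclideanSpace ℝ (Fin d) → ℂ :=
    fun k => (((fwdDiff h)^[m] (stableExponent α a₀) k : ℝ) : ℂ) * planeWave k (-v) with hDF
  have hDFi : Integrable DF := by
    refine (hFi h).ofReal.mul_bdd (c := 1) (continuous_planeWave_left _).aestronglyMeasurable
      (Filter.Eventually.of_forall fun y => (norm_planeWave _ _).le)
  have hDAi : IntegrableOn DA (piCube d) := by
    refine ContinuousOn.integrableOn_compact isCompact_piCube (Continuous.continuousOn ?_)
    refine Continuous.mul ?_ (continuous_planeWave_left _)
    have h1 := continuous_latticeFourier hs1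
    rw [← hs2] at h1
    exact (continuous_congr hcast).1 h1
  have e3 : ∫ k in piCube d, DA k = (∫ k in B, DA k) + ∫ k in piCube d \ B, DA k := by
    rw [← setIntegral_union Set.disjoint_sdiff_right (hQm.diff hBm) (hDAi.mono_set hBQ)
      (hDAi.mono_set Set.sdiff_subset), Set.union_sdiff_cancel hBQ]
  have e4 : ∫ k, DF k = (∫ k in B, DF k) + ∫ k in Bᶜ, DF k :=
    (integral_add_compl hBm hDFi).symm
  -- The two inversions carry opposite signs, so adding them yields a(x) - w(x). Near 0 the symbols
  -- are combined to cancel; away from 0 each is bounded separately, on the cube and on the whole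
  -- complement of the ball.
  have e5 : (2 * Real.pi) ^ d * (-2) ^ m * ((a x : ℂ) - (levyDensity α a₀ v : ℂ))
      = (∫ k in B, (DA k + DF k)) + (∫ k in piCube d \ B, DA k) + ∫ k in Bᶜ, DF k := by
    rw [integral_add (hDAi.mono_set hBQ) hDFi.integrableOn]
    have e6 := e1.symm.trans e3
    have e7 := e2.symm.trans e4
    linear_combination e6 + e7
  -- bounds on the three parts
  have hpow : ‖h‖ ^ m ≤ ‖h‖ ^ (d + α + σ) := by
    rw [← Real.rpow_natCast]
    exact Real.rpow_le_rpow_of_exponent_ge hh0 (hhr.trans (min_le_right _ _)) (by linarith)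
  set H := ‖h‖ ^ (d + α + σ) with hH
  have hH0 : 0 ≤ H := by positivity
  have b1 : ‖∫ k in B, (DA k + DF k)‖ ≤ C₁ * H * J₁ := by
    rw [hJ₁, ← integral_const_mul]
    refine norm_integral_le_of_norm_le (hI1.const_mul _) ?_
    have hae : ∀ᵐ k : EuclideanSpace ℝ (Fin d), k ≠ 0 := by
      have : Nonempty (Fin d) := ⟨⟨0, W.one_le⟩⟩
      exact (measure_eq_zero_iff_ae_notMem.1 (measure_singleton 0)).mono fun k hk => by simpa using hk
    filter_upwards [ae_restrict_mem hBm, ae_restrict_of_ae hae] with k hk hk0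
    rw [hDA, hDF]
    beta_reduce
    rw [← add_mul, norm_mul, norm_planeWave, mul_one, ← Complex.ofReal_add, Complex.norm_real]
    exact hnear k hk hk0 h (hhr.trans ((min_le_left _ _).trans (min_le_left _ _)))
  have b2 : ‖∫ k in piCube d \ B, DA k‖ ≤ C₂ * H * V := by
    have h1 : volume (piCube d \ B) < ⊤ :=
      (measure_mono Set.sdiff_subset).trans_lt isCompact_piCube.measure_lt_top
    refine (norm_setIntegral_le_of_norm_le_const h1 (C := C₂ * H) fun k hk => ?_).trans ?_
    · rw [hDA]
      beta_reduce
      rw [norm_mul, norm_planeWave, mul_one, Complex.norm_real]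
      refine (haway k hk h (hhr.trans ((min_le_left _ _).trans (min_le_right _ _)))).trans ?_
      gcongr
    · gcongr
      exact measureReal_mono Set.sdiff_subset hfinQ
  have b3 : ‖∫ k in Bᶜ, DF k‖ ≤ C₃ * H * J₂ := by
    rw [hJ₂, ← integral_const_mul]
    refine norm_integral_le_of_norm_le (hI2.const_mul _) ?_
    filter_upwards [ae_restrict_mem hBm.compl] with k hk
    have hk0 : k ≠ 0 := by
      rintro rfl
      exact hk (Metric.mem_ball_self hρ)
    rw [hDF]
    beta_reduce
    rw [norm_mul, norm_planeWave, mul_one, Complex.norm_real]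
    refine (hexp (α - m) (by linarith) le_rfl h k hk0).trans ?_
    rw [sub_sub_cancel, Real.rpow_natCast, mul_assoc]
    gcongr
  have hnorm := congrArg norm e5
  rw [norm_mul, norm_mul, norm_pow, norm_pow, ← Complex.ofReal_sub, Complex.norm_real,
    Real.norm_eq_abs] at hnorm
  have hc1 : (1 : ℝ) ≤ ‖(2 * Real.pi : ℂ)‖ ^ d * ‖(-2 : ℂ)‖ ^ m := by
    have h1 : (1 : ℝ) ≤ ‖(2 * Real.pi : ℂ)‖ := by
      rw [norm_mul, Complex.norm_real, Real.norm_eq_abs, abs_of_pos hpi]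
      norm_num
      linarith [Real.pi_gt_three]
    have h2 : (1 : ℝ) ≤ ‖(-2 : ℂ)‖ := by norm_num
    exact one_le_mul_of_one_le_of_one_le (one_le_pow₀ h1) (one_le_pow₀ h2)
  have hHX : H = Real.pi ^ (d + α + σ) * ‖v‖ ^ (-((d : ℝ) + α + σ)) := by
    rw [hH, hhn, Real.div_rpow hpi.le hX.le, Real.rpow_neg hX.le]
    rfl
  calc |a x - levyDensity α a₀ v|
      ≤ ‖(2 * Real.pi : ℂ)‖ ^ d * ‖(-2 : ℂ)‖ ^ m * |a x - levyDensity α a₀ v| :=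
        le_mul_of_one_le_left (abs_nonneg _) hc1
    _ ≤ C₁ * H * J₁ + C₂ * H * V + C₃ * H * J₂ := by
        rw [hnorm]
        exact (norm_add₃_le).trans (by gcongr)
    _ = _ := by rw [hHX]; ring

end IsStableWalk

end JumpAsymptotics

/-! ### Size of 1 - â -/

section SymbolBounds

variable {d : ℕ} {α : ℝ} {a : (Fin d → ℤ) → ℝ} {b : ℕ → EuclideanSpace ℝ (Fin d) → ℝ}
  {a₀ : EuclideanSpace ℝ (Fin d) → ℝ}

lemma jumpFourier_neg (a : (Fin d → ℤ) → ℝ) (k : EuclideanSpace ℝ (Fin d)) :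
    jumpFourier a (-k) = jumpFourier a k := by
  simp [jumpFourier, inner_neg_left]

lemma summable_cos_mul (ha : IsSymmetricJumpLaw a) (k : EuclideanSpace ℝ (Fin d)) :
    Summable fun z => Real.cos (inner ℝ k (latticeVec z)) * a z := by
  refine Summable.of_norm_bounded ha.hasSum_one.summable fun z => ?_
  rw [norm_mul, Real.norm_eq_abs, Real.norm_eq_abs, abs_of_nonneg (ha.nonneg z)]
  exact mul_le_of_le_one_left (ha.nonneg z) (Real.abs_cos_le_one _)

lemma hasSum_one_sub_jumpFourier (ha : IsSymmetricJumpLaw a) (k : EuclideanSpace ℝ (Fin d)) :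
    HasSum (fun z => (1 - Real.cos (inner ℝ k (latticeVec z))) * a z) (1 - jumpFourier a k) := by
  have := ha.hasSum_one.sub (summable_cos_mul ha k).hasSum
  simpa [sub_mul, jumpFourier] using this

lemma one_sub_jumpFourier_le_two (ha : IsSymmetricJumpLaw a) (k : EuclideanSpace ℝ (Fin d)) :
    1 - jumpFourier a k ≤ 2 := by
  have h := ha.hasSum_one.mul_left 2
  rw [mul_one] at h
  refine hasSum_le (fun z => ?_) (hasSum_one_sub_jumpFourier ha k) h
  have := Real.neg_one_le_cos (inner ℝ k (latticeVec z))
  have := ha.nonneg z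
  gcongr
  linarith

lemma continuous_jumpFourier (ha : IsSymmetricJumpLaw a) :
    Continuous (jumpFourier a : EuclideanSpace ℝ (Fin d) → ℝ) := by
  have hs : Summable fun z => (a z : ℂ) := Complex.summable_ofReal.2 ha.hasSum_one.summable
  have h := Complex.continuous_re.comp (continuous_latticeFourier hs)
  refine (continuous_congr fun k => ?_).1 h
  simp [latticeFourier_jumpLaw ha]

namespace IsStableWalk

lemma homTerm_le (W : IsStableWalk α a b a₀) {j : ℕ} (hj : j ≤ d) :
    ∃ C : ℝ, 0 ≤ C ∧ ∀ k : EuclideanSpace ℝ (Fin d), |homTerm α b j k| ≤ C * ‖k‖ ^ (α + j) := by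
  have hS : IsCompact (Metric.sphere (0 : EuclideanSpace ℝ (Fin d)) 1) := isCompact_sphere 0 1
  have hSU : Metric.sphere (0 : EuclideanSpace ℝ (Fin d)) 1 ⊆ {0}ᶜ := by
    intro x hx hx0
    simp_all
  obtain ⟨M, hM⟩ := hS.exists_bound_of_continuousOn
    ((W.expansion.smooth_coeff j hj).continuousOn.mono hSU)
  refine ⟨max M 0, le_max_right _ _, fun k => ?_⟩
  by_cases hk : k = 0
  · simp only [hk, homTerm_zero_right W.pos, abs_zero]
    positivity
  · rw [homTerm, abs_mul, abs_of_nonneg (show 0 ≤ ‖k‖ ^ (α + (j : ℝ)) by positivity)]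
    have h1 := hM _ (direction_mem_sphere hk)
    rw [direction_of_mem_sphere (direction_mem_sphere hk), Real.norm_eq_abs] at h1
    have := h1.trans (le_max_left M 0)
    gcongr

/-- A linear term of f would be too large for α ≥ 1. Since â and the exponent are even, the
expansions at k and -k may be averaged, and f(k)+f(-k) is a second difference of f because f(0) = 0,
hence O(‖k‖²). -/
lemma one_sub_jumpFourier_near (W : IsStableWalk α a b a₀) :
    ∃ ρ > 0, ∃ C : ℝ, 0 ≤ C ∧ ∀ k ∈ Metric.ball (0 : EuclideanSpace ℝ (Fin d)) ρ,
      |1 - jumpFourier a k - stableExponent α a₀ k| ≤ C * (‖k‖ ^ (α + 1) + ‖k‖ ^ 2) := by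
  have hα := W.pos
  obtain ⟨f, hf, hf0, hexp⟩ := W.expansion.expansion
  have hf2 : ContDiffAt ℝ ((2 : ℕ) : WithTop ℕ∞) f 0 := by
    refine hf.of_le ?_
    exact_mod_cast W.two_le_order
  have htop (n : ℕ) : ((n : ℕ) : WithTop ℕ∞) ≠ ((⊤ : ℕ∞) : WithTop ℕ∞) :=
    fun h => ENat.natCast_ne_top n (by exact_mod_cast h)
  obtain ⟨u, hu, hfu⟩ := hf2.contDiffOn le_rfl fun h => absurd h (htop 2)
  have hu' : interior u ∈ nhds (0 : EuclideanSpace ℝ (Fin d)) := interior_mem_nhds.2 (by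
    simpa using hu)
  obtain ⟨ρ₁, hρ₁, hball₁⟩ := Metric.eventually_nhds_iff_ball.1 hexp
  obtain ⟨r₂, hr₂, C₂, hC₂, hb₂⟩ := fwdDiff_iter_le_of_contDiffOn isOpen_interior 2
    (hfu.mono interior_subset) (mem_of_mem_nhds hu')
  have hg : ∀ j ∈ Finset.Icc 1 d, ∃ C : ℝ, 0 ≤ C ∧
      ∀ k : EuclideanSpace ℝ (Fin d), |homTerm α b j k| ≤ C * ‖k‖ ^ (α + j) :=
    fun j hj => W.homTerm_le (Finset.mem_Icc.1 hj).2
  choose! Cg hCg hbg using hg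
  have hCs : 0 ≤ ∑ j ∈ Finset.Icc 1 d, Cg j := Finset.sum_nonneg hCg
  refine ⟨min (min ρ₁ r₂) 1, by positivity, C₂ + ∑ j ∈ Finset.Icc 1 d, Cg j, by positivity,
    fun k hk => ?_⟩
  have hk' : ‖k‖ < min (min ρ₁ r₂) 1 := by simpa using hk
  have hk1 : ‖k‖ < ρ₁ := hk'.trans_le ((min_le_left _ _).trans (min_le_left _ _))
  have hk2 : ‖k‖ < r₂ := hk'.trans_le ((min_le_left _ _).trans (min_le_right _ _))
  have hk3 : ‖k‖ ≤ 1 := (hk'.trans_le (min_le_right _ _)).le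
  have h2 : Finset.range (d + 1) = insert 0 (Finset.Icc 1 d) := by
    ext j; simp; omega
  have key : ∀ κ : EuclideanSpace ℝ (Fin d), ‖κ‖ < ρ₁ →
      1 - jumpFourier a κ - stableExponent α a₀ κ
        = ∑ j ∈ Finset.Icc 1 d, homTerm α b j κ - f κ := by
    intro κ hκ
    have h3 := hball₁ κ (by simpa using hκ)
    change _ = 1 - ∑ j ∈ Finset.range (d + 1), homTerm α b j κ + f κ at h3
    rw [h3, h2, Finset.sum_insert (by simp), W.homTerm_zero]
    ring
  have hfd : (fwdDiff k)^[2] f (-k) = f k + f (-k) := by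
    simp only [Function.iterate_succ, Function.iterate_zero, Function.comp_apply, id, fwdDiff,
      neg_add_cancel, zero_add, hf0]
    ring
  have hf1 : |f k + f (-k)| ≤ C₂ * ‖k‖ ^ 2 := by
    rw [← hfd]
    exact hb₂ (-k) (by simpa using hk2) k hk2.le
  have hgb : ∀ κ : EuclideanSpace ℝ (Fin d), ‖κ‖ = ‖k‖ →
      |∑ j ∈ Finset.Icc 1 d, homTerm α b j κ| ≤ (∑ j ∈ Finset.Icc 1 d, Cg j) * ‖k‖ ^ (α + 1) := by
    intro κ hκ
    rw [Finset.sum_mul]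
    refine (Finset.abs_sum_le_sum_abs _ _).trans (Finset.sum_le_sum fun j hj => ?_)
    refine (hbg j hj κ).trans ?_
    have := hCg j hj
    have hj1 : (1 : ℝ) ≤ j := by exact_mod_cast (Finset.mem_Icc.1 hj).1
    rw [hκ]
    have h3 : ‖k‖ ^ (α + (j : ℝ)) ≤ ‖k‖ ^ (α + 1) := by
      rcases eq_or_ne k 0 with rfl | hk0
      · rw [norm_zero, Real.zero_rpow (by positivity), Real.zero_rpow (by positivity)]
      · exact Real.rpow_le_rpow_of_exponent_ge (norm_pos_iff.2 hk0) hk3 (by linarith)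
    gcongr
  have k1 := key k hk1
  have k2 := key (-k) (by simpa using hk1)
  rw [jumpFourier_neg, stableExponent_neg] at k2
  have g1 := abs_le.1 (hgb k rfl)
  have g2 := abs_le.1 (hgb (-k) (norm_neg k))
  have f1 := abs_le.1 hf1
  have hp1 : 0 ≤ ‖k‖ ^ (α + 1) := by positivity
  have hp2 : 0 ≤ ‖k‖ ^ 2 := by positivity
  have e1 := mul_nonneg hC₂ hp1
  have e2 := mul_nonneg hC₂ hp2
  have e3 := mul_nonneg hCs hp2
  have e4 := mul_nonneg hCs hp1
  rw [abs_le]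
  constructor <;> nlinarith

/-- Both α+1 and 2 exceed α; this is where α < 2 is needed for the symbol. -/
lemma one_sub_jumpFourier_littleO (W : IsStableWalk α a b a₀) {ε : ℝ} (hε : 0 < ε) :
    ∃ ρ > 0, ∀ k ∈ Metric.ball (0 : EuclideanSpace ℝ (Fin d)) ρ,
      |1 - jumpFourier a k - stableExponent α a₀ k| ≤ ε * ‖k‖ ^ α := by
  have hα := W.pos
  have hα2 := W.lt_two
  obtain ⟨ρ, hρ, C, hC, hb⟩ := W.one_sub_jumpFourier_near
  have hlim : Filter.Tendsto (fun k : EuclideanSpace ℝ (Fin d) => C * (‖k‖ + ‖k‖ ^ (2 - α)))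
      (nhds 0) (nhds 0) := by
    have h1 : ContinuousAt (fun k : EuclideanSpace ℝ (Fin d) => C * (‖k‖ + ‖k‖ ^ (2 - α))) 0 :=
      (continuous_const.mul (continuous_norm.add
        (continuous_norm.rpow_const fun _ => Or.inr (by linarith)))).continuousAt
    have h2 : (2 - α) ≠ 0 := by linarith
    simpa [ContinuousAt, Real.zero_rpow h2] using h1
  obtain ⟨ρ', hρ', hb'⟩ := Metric.eventually_nhds_iff_ball.1 (hlim.eventually (gt_mem_nhds hε))
  refine ⟨min ρ ρ', lt_min hρ hρ', fun k hk => ?_⟩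
  have h1 := hb k (Metric.ball_subset_ball (min_le_left _ _) hk)
  have h2 := hb' k (Metric.ball_subset_ball (min_le_right _ _) hk)
  rcases eq_or_ne k 0 with rfl | hk0
  · refine h1.trans (le_of_eq ?_)
    rw [norm_zero, Real.zero_rpow hα.ne', Real.zero_rpow (by positivity)]
    ring
  · have hkp := norm_pos_iff.2 hk0
    refine h1.trans ?_
    have h3 : ‖k‖ ^ (α + 1) + ‖k‖ ^ 2 = (‖k‖ + ‖k‖ ^ (2 - α)) * ‖k‖ ^ α := by
      rw [add_mul, ← Real.rpow_add hkp, Real.rpow_add_one hkp.ne', ← Real.rpow_two,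
        sub_add_cancel, mul_comm]
    rw [h3, ← mul_assoc]
    gcongr

/-- Near 0 the exponent dominates the error; on the rest of the cube compactness and â < 1 give a
positive lower bound. -/
lemma one_sub_jumpFourier_ge (W : IsStableWalk α a b a₀) :
    ∃ c > 0, ∀ k ∈ piCube d, c * ‖k‖ ^ α ≤ 1 - jumpFourier a k := by
  obtain ⟨c, C, hc, hC, hcC⟩ := W.exponent_bounds
  obtain ⟨ρ, hρ, hb⟩ := W.one_sub_jumpFourier_littleO (half_pos hc)
  have hK : IsCompact (piCube d \ Metric.ball 0 ρ) := isCompact_piCube.diff Metric.isOpen_ball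
  have hposK : ∀ k ∈ piCube d \ Metric.ball 0 ρ, 0 < 1 - jumpFourier a k := by
    rintro k ⟨hk, hkρ⟩
    refine sub_pos.2 (W.lt_one k hk ?_)
    rintro rfl
    exact hkρ (Metric.mem_ball_self hρ)
  have hcont : ContinuousOn (fun k : EuclideanSpace ℝ (Fin d) => ‖k‖ ^ α / (1 - jumpFourier a k))
      (piCube d \ Metric.ball 0 ρ) := by
    refine ContinuousOn.div ?_ ?_ fun k hk => (hposK k hk).ne'
    · exact (continuous_norm.rpow_const fun _ => Or.inr W.pos.le).continuousOn
    · exact (continuous_const.sub (continuous_jumpFourier W.jumpLaw)).continuousOn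
  obtain ⟨M, hM⟩ := hK.exists_bound_of_continuousOn hcont
  have hM1 : 0 < max M 1 := lt_max_of_lt_right one_pos
  refine ⟨min (c / 2) (max M 1)⁻¹, by positivity, fun k hk => ?_⟩
  by_cases hkρ : k ∈ Metric.ball 0 ρ
  · have h1 := (abs_le.1 (hb k hkρ)).1
    have h2 := (hcC k).1
    calc min (c / 2) (max M 1)⁻¹ * ‖k‖ ^ α ≤ c / 2 * ‖k‖ ^ α := by
          gcongr; exact min_le_left _ _
      _ ≤ _ := by linarith
  · have h1 := hM k ⟨hk, hkρ⟩
    have h2 := hposK k ⟨hk, hkρ⟩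
    rw [Real.norm_eq_abs, abs_of_nonneg (by positivity), div_le_iff₀ h2] at h1
    have h3 : ‖k‖ ^ α ≤ max M 1 * (1 - jumpFourier a k) :=
      h1.trans (by gcongr; exact le_max_left _ _)
    calc min (c / 2) (max M 1)⁻¹ * ‖k‖ ^ α ≤ (max M 1)⁻¹ * ‖k‖ ^ α := by
          gcongr; exact min_le_right _ _
      _ ≤ (max M 1)⁻¹ * (max M 1 * (1 - jumpFourier a k)) := by gcongr
      _ = _ := by rw [inv_mul_cancel_left₀ hM1.ne']

lemma one_sub_jumpFourier_le (W : IsStableWalk α a b a₀) :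
    ∃ C > 0, ∀ k : EuclideanSpace ℝ (Fin d), 1 - jumpFourier a k ≤ C * ‖k‖ ^ α := by
  obtain ⟨c, C, hc, hC, hcC⟩ := W.exponent_bounds
  obtain ⟨ρ, hρ, hb⟩ := W.one_sub_jumpFourier_littleO one_pos
  have hα := W.pos
  refine ⟨C + 1 + 2 * ρ ^ (-α), by positivity, fun k => ?_⟩
  have hk0 : 0 ≤ ‖k‖ ^ α := by positivity
  by_cases hkρ : k ∈ Metric.ball 0 ρ
  · have h1 := (abs_le.1 (hb k hkρ)).2
    have h2 := (hcC k).2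
    have h3 : 0 ≤ 2 * ρ ^ (-α) * ‖k‖ ^ α := by positivity
    linarith
  · have h1 := one_sub_jumpFourier_le_two W.jumpLaw k
    have h2 : ρ ≤ ‖k‖ := by simpa using hkρ
    have h3 : ρ ^ α ≤ ‖k‖ ^ α := by gcongr
    have h4 : 1 ≤ ρ ^ (-α) * ‖k‖ ^ α := by
      rw [Real.rpow_neg hρ.le, inv_mul_eq_div, le_div_iff₀ (by positivity), one_mul]
      exact h3
    have h5 : 0 ≤ (C + 1) * ‖k‖ ^ α := by positivity
    linarith

end IsStableWalk

end SymbolBounds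

/-! ### The stable kernel as a Fourier integral -/

section Kernel

variable {d : ℕ} {α : ℝ} {a : (Fin d → ℤ) → ℝ} {b : ℕ → EuclideanSpace ℝ (Fin d) → ℝ}
  {a₀ : EuclideanSpace ℝ (Fin d) → ℝ}

lemma integrable_exp_neg_mul_norm_rpow (hd : 1 ≤ d) (hα₀ : 0 < α) {c : ℝ} (hc : 0 < c) :
    Integrable fun k : EuclideanSpace ℝ (Fin d) => Real.exp (-(c * ‖k‖ ^ α)) := by
  have : Nonempty (Fin d) := ⟨⟨0, hd⟩⟩
  rw [integrable_fun_norm_addHaar volume (f := fun r => Real.exp (-(c * r ^ α)))]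
  simp only [finrank_euclideanSpace, Fintype.card_fin, smul_eq_mul]
  have h2 : IntegrableOn (fun x : ℝ => x ^ ((d : ℝ) - 1) * Real.exp (-c * x ^ α)) (Set.Ioi 0) :=
    integrableOn_rpow_mul_exp_neg_mul_rpow (by
      have : (1 : ℝ) ≤ d := by exact_mod_cast hd
      linarith) hα₀ hc
  refine h2.congr_fun (fun r hr => ?_) measurableSet_Ioi
  beta_reduce
  rw [← Real.rpow_natCast, Nat.cast_sub hd, Nat.cast_one, neg_mul]

lemma integral_comp_smul_pos (g : EuclideanSpace ℝ (Fin d) → ℂ) {s : ℝ} (hs : 0 < s) :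
    ∫ k, g k = (s ^ d : ℝ) * ∫ k, g (s • k) := by
  rw [Measure.integral_comp_smul]
  simp only [finrank_euclideanSpace, Fintype.card_fin]
  rw [abs_of_pos (by positivity), Complex.real_smul, ← mul_assoc, ← Complex.ofReal_mul,
    mul_inv_cancel₀ (by positivity), Complex.ofReal_one, one_mul]

/-- The Fourier integral of `e^{-τ b₀(k/|k|)|k|^α}`. -/
noncomputable def stableKernel (α : ℝ) (a₀ : EuclideanSpace ℝ (Fin d) → ℝ) (τ : ℝ)
    (y : EuclideanSpace ℝ (Fin d)) : ℂ :=
  ∫ k, (Real.exp (-(τ * stableExponent α a₀ k)) : ℂ) * planeWave k (-y)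

namespace IsStableWalk

lemma integrable_exp_neg_exponent (W : IsStableWalk α a b a₀) {τ : ℝ} (hτ : 0 < τ) :
    Integrable fun k : EuclideanSpace ℝ (Fin d) => Real.exp (-(τ * stableExponent α a₀ k)) := by
  obtain ⟨c, C, hc, hC, hcC⟩ := W.exponent_bounds
  refine (integrable_exp_neg_mul_norm_rpow W.one_le W.pos (mul_pos hτ hc)).mono' ?_ ?_
  · have := W.continuous_stableExponent
    exact (by fun_prop : Continuous fun k : EuclideanSpace ℝ (Fin d) =>
      Real.exp (-(τ * stableExponent α a₀ k))).aestronglyMeasurable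
  · refine Filter.Eventually.of_forall fun k => ?_
    rw [Real.norm_of_nonneg (Real.exp_pos _).le, mul_assoc]
    have := (hcC k).1
    gcongr

/-- The exponent is even, so k ↦ -k conjugates the integrand; hence S is real. -/
lemma stableKernel_conj (y : EuclideanSpace ℝ (Fin d)) (τ : ℝ) :
    starRingEnd ℂ (stableKernel α a₀ τ y) = stableKernel α a₀ τ y := by
  have h1 := integral_neg_eq_self
    (fun k => (Real.exp (-(τ * stableExponent α a₀ k)) : ℂ) * planeWave k (-y)) volume
  rw [stableKernel, ← integral_conj]
  refine Eq.trans ?_ h1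
  refine integral_congr_ae (Filter.Eventually.of_forall fun k => ?_)
  simp only [map_mul, Complex.conj_ofReal, stableExponent_neg, planeWave_neg_left]
  rw [planeWave_neg_right k (-y)]

lemma stableKernel_neg (y : EuclideanSpace ℝ (Fin d)) (τ : ℝ) :
    stableKernel α a₀ τ (-y) = stableKernel α a₀ τ y := by
  have h1 := integral_neg_eq_self
    (fun k => (Real.exp (-(τ * stableExponent α a₀ k)) : ℂ) * planeWave k (-y)) volume
  rw [stableKernel, stableKernel, ← h1]
  refine integral_congr_ae (Filter.Eventually.of_forall fun k => ?_)
  simp only [stableExponent_neg, planeWave_neg_left, neg_neg]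

lemma continuous_stableKernel (W : IsStableWalk α a b a₀) {τ : ℝ} (hτ : 0 < τ) :
    Continuous (stableKernel α a₀ τ) := by
  refine continuous_of_dominated (F := fun y k =>
    (Real.exp (-(τ * stableExponent α a₀ k)) : ℂ) * planeWave k (-y))
    (bound := fun k => Real.exp (-(τ * stableExponent α a₀ k))) ?_ ?_
    (W.integrable_exp_neg_exponent hτ) ?_
  · intro y
    have := W.continuous_stableExponent
    have := continuous_planeWave_left (-y)
    exact (by fun_prop : Continuous fun k : EuclideanSpace ℝ (Fin d) =>
      (Real.exp (-(τ * stableExponent α a₀ k)) : ℂ) * planeWave k (-y)).aestronglyMeasurable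
  · intro y
    refine Filter.Eventually.of_forall fun k => ?_
    rw [norm_mul, norm_planeWave, mul_one, Complex.norm_real,
      Real.norm_of_nonneg (Real.exp_pos _).le]
  · refine Filter.Eventually.of_forall fun k => ?_
    exact continuous_const.mul ((continuous_planeWave_right k).comp continuous_neg)

lemma stableKernel_scaling (W : IsStableWalk α a b a₀) {τ : ℝ} (hτ : 0 < τ)
    (y : EuclideanSpace ℝ (Fin d)) :
    stableKernel α a₀ τ y
      = ((τ ^ (-(1 / α))) ^ d : ℝ) * stableKernel α a₀ 1 (τ ^ (-(1 / α)) • y) := by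
  have hs : 0 < τ ^ (-(1 / α)) := Real.rpow_pos_of_pos hτ _
  have hα := W.pos
  rw [stableKernel, integral_comp_smul_pos _ hs]
  congr 1
  refine integral_congr_ae (Filter.Eventually.of_forall fun k => ?_)
  beta_reduce
  rw [stableExponent_smul hs, planeWave_smul_left, smul_neg, ← mul_assoc, ← Real.rpow_mul hτ.le]
  have : -(1 / α) * α = -1 := by field_simp
  rw [this, Real.rpow_neg_one, mul_inv_cancel₀ hτ.ne']

lemma stableFourierIntegral_eq (W : IsStableWalk α a b a₀) (y : EuclideanSpace ℝ (Fin d)) :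
    stableFourierIntegral α (b 0) y = (1 / (2 * (Real.pi : ℂ)) ^ d) * stableKernel α a₀ 1 y := by
  rw [← stableKernel_neg, stableFourierIntegral, stableKernel]
  congr 1
  refine integral_congr_ae (Filter.Eventually.of_forall fun k => ?_)
  beta_reduce
  rw [W.exponent_eq, one_mul, neg_neg, planeWave, Complex.ofReal_exp, ← Complex.exp_add]
  congr 1
  push_cast; ring

lemma stableDensity_ofReal (W : IsStableWalk α a b a₀) (y : EuclideanSpace ℝ (Fin d)) :
    stableFourierIntegral α (b 0) y = (stableDensity α (b 0) y : ℂ) := by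
  rw [stableDensity, eq_comm, ← Complex.conj_eq_iff_re, W.stableFourierIntegral_eq, map_mul,
    stableKernel_conj]
  simp [Complex.conj_ofNat]

lemma stableKernel_one_eq (W : IsStableWalk α a b a₀) (y : EuclideanSpace ℝ (Fin d)) :
    stableKernel α a₀ 1 y = (2 * Real.pi) ^ d * (stableDensity α (b 0) y : ℂ) := by
  have hp : ((2 * Real.pi) ^ d : ℂ) ≠ 0 :=
    pow_ne_zero _ (mul_ne_zero two_ne_zero (by exact_mod_cast Real.pi_ne_zero))
  rw [← W.stableDensity_ofReal, W.stableFourierIntegral_eq, one_div, mul_inv_cancel_left₀ hp]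

lemma continuous_stableDensity (W : IsStableWalk α a b a₀) :
    Continuous (stableDensity α (b 0)) := by
  have h : Continuous fun y => (1 / (2 * (Real.pi : ℂ)) ^ d) * stableKernel α a₀ 1 y :=
    continuous_const.mul (W.continuous_stableKernel one_pos)
  refine (continuous_congr fun y => ?_).1 (Complex.continuous_re.comp h)
  simp only [Function.comp_apply, stableDensity, W.stableFourierIntegral_eq]

end IsStableWalk

end Kernel

/-! ### Local limit theorem -/

section LocalLimit

variable {d : ℕ} {α : ℝ} {a : (Fin d → ℤ) → ℝ} {b : ℕ → EuclideanSpace ℝ (Fin d) → ℝ}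
  {a₀ : EuclideanSpace ℝ (Fin d) → ℝ}

lemma transitionProb_nonneg (ha : ∀ z, 0 ≤ a z) {t : ℝ} (ht : 0 ≤ t) (x : Fin d → ℤ) :
    0 ≤ transitionProb a t x := by
  rw [transitionProb_eq]
  exact mul_nonneg (Real.exp_pos _).le (convExp_nonneg (fun z => mul_nonneg ht (ha z)) x)

/-- The characteristic function of the walk at time `t`, in the stable scaling and cut off to the
fundamental cube. -/
noncomputable def scaledSymbol (α : ℝ) (a : (Fin d → ℤ) → ℝ) (t : ℝ) :
    EuclideanSpace ℝ (Fin d) → ℝ :=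
  {κ | t ^ (-(1 / α)) • κ ∈ piCube d}.indicator
    fun κ => Real.exp (-(t * (1 - jumpFourier a (t ^ (-(1 / α)) • κ))))

namespace IsStableWalk

lemma measurable_scaledSymbol (W : IsStableWalk α a b a₀) (t : ℝ) :
    Measurable (scaledSymbol α a t : EuclideanSpace ℝ (Fin d) → ℝ) := by
  refine Measurable.indicator ?_ (measurableSet_piCube.preimage (by fun_prop))
  have := continuous_jumpFourier W.jumpLaw
  exact (by fun_prop : Continuous fun κ : EuclideanSpace ℝ (Fin d) =>
    Real.exp (-(t * (1 - jumpFourier a (t ^ (-(1 / α)) • κ))))).measurable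

lemma rpow_scaling (W : IsStableWalk α a b a₀) {t : ℝ} (ht : 0 < t)
    (κ : EuclideanSpace ℝ (Fin d)) : t * ‖t ^ (-(1 / α)) • κ‖ ^ α = ‖κ‖ ^ α := by
  have hs : 0 < t ^ (-(1 / α)) := Real.rpow_pos_of_pos ht _
  have hα := W.pos
  rw [norm_smul, Real.norm_of_nonneg hs.le, Real.mul_rpow hs.le (norm_nonneg _),
    ← Real.rpow_mul ht.le, show -(1 / α) * α = -1 by field_simp, Real.rpow_neg_one,
    mul_inv_cancel_left₀ ht.ne']

/-- The lower bound c‖k‖^α for 1-â is invariant under the stable scaling, so one integrable function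
dominates for all t at once. -/
lemma scaledSymbol_bound (W : IsStableWalk α a b a₀) :
    ∃ c > 0, ∀ t : ℝ, 0 < t → ∀ κ : EuclideanSpace ℝ (Fin d),
      0 ≤ scaledSymbol α a t κ ∧ scaledSymbol α a t κ ≤ Real.exp (-(c * ‖κ‖ ^ α)) := by
  obtain ⟨c, hc, hb⟩ := W.one_sub_jumpFourier_ge
  refine ⟨c, hc, fun t ht κ => ?_⟩
  by_cases hκ : t ^ (-(1 / α)) • κ ∈ piCube d
  · have h1 := hb _ hκ
    rw [scaledSymbol, Set.indicator_of_mem (show κ ∈ {κ | t ^ (-(1 / α)) • κ ∈ piCube d} from hκ)]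
    refine ⟨(Real.exp_pos _).le, Real.exp_le_exp.2 (neg_le_neg ?_)⟩
    calc c * ‖κ‖ ^ α = t * (c * ‖t ^ (-(1 / α)) • κ‖ ^ α) := by
          rw [← W.rpow_scaling ht κ]; ring
      _ ≤ _ := by gcongr
  · rw [scaledSymbol,
      Set.indicator_of_notMem (show κ ∉ {κ | t ^ (-(1 / α)) • κ ∈ piCube d} from hκ)]
    exact ⟨le_rfl, (Real.exp_pos _).le⟩

lemma rpow_neg_inv_pow (W : IsStableWalk α a b a₀) {t : ℝ} (ht : 0 < t) :
    (t ^ (-(1 / α))) ^ d = (t ^ ((d : ℝ) / α))⁻¹ := by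
  have hα := W.pos
  rw [← Real.rpow_natCast, ← Real.rpow_mul ht.le, ← Real.rpow_neg ht.le]
  congr 1
  ring

lemma transitionProb_eq_scaled (W : IsStableWalk α a b a₀) {t : ℝ} (ht : 0 < t) (x : Fin d → ℤ) :
    (2 * Real.pi) ^ d * ((t ^ ((d : ℝ) / α) * transitionProb a t x : ℝ) : ℂ)
      = ∫ κ, (scaledSymbol α a t κ : ℂ) * planeWave κ (-(t ^ (-(1 / α)) • latticeVec x)) := by
  have hs : 0 < t ^ (-(1 / α)) := Real.rpow_pos_of_pos ht _
  have htd : 0 < t ^ ((d : ℝ) / α) := Real.rpow_pos_of_pos ht _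
  have h1 := integral_transitionProb W.jumpLaw t x
  rw [← integral_indicator measurableSet_piCube, integral_comp_smul_pos _ hs] at h1
  have h2 : ∀ κ : EuclideanSpace ℝ (Fin d), (piCube d).indicator (fun k =>
      (Real.exp (-(t * (1 - jumpFourier a k))) : ℂ) * latticeChar k (-x)) (t ^ (-(1 / α)) • κ)
      = (scaledSymbol α a t κ : ℂ) * planeWave κ (-(t ^ (-(1 / α)) • latticeVec x)) := by
    intro κ
    by_cases hκ : t ^ (-(1 / α)) • κ ∈ piCube d
    · rw [scaledSymbol, Set.indicator_of_mem hκ,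
        Set.indicator_of_mem (show κ ∈ {κ | t ^ (-(1 / α)) • κ ∈ piCube d} from hκ),
        latticeChar_eq_planeWave, planeWave_smul_left, latticeVec_neg, smul_neg]
    · rw [scaledSymbol, Set.indicator_of_notMem hκ,
        Set.indicator_of_notMem (show κ ∉ {κ | t ^ (-(1 / α)) • κ ∈ piCube d} from hκ)]
      simp
  simp_rw [h2] at h1
  rw [Complex.ofReal_mul, mul_left_comm, ← h1, W.rpow_neg_inv_pow ht, ← mul_assoc,
    ← Complex.ofReal_mul, mul_inv_cancel₀ htd.ne', Complex.ofReal_one, one_mul]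

/-- The on-diagonal upper bound. -/
lemma transitionProb_le (W : IsStableWalk α a b a₀) :
    ∃ C > 0, ∀ t : ℝ, 0 < t → ∀ x : Fin d → ℤ,
      t ^ ((d : ℝ) / α) * transitionProb a t x ≤ C := by
  obtain ⟨c, hc, hb⟩ := W.scaledSymbol_bound
  have hi := integrable_exp_neg_mul_norm_rpow W.one_le W.pos hc
  refine ⟨(∫ κ : EuclideanSpace ℝ (Fin d), Real.exp (-(c * ‖κ‖ ^ α))) + 1,
    add_pos_of_nonneg_of_pos (integral_nonneg fun _ => (Real.exp_pos _).le) one_pos,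
    fun t ht x => ?_⟩
  have h0 : 0 ≤ t ^ ((d : ℝ) / α) * transitionProb a t x :=
    mul_nonneg (by positivity) (transitionProb_nonneg W.jumpLaw.nonneg ht.le x)
  have h1 := congrArg norm (W.transitionProb_eq_scaled ht x)
  rw [norm_mul, Complex.norm_real, Real.norm_of_nonneg h0, norm_pow] at h1
  have h2 : ‖∫ κ, (scaledSymbol α a t κ : ℂ) * planeWave κ (-(t ^ (-(1 / α)) • latticeVec x))‖
      ≤ ∫ κ : EuclideanSpace ℝ (Fin d), Real.exp (-(c * ‖κ‖ ^ α)) := by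
    refine norm_integral_le_of_norm_le hi (Filter.Eventually.of_forall fun κ => ?_)
    rw [norm_mul, norm_planeWave, mul_one, Complex.norm_real,
      Real.norm_of_nonneg (hb t ht κ).1]
    exact (hb t ht κ).2
  have h3 : (1 : ℝ) ≤ ‖(2 * Real.pi : ℂ)‖ ^ d := by
    refine one_le_pow₀ ?_
    rw [norm_mul, Complex.norm_real, Real.norm_of_nonneg Real.pi_pos.le]
    norm_num
    linarith [Real.pi_gt_three]
  calc t ^ ((d : ℝ) / α) * transitionProb a t x
      ≤ ‖(2 * Real.pi : ℂ)‖ ^ d * (t ^ ((d : ℝ) / α) * transitionProb a t x) :=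
        le_mul_of_one_le_left h0 h3
    _ ≤ _ := by rw [h1]; linarith

lemma tendsto_scaledSymbol (W : IsStableWalk α a b a₀) (κ : EuclideanSpace ℝ (Fin d)) :
    Filter.Tendsto (fun t => scaledSymbol α a t κ) Filter.atTop
      (nhds (Real.exp (-stableExponent α a₀ κ))) := by
  have hα := W.pos
  have hlim : Filter.Tendsto (fun t : ℝ => t ^ (-(1 / α)) • κ) Filter.atTop (nhds 0) := by
    have := (tendsto_rpow_neg_atTop (show 0 < 1 / α by positivity)).smul_const κ
    rwa [zero_smul] at this
  have hlog : Filter.Tendsto (fun t => t * (1 - jumpFourier a (t ^ (-(1 / α)) • κ))) Filter.atTop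
      (nhds (stableExponent α a₀ κ)) := by
    rw [Metric.tendsto_nhds]
    intro ε hε
    have hK : 0 < ‖κ‖ ^ α + 1 := by positivity
    obtain ⟨ρ, hρ, hb⟩ := W.one_sub_jumpFourier_littleO (div_pos hε hK)
    filter_upwards [hlim.eventually (Metric.ball_mem_nhds 0 hρ), Filter.eventually_gt_atTop 0]
      with t ht ht0
    have hs : 0 < t ^ (-(1 / α)) := Real.rpow_pos_of_pos ht0 _
    have h1 := hb _ ht
    have h2 : t * stableExponent α a₀ (t ^ (-(1 / α)) • κ) = stableExponent α a₀ κ := by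
      rw [stableExponent_smul hs, ← Real.rpow_mul ht0.le, show -(1 / α) * α = -1 by field_simp,
        Real.rpow_neg_one, mul_inv_cancel_left₀ ht0.ne']
    rw [Real.dist_eq, ← h2, ← mul_sub, abs_mul, abs_of_pos ht0]
    calc t * |1 - jumpFourier a (t ^ (-(1 / α)) • κ) - stableExponent α a₀ (t ^ (-(1 / α)) • κ)|
        ≤ t * (ε / (‖κ‖ ^ α + 1) * ‖t ^ (-(1 / α)) • κ‖ ^ α) := by gcongr
      _ = ε / (‖κ‖ ^ α + 1) * ‖κ‖ ^ α := by rw [← W.rpow_scaling ht0 κ]; ring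
      _ < ε := by
        rw [div_mul_eq_mul_div, div_lt_iff₀ hK]
        nlinarith
  have h3 := (Real.continuous_exp.tendsto _).comp hlog.neg
  refine h3.congr' ?_
  have hQ : piCube d ∈ nhds (0 : EuclideanSpace ℝ (Fin d)) := by
    filter_upwards [Metric.ball_mem_nhds (0 : EuclideanSpace ℝ (Fin d)) one_pos] with k hk i
    have h1 : ‖k‖ < 1 := by simpa using hk
    have h2 : |k i| ≤ ‖k‖ := by simpa using PiLp.norm_apply_le k i
    linarith [Real.pi_gt_three]
  filter_upwards [hlim.eventually hQ] with t ht
  rw [scaledSymbol, Set.indicator_of_mem (show κ ∈ {κ | t ^ (-(1 / α)) • κ ∈ piCube d} from ht)]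
  rfl

/-- The local limit theorem, uniformly over the lattice. -/
lemma local_limit (W : IsStableWalk α a b a₀) {ε : ℝ} (hε : 0 < ε) :
    ∃ T > 0, ∀ t : ℝ, T ≤ t → ∀ x : Fin d → ℤ,
      |t ^ ((d : ℝ) / α) * transitionProb a t x
        - stableDensity α (b 0) ((t ^ (1 / α))⁻¹ • latticeVec x)| ≤ ε := by
  obtain ⟨c, hc, hb⟩ := W.scaledSymbol_bound
  have hi := integrable_exp_neg_mul_norm_rpow W.one_le W.pos hc
  have hiF := W.integrable_exp_neg_exponent one_pos
  simp_rw [one_mul] at hiF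
  -- Plane waves have modulus one, so L¹ convergence of the symbols bounds the error simultaneously
  -- for all x.
  have hlim : Filter.Tendsto (fun t => ∫ κ : EuclideanSpace ℝ (Fin d),
      |scaledSymbol α a t κ - Real.exp (-stableExponent α a₀ κ)|) Filter.atTop (nhds 0) := by
    have h0 : (0 : ℝ) = ∫ κ : EuclideanSpace ℝ (Fin d), (0 : ℝ) := by simp
    rw [h0]
    refine tendsto_integral_filter_of_dominated_convergence
      (fun κ => Real.exp (-(c * ‖κ‖ ^ α)) + Real.exp (-stableExponent α a₀ κ)) ?_ ?_
      (hi.add hiF) ?_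
    · refine Filter.Eventually.of_forall fun t => ?_
      have h1 := (W.measurable_scaledSymbol t).aestronglyMeasurable (μ := volume)
      exact (h1.sub hiF.1).norm
    · filter_upwards [Filter.eventually_gt_atTop 0] with t ht
      refine Filter.Eventually.of_forall fun κ => ?_
      rw [Real.norm_eq_abs, abs_abs]
      refine (abs_sub _ _).trans ?_
      rw [abs_of_nonneg (hb t ht κ).1, abs_of_pos (Real.exp_pos _)]
      have := (hb t ht κ).2
      gcongr
    · refine Filter.Eventually.of_forall fun κ => ?_
      have := ((W.tendsto_scaledSymbol κ).sub_const (Real.exp (-stableExponent α a₀ κ))).abs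
      simpa using this
  obtain ⟨T, hT⟩ := Filter.eventually_atTop.1 (hlim.eventually (ge_mem_nhds hε))
  refine ⟨max T 1, lt_max_of_lt_right one_pos, fun t ht x => ?_⟩
  have ht0 : 0 < t := lt_of_lt_of_le one_pos ((le_max_right _ _).trans ht)
  have h1 := hT t ((le_max_left _ _).trans ht)
  set y := t ^ (-(1 / α)) • latticeVec x with hy
  have hy' : (t ^ (1 / α))⁻¹ • latticeVec x = y := by rw [hy, Real.rpow_neg ht0.le]
  have h2 := W.transitionProb_eq_scaled ht0 x
  have h3 := W.stableKernel_one_eq y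
  rw [stableKernel] at h3
  simp_rw [one_mul] at h3
  have hpwm : ∀ {g : EuclideanSpace ℝ (Fin d) → ℝ}, Integrable g →
      Integrable fun κ => (g κ : ℂ) * planeWave κ (-y) := fun hg =>
    hg.ofReal.mul_bdd (c := 1) (continuous_planeWave_left _).aestronglyMeasurable
      (Filter.Eventually.of_forall fun k => (norm_planeWave _ _).le)
  have hsi : Integrable (scaledSymbol α a t : EuclideanSpace ℝ (Fin d) → ℝ) := by
    refine hi.mono' (W.measurable_scaledSymbol t).aestronglyMeasurable
      (Filter.Eventually.of_forall fun κ => ?_)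
    rw [Real.norm_of_nonneg (hb t ht0 κ).1]
    exact (hb t ht0 κ).2
  have h4 : (2 * Real.pi : ℂ) ^ d * ((t ^ ((d : ℝ) / α) * transitionProb a t x
      - stableDensity α (b 0) y : ℝ) : ℂ)
      = ∫ κ, ((scaledSymbol α a t κ - Real.exp (-stableExponent α a₀ κ) : ℝ) : ℂ)
        * planeWave κ (-y) := by
    rw [Complex.ofReal_sub, mul_sub, h2, ← h3, ← integral_sub (hpwm hsi) (hpwm hiF)]
    refine integral_congr_ae (Filter.Eventually.of_forall fun κ => ?_)
    beta_reduce
    push_cast; ring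
  have h5 := congrArg norm h4
  rw [norm_mul, norm_pow, Complex.norm_real, Real.norm_eq_abs] at h5
  have h6 : ‖∫ κ, ((scaledSymbol α a t κ - Real.exp (-stableExponent α a₀ κ) : ℝ) : ℂ)
        * planeWave κ (-y)‖ ≤ ∫ κ : EuclideanSpace ℝ (Fin d),
      |scaledSymbol α a t κ - Real.exp (-stableExponent α a₀ κ)| := by
    refine norm_integral_le_of_norm_le (hsi.sub hiF).abs (Filter.Eventually.of_forall fun κ => ?_)
    rw [norm_mul, norm_planeWave, mul_one, Complex.norm_real, Real.norm_eq_abs]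
  have h7 : (1 : ℝ) ≤ ‖(2 * Real.pi : ℂ)‖ ^ d := by
    refine one_le_pow₀ ?_
    rw [norm_mul, Complex.norm_real, Real.norm_of_nonneg Real.pi_pos.le]
    norm_num
    linarith [Real.pi_gt_three]
  rw [hy']
  calc |t ^ ((d : ℝ) / α) * transitionProb a t x - stableDensity α (b 0) y|
      ≤ ‖(2 * Real.pi : ℂ)‖ ^ d *
        |t ^ ((d : ℝ) / α) * transitionProb a t x - stableDensity α (b 0) y| :=
        le_mul_of_one_le_left (abs_nonneg _) h7
    _ ≤ ε := by rw [h5]; exact h6.trans h1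

end IsStableWalk

end LocalLimit

/-! ### Splitting the jumps at length A -/

section Truncation

variable {d : ℕ} {α : ℝ} {a : (Fin d → ℤ) → ℝ} {b : ℕ → EuclideanSpace ℝ (Fin d) → ℝ}
  {a₀ : EuclideanSpace ℝ (Fin d) → ℝ}

/-- The jumps of length at most `A`. -/
noncomputable def smallJumps (a : (Fin d → ℤ) → ℝ) (A : ℝ) (z : Fin d → ℤ) : ℝ :=
  if ‖latticeVec z‖ ≤ A then a z else 0

/-- The jumps of length greater than `A`. -/
noncomputable def bigJumps (a : (Fin d → ℤ) → ℝ) (A : ℝ) (z : Fin d → ℤ) : ℝ :=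
  if ‖latticeVec z‖ ≤ A then 0 else a z

lemma smallJumps_add_bigJumps (a : (Fin d → ℤ) → ℝ) (A : ℝ) (z : Fin d → ℤ) :
    smallJumps a A z + bigJumps a A z = a z := by
  unfold smallJumps bigJumps; split_ifs <;> simp

lemma smallJumps_nonneg (ha : ∀ z, 0 ≤ a z) (A : ℝ) (z : Fin d → ℤ) : 0 ≤ smallJumps a A z := by
  unfold smallJumps; split_ifs; exacts [ha z, le_rfl]

lemma bigJumps_nonneg (ha : ∀ z, 0 ≤ a z) (A : ℝ) (z : Fin d → ℤ) : 0 ≤ bigJumps a A z := by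
  unfold bigJumps; split_ifs; exacts [le_rfl, ha z]

lemma smallJumps_le (ha : ∀ z, 0 ≤ a z) (A : ℝ) (z : Fin d → ℤ) : smallJumps a A z ≤ a z := by
  linarith [smallJumps_add_bigJumps a A z, bigJumps_nonneg ha A z]

lemma bigJumps_le (ha : ∀ z, 0 ≤ a z) (A : ℝ) (z : Fin d → ℤ) : bigJumps a A z ≤ a z := by
  linarith [smallJumps_add_bigJumps a A z, smallJumps_nonneg ha A z]

lemma summable_smallJumps (ha : IsSymmetricJumpLaw a) (A : ℝ) : Summable (smallJumps a A) :=
  ha.hasSum_one.summable.of_nonneg_of_le (smallJumps_nonneg ha.nonneg A) (smallJumps_le ha.nonneg A)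

lemma summable_bigJumps (ha : IsSymmetricJumpLaw a) (A : ℝ) : Summable (bigJumps a A) :=
  ha.hasSum_one.summable.of_nonneg_of_le (bigJumps_nonneg ha.nonneg A) (bigJumps_le ha.nonneg A)

lemma tsum_smallJumps_add_tsum_bigJumps (ha : IsSymmetricJumpLaw a) (A : ℝ) :
    ∑' z, smallJumps a A z + ∑' z, bigJumps a A z = 1 := by
  rw [← (summable_smallJumps ha A).tsum_add (summable_bigJumps ha A)]
  simp_rw [smallJumps_add_bigJumps]
  exact ha.hasSum_one.tsum_eq

lemma smallJumps_neg (ha : IsSymmetricJumpLaw a) (A : ℝ) (z : Fin d → ℤ) :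
    smallJumps a A (-z) = smallJumps a A z := by
  simp [smallJumps, latticeVec_neg, ha.symm]

lemma abs_coord_le_norm (v : EuclideanSpace ℝ (Fin d)) (i : Fin d) : |v i| ≤ ‖v‖ := by
  simpa using PiLp.norm_apply_le v i

/-- Reduces norm estimates to a single coordinate; the crude constant d is enough. -/
lemma exists_norm_le_mul_abs_coord (hd : 1 ≤ d) (v : EuclideanSpace ℝ (Fin d)) :
    ∃ i, ‖v‖ ≤ d * |v i| := by
  have hne : Nonempty (Fin d) := ⟨⟨0, hd⟩⟩
  obtain ⟨i, -, hi⟩ := Finset.exists_max_image Finset.univ (fun i => |v i|)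
    ⟨Classical.arbitrary _, Finset.mem_univ _⟩
  refine ⟨i, ?_⟩
  have hd1 : (1 : ℝ) ≤ d := by exact_mod_cast hd
  refine abs_le_of_sq_le_sq' ?_ (by positivity) |>.2
  rw [EuclideanSpace.real_norm_sq_eq]
  calc ∑ j, v j ^ 2 ≤ ∑ _j : Fin d, |v i| ^ 2 := by
        refine Finset.sum_le_sum fun j hj => ?_
        rw [← sq_abs]
        have := hi j hj
        gcongr
    _ = d * |v i| ^ 2 := by simp
    _ ≤ (d * |v i|) ^ 2 := by
        rw [mul_pow]
        gcongr
        nlinarith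

lemma inner_single_latticeVec (i : Fin d) (c : ℝ) (z : Fin d → ℤ) :
    inner ℝ (EuclideanSpace.single i c) (latticeVec z) = c * z i := by
  simp [EuclideanSpace.inner_single_left, latticeVec]

lemma sq_le_mul_one_sub_cos {u : ℝ} (hu : |u| ≤ 1) : u ^ 2 ≤ 5 * (1 - Real.cos u) := by
  have h1 := Real.cos_le_one_sub_mul_cos_sq (hu.trans (by linarith [Real.pi_gt_three]))
  have h2 : 1 / 5 ≤ 2 / Real.pi ^ 2 := by
    rw [div_le_div_iff₀ (by norm_num) (by positivity)]
    nlinarith [Real.pi_lt_d2, Real.pi_pos]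
  nlinarith [sq_nonneg u]

namespace IsStableWalk

/-- Test 1-â at k = eᵢ/A: for ‖z‖ ≤ A the angle zᵢ/A is at most 1, so zᵢ² ≤ 5A²(1-cos(zᵢ/A)), and
1-â(eᵢ/A) is O(A^{-α}). -/
lemma tsum_smallJumps_mul_sq (W : IsStableWalk α a b a₀) :
    ∃ C > 0, ∀ A : ℝ, 0 < A → ∀ i : Fin d,
      Summable (fun z => smallJumps a A z * (z i : ℝ) ^ 2) ∧
      ∑' z, smallJumps a A z * (z i : ℝ) ^ 2 ≤ C * A ^ (2 - α) := by
  obtain ⟨C, hC, hb⟩ := W.one_sub_jumpFourier_le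
  refine ⟨5 * C, by positivity, fun A hA i => ?_⟩
  have h1 := hasSum_one_sub_jumpFourier W.jumpLaw (EuclideanSpace.single i A⁻¹)
  have h2 : ∀ z : Fin d → ℤ, smallJumps a A z * (z i : ℝ) ^ 2 ≤ 5 * A ^ 2 *
      ((1 - Real.cos (inner ℝ (EuclideanSpace.single i A⁻¹) (latticeVec z))) * a z) := by
    intro z
    have hn : 0 ≤ (1 - Real.cos (inner ℝ (EuclideanSpace.single i A⁻¹) (latticeVec z))) * a z :=
      mul_nonneg (sub_nonneg.2 (Real.cos_le_one _)) (W.jumpLaw.nonneg z)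
    unfold smallJumps
    split_ifs with hz
    · have h3 : |(z i : ℝ)| ≤ A := (abs_coord_le_norm (latticeVec z) i).trans hz
      have h4 : |A⁻¹ * (z i : ℝ)| ≤ 1 := by
        rw [abs_mul, abs_of_pos (inv_pos.2 hA), inv_mul_le_iff₀ hA, mul_one]
        exact h3
      have h5 := sq_le_mul_one_sub_cos h4
      rw [inner_single_latticeVec]
      have h6 : (z i : ℝ) ^ 2 = A ^ 2 * (A⁻¹ * (z i : ℝ)) ^ 2 := by
        field_simp
      have ha := W.jumpLaw.nonneg z
      rw [h6]
      calc a z * (A ^ 2 * (A⁻¹ * (z i : ℝ)) ^ 2)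
          ≤ a z * (A ^ 2 * (5 * (1 - Real.cos (A⁻¹ * (z i : ℝ))))) := by gcongr
        _ = _ := by ring
    · rw [zero_mul]
      positivity
  have hs : Summable fun z => smallJumps a A z * (z i : ℝ) ^ 2 :=
    (h1.summable.mul_left (5 * A ^ 2)).of_nonneg_of_le
      (fun z => mul_nonneg (smallJumps_nonneg W.jumpLaw.nonneg A z) (sq_nonneg _)) h2
  refine ⟨hs, (hs.tsum_le_tsum h2 (h1.summable.mul_left _)).trans ?_⟩
  rw [tsum_mul_left, h1.tsum_eq]
  have h3 := hb (EuclideanSpace.single i A⁻¹)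
  have h4 : ‖(EuclideanSpace.single i A⁻¹ : EuclideanSpace ℝ (Fin d))‖ = A⁻¹ := by
    simp [abs_of_pos hA]
  rw [h4] at h3
  calc 5 * A ^ 2 * (1 - jumpFourier a (EuclideanSpace.single i A⁻¹))
      ≤ 5 * A ^ 2 * (C * A⁻¹ ^ α) := by gcongr
    _ = 5 * C * A ^ (2 - α) := by
      rw [Real.inv_rpow hA.le, Real.rpow_sub hA, Real.rpow_two]; ring

/-- The rate of jumps longer than `A` is `O(A^{-α})`. -/
lemma tsum_bigJumps_le (W : IsStableWalk α a b a₀) :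
    ∃ C > 0, ∀ A : ℝ, 0 < A → ∑' z, bigJumps a A z ≤ C * A ^ (-α) := by
  obtain ⟨C, hC, hb⟩ := W.one_sub_jumpFourier_le
  have hα := W.pos
  have hd0 : (0 : ℝ) < d := by exact_mod_cast W.one_le
  refine ⟨d * (2 * (C * (2 * d) ^ α)), by positivity, fun A hA => ?_⟩
  have hcont := continuous_jumpFourier W.jumpLaw
  -- Bounding finite partial sums makes the exchange of the sum with the θ-integral a matter of
  -- linearity.
  refine Real.tsum_le_of_sum_le (bigJumps_nonneg W.jumpLaw.nonneg A) fun T => ?_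
  -- Average 1-â over the segment from 0 to (2d/A)eᵢ. If ‖z‖ > A, some coordinate satisfies |zᵢ| ≥
  -- A/d, so u = (2d/A)zᵢ has |u| ≥ 2 and the average 1 - sin(u)/u is at least 1/2.
  set k : Fin d → ℝ → EuclideanSpace ℝ (Fin d) :=
    fun i θ => EuclideanSpace.single i (θ * (2 * d / A)) with hk
  have hkc : ∀ i, Continuous (k i) := fun i => by
    have : k i = fun θ => (θ * (2 * d / A)) • EuclideanSpace.single i (1 : ℝ) := by
      funext θ
      ext j
      by_cases hj : j = i <;> simp [hk, hj]
    rw [this]; fun_prop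
  have hpt : ∀ z : Fin d → ℤ, bigJumps a A z ≤ ∑ i, 2 * (a z *
      ∫ θ in (0 : ℝ)..1, (1 - Real.cos (inner ℝ (k i θ) (latticeVec z)))) := by
    intro z
    have haz := W.jumpLaw.nonneg z
    have hnn : ∀ i, 0 ≤ 2 * (a z *
        ∫ θ in (0 : ℝ)..1, (1 - Real.cos (inner ℝ (k i θ) (latticeVec z)))) := fun i =>
      mul_nonneg zero_le_two (mul_nonneg haz (intervalIntegral.integral_nonneg zero_le_one
        fun θ _ => sub_nonneg.2 (Real.cos_le_one _)))
    unfold bigJumps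
    split_ifs with hz
    · exact Finset.sum_nonneg fun i _ => hnn i
    · obtain ⟨i, hi⟩ := exists_norm_le_mul_abs_coord W.one_le (latticeVec z)
      refine le_trans ?_ (Finset.single_le_sum (fun i _ => hnn i) (Finset.mem_univ i))
      set u : ℝ := 2 * d / A * z i with hu
      have hu2 : 2 ≤ |u| := by
        have h1 : A ≤ d * |(z i : ℝ)| := (not_le.1 hz).le.trans hi
        rw [hu, abs_mul, abs_of_pos (by positivity), div_mul_eq_mul_div, le_div_iff₀ hA]
        linarith
      have hu0 : u ≠ 0 := by
        intro h
        rw [h, abs_zero] at hu2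
        linarith
      have h2 : ∫ θ in (0 : ℝ)..1, (1 - Real.cos (inner ℝ (k i θ) (latticeVec z)))
          = 1 - Real.sin u / u := by
        have h3 : ∀ θ : ℝ, inner ℝ (k i θ) (latticeVec z) = θ * u := by
          intro θ
          rw [hk, inner_single_latticeVec]; ring
        simp_rw [h3]
        rw [intervalIntegral.integral_sub (by simp)
          ((by fun_prop : Continuous fun θ : ℝ => Real.cos (θ * u)).intervalIntegrable _ _),
          intervalIntegral.integral_comp_mul_right _ hu0]
        simp [integral_cos, inv_mul_eq_div]
      rw [h2]
      have h4 : Real.sin u / u ≤ 1 / 2 := by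
        refine (le_abs_self _).trans ?_
        rw [abs_div]
        exact div_le_div₀ zero_le_one (Real.abs_sin_le_one u) two_pos hu2
      nlinarith
  calc ∑ z ∈ T, bigJumps a A z
      ≤ ∑ z ∈ T, ∑ i, 2 * (a z *
        ∫ θ in (0 : ℝ)..1, (1 - Real.cos (inner ℝ (k i θ) (latticeVec z)))) :=
        Finset.sum_le_sum fun z _ => hpt z
    _ = ∑ i, 2 * ∫ θ in (0 : ℝ)..1, ∑ z ∈ T,
        a z * (1 - Real.cos (inner ℝ (k i θ) (latticeVec z))) := by
        rw [Finset.sum_comm]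
        refine Finset.sum_congr rfl fun i _ => ?_
        have := hkc i
        rw [intervalIntegral.integral_finsetSum fun z _ => Continuous.intervalIntegrable
          (by fun_prop) _ _, Finset.mul_sum]
        refine Finset.sum_congr rfl fun z _ => ?_
        rw [intervalIntegral.integral_const_mul]
    _ ≤ ∑ _i : Fin d, 2 * (C * (2 * d) ^ α * A ^ (-α)) := by
        refine Finset.sum_le_sum fun i _ => ?_
        have := hkc i
        have h5 : ∫ θ in (0 : ℝ)..1, ∑ z ∈ T,
            a z * (1 - Real.cos (inner ℝ (k i θ) (latticeVec z)))
            ≤ ∫ _θ in (0 : ℝ)..1, C * (2 * d) ^ α * A ^ (-α) := by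
          refine intervalIntegral.integral_mono_on zero_le_one
            (Continuous.intervalIntegrable (by fun_prop) _ _) (by simp) fun θ hθ => ?_
          have h6 := hasSum_one_sub_jumpFourier W.jumpLaw (k i θ)
          have h7 : ∑ z ∈ T, a z * (1 - Real.cos (inner ℝ (k i θ) (latticeVec z)))
              ≤ 1 - jumpFourier a (k i θ) := by
            simp_rw [mul_comm (a _)]
            exact sum_le_hasSum T (fun z _ => mul_nonneg (sub_nonneg.2 (Real.cos_le_one _))
              (W.jumpLaw.nonneg z)) h6
          refine h7.trans ((hb _).trans ?_)
          rw [mul_assoc]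
          gcongr
          have h8 : ‖k i θ‖ ≤ 2 * d / A := by
            rw [hk]
            simp only [PiLp.norm_single, Real.norm_eq_abs]
            rw [abs_of_nonneg (mul_nonneg hθ.1 (by positivity))]
            exact mul_le_of_le_one_left (by positivity) hθ.2
          calc ‖k i θ‖ ^ α ≤ (2 * d / A) ^ α := by gcongr
            _ = (2 * d) ^ α * A ^ (-α) := by
              rw [Real.div_rpow (by positivity) hA.le, Real.rpow_neg hA.le]; rfl
        rw [intervalIntegral.integral_const, sub_zero, one_smul] at h5
        linarith
    _ = _ := by simp; ring

end IsStableWalk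

/-- The law at time `t` of the walk that makes only the jumps of length at most `A`. -/
noncomputable def truncatedWalk (a : (Fin d → ℤ) → ℝ) (A t : ℝ) (x : Fin d → ℤ) : ℝ :=
  Real.exp (-(t * ∑' z, smallJumps a A z)) * convExp (fun z => t * smallJumps a A z) x

lemma truncatedWalk_nonneg (ha : ∀ z, 0 ≤ a z) (A : ℝ) {t : ℝ} (ht : 0 ≤ t) (x : Fin d → ℤ) :
    0 ≤ truncatedWalk a A t x :=
  mul_nonneg (Real.exp_pos _).le
    (convExp_nonneg (fun z => mul_nonneg ht (smallJumps_nonneg ha A z)) x)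

lemma summable_truncatedWalk (ha : IsSymmetricJumpLaw a) (A t : ℝ) :
    Summable (truncatedWalk a A t) :=
  (summable_convExp ((summable_smallJumps ha A).mul_left t)).mul_left _

lemma tsum_truncatedWalk (ha : IsSymmetricJumpLaw a) (A t : ℝ) :
    ∑' x, truncatedWalk a A t x = 1 := by
  simp_rw [truncatedWalk]
  rw [tsum_mul_left, tsum_convExp ((summable_smallJumps ha A).mul_left t), tsum_mul_left,
    ← Real.exp_eq_exp_ℝ, ← Real.exp_add, neg_add_cancel, Real.exp_zero]

lemma discreteConv_const_mul_const_mul (c c' : ℝ) (u v : (Fin d → ℤ) → ℝ) (x : Fin d → ℤ) :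
    discreteConv (fun z => c * u z) (fun z => c' * v z) x = c * c' * discreteConv u v x := by
  rw [discreteConv, discreteConv, ← tsum_mul_left]
  exact tsum_congr fun z => by ring

lemma truncatedWalk_semigroup (ha : IsSymmetricJumpLaw a) (A t : ℝ) (x : Fin d → ℤ) :
    truncatedWalk a A t x
      = discreteConv (truncatedWalk a A (t / 2)) (truncatedWalk a A (t / 2)) x := by
  have hs := (summable_smallJumps ha A).mul_left (t / 2)
  have h1 := convExp_add hs hs
  have h2 : (fun z => t / 2 * smallJumps a A z + t / 2 * smallJumps a A z)
      = fun z => t * smallJumps a A z := by funext z; ring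
  rw [h2] at h1
  rw [show truncatedWalk a A (t / 2) = fun z =>
    Real.exp (-(t / 2 * ∑' z, smallJumps a A z)) * convExp (fun z => t / 2 * smallJumps a A z) z
    from rfl, discreteConv_const_mul_const_mul, truncatedWalk, h1, ← Real.exp_add]
  congr 2; ring

/-- Small and big jumps form independent compound Poisson processes; their rates add up to 1, which
matches the normalizations. -/
lemma transitionProb_eq_conv (ha : IsSymmetricJumpLaw a) (A t : ℝ) (x : Fin d → ℤ) :
    transitionProb a t x = Real.exp (-(t * ∑' z, bigJumps a A z)) *
      discreteConv (truncatedWalk a A t) (convExp fun z => t * bigJumps a A z) x := by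
  have h1 := convExp_add ((summable_smallJumps ha A).mul_left t)
    ((summable_bigJumps ha A).mul_left t)
  simp_rw [← mul_add, smallJumps_add_bigJumps] at h1
  have h3 := discreteConv_const_mul_const_mul (Real.exp (-(t * ∑' z, smallJumps a A z))) 1
    (convExp fun z => t * smallJumps a A z) (convExp fun z => t * bigJumps a A z) x
  simp_rw [one_mul] at h3
  rw [transitionProb_eq, h1, show truncatedWalk a A t = fun z =>
    Real.exp (-(t * ∑' z, smallJumps a A z)) * convExp (fun z => t * smallJumps a A z) z
    from rfl, h3, mul_one, ← mul_assoc, ← Real.exp_add]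
  congr 2
  linear_combination t * tsum_smallJumps_add_tsum_bigJumps ha A

end Truncation

/-! ### Large deviations of the walk without big jumps -/

section TruncatedWalk

variable {d : ℕ} {α : ℝ} {a : (Fin d → ℤ) → ℝ} {b : ℕ → EuclideanSpace ℝ (Fin d) → ℝ}
  {a₀ : EuclideanSpace ℝ (Fin d) → ℝ}

lemma exp_sub_one_sub_le (u : ℝ) : Real.exp u - 1 - u ≤ u ^ 2 * Real.exp |u| := by
  have h := Complex.norm_exp_sub_sum_le_norm_mul_exp (u : ℂ) 2
  simp only [Finset.sum_range_succ, Finset.sum_range_zero, Nat.factorial] at h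
  rw [Complex.norm_real, Real.norm_eq_abs, sq_abs] at h
  refine le_trans ?_ h
  have h2 : Complex.exp (u : ℂ) - (0 + (u : ℂ) ^ 0 / ((1 : ℕ) : ℂ)
      + (u : ℂ) ^ 1 / (((0 + 1) * 1 : ℕ) : ℂ)) = ((Real.exp u - 1 - u : ℝ) : ℂ) := by
    push_cast; norm_num; ring
  rw [h2, Complex.norm_real]
  exact le_abs_self _

lemma abs_coord_le_of_smallJumps_ne_zero {A : ℝ} {z : Fin d → ℤ} (hz : ‖latticeVec z‖ ≤ A)
    (i : Fin d) : |(z i : ℝ)| ≤ A :=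
  (abs_coord_le_norm (latticeVec z) i).trans hz

lemma summable_smallJumps_mul (ha : IsSymmetricJumpLaw a) {A M : ℝ} {g : (Fin d → ℤ) → ℝ}
    (hg : ∀ z, ‖latticeVec z‖ ≤ A → |g z| ≤ M) : Summable fun z => smallJumps a A z * g z := by
  refine Summable.of_norm_bounded (ha.hasSum_one.summable.mul_right |M|) fun z => ?_
  have haz := ha.nonneg z
  unfold smallJumps
  split_ifs with hz
  · rw [norm_mul, Real.norm_of_nonneg haz]
    have := (hg z hz).trans (le_abs_self M)
    gcongr
    exact this
  · rw [zero_mul, norm_zero]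
    positivity

namespace IsStableWalk

/-- Exponential moments of the truncated walk. -/
lemma truncatedWalk_exp_moment (W : IsStableWalk α a b a₀) :
    ∃ C > 0, ∀ A : ℝ, 0 < A → ∀ t : ℝ, 0 ≤ t → ∀ (s : ℝ) (i : Fin d),
      Summable (fun z => truncatedWalk a A t z * Real.exp (s * z i)) ∧
      ∑' z, truncatedWalk a A t z * Real.exp (s * z i)
        ≤ Real.exp (t * (s ^ 2 * Real.exp (|s| * A) * (C * A ^ (2 - α)))) := by
  obtain ⟨C, hC, hb⟩ := W.tsum_smallJumps_mul_sq
  refine ⟨C, hC, fun A hA t ht s i => ?_⟩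
  obtain ⟨hs2, hle⟩ := hb A hA i
  have hna := W.jumpLaw.nonneg
  set χ : (Fin d → ℤ) → ℝ := fun z => Real.exp (s * z i) with hχ
  have h0 : χ 0 = 1 := by simp [hχ]
  have hmul : ∀ x y, χ (x + y) = χ x * χ y := fun x y => by
    simp [hχ, mul_add, Real.exp_add]
  have hsa : ∀ z : Fin d → ℤ, ‖latticeVec z‖ ≤ A → |s * z i| ≤ |s| * A := fun z hz => by
    rw [abs_mul]
    exact mul_le_mul_of_nonneg_left (abs_coord_le_of_smallJumps_ne_zero hz i) (abs_nonneg s)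
  have hsχ : Summable fun z => smallJumps a A z * χ z :=
    summable_smallJumps_mul W.jumpLaw (M := Real.exp (|s| * A)) fun z hz => by
      rw [abs_of_pos (Real.exp_pos _)]
      exact Real.exp_le_exp.2 ((le_abs_self _).trans (hsa z hz))
  have hsl : Summable fun z => smallJumps a A z * (s * z i) :=
    summable_smallJumps_mul W.jumpLaw (M := |s| * A) hsa
  -- By symmetry the first moment vanishes, so the exponential moment is governed by the second
  -- moments of the small jumps.
  have hlin : ∑' z, smallJumps a A z * (s * z i) = 0 := by
    have h1 := (Equiv.neg (Fin d → ℤ)).tsum_eq fun z => smallJumps a A z * (s * z i)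
    simp only [Equiv.neg_apply, smallJumps_neg W.jumpLaw, Pi.neg_apply, Int.cast_neg, mul_neg,
      tsum_neg] at h1
    linarith
  have hst : Summable fun z => t * smallJumps a A z * χ z := by
    simp_rw [mul_assoc]; exact hsχ.mul_left t
  have hsum := tsum_convExp_character h0 hmul hst
  have hsum' := summable_convExp_character h0 hmul hst
  have e1 : ∀ z, truncatedWalk a A t z * χ z = Real.exp (-(t * ∑' z, smallJumps a A z)) *
      (convExp (fun z => t * smallJumps a A z) z * χ z) := fun z => by
    rw [truncatedWalk, mul_assoc]
  change Summable (fun z => truncatedWalk a A t z * χ z) ∧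
    ∑' z, truncatedWalk a A t z * χ z ≤ _
  simp_rw [e1]
  refine ⟨hsum'.mul_left _, ?_⟩
  rw [tsum_mul_left, hsum, ← Real.exp_eq_exp_ℝ, ← Real.exp_add]
  refine Real.exp_le_exp.2 ?_
  simp_rw [mul_assoc t]
  rw [tsum_mul_left]
  have e2 : -(t * ∑' z, smallJumps a A z) + t * ∑' z, smallJumps a A z * χ z
      = t * ∑' z, smallJumps a A z * (χ z - 1 - s * z i) := by
    have h1 : ∀ z, smallJumps a A z * (χ z - 1 - s * z i)
        = smallJumps a A z * χ z - smallJumps a A z - smallJumps a A z * (s * z i) := fun z => by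
      ring
    simp_rw [h1]
    rw [(hsχ.sub (summable_smallJumps W.jumpLaw A)).tsum_sub hsl,
      hsχ.tsum_sub (summable_smallJumps W.jumpLaw A), hlin]
    ring
  rw [e2]
  refine mul_le_mul_of_nonneg_left ?_ ht
  have h2 : ∀ z, smallJumps a A z * (χ z - 1 - s * z i)
      ≤ s ^ 2 * Real.exp (|s| * A) * (smallJumps a A z * (z i : ℝ) ^ 2) := by
    intro z
    by_cases hz : ‖latticeVec z‖ ≤ A
    · have h3 := exp_sub_one_sub_le (s * z i)
      have h4 : Real.exp |s * z i| ≤ Real.exp (|s| * A) := Real.exp_le_exp.2 (hsa z hz)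
      have h5 := smallJumps_nonneg hna A z
      calc smallJumps a A z * (χ z - 1 - s * z i)
          ≤ smallJumps a A z * ((s * z i) ^ 2 * Real.exp (|s| * A)) := by
            gcongr
            exact h3.trans (by gcongr)
        _ = _ := by ring
    · simp [smallJumps, hz]
  have hs3 : Summable fun z => smallJumps a A z * (χ z - 1 - s * z i) := by
    simp_rw [mul_sub, mul_one]
    exact (hsχ.sub (summable_smallJumps W.jumpLaw A)).sub hsl
  refine (hs3.tsum_le_tsum h2 (hs2.mul_left _)).trans ?_
  rw [tsum_mul_left]
  gcongr

/-- Tail bound for the truncated walk. -/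
lemma truncatedWalk_tail (W : IsStableWalk α a b a₀) :
    ∃ C > 0, ∀ A : ℝ, 0 < A → ∀ t : ℝ, 0 < t → t * A ^ (-α) ≤ 1 → ∀ r : ℝ,
      ∑' z, (if r ≤ ‖latticeVec z‖ then truncatedWalk a A t z else 0)
        ≤ C * (t * A ^ (-α)) ^ (r / (2 * d * A)) := by
  obtain ⟨C, hC, hb⟩ := W.truncatedWalk_exp_moment
  have hd0 : (0 : ℝ) < d := by exact_mod_cast W.one_le
  refine ⟨d * (2 * Real.exp (2 * C)), by positivity, fun A hA t ht hq r => ?_⟩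
  have hq0 : 0 < t * A ^ (-α) := by positivity
  set q := t * A ^ (-α) with hqdef
  -- This tilt makes e^{-2sA} = q. With y = sA the exponent of the moment is C·q·y²e^y ≤ 2C·q·e^{2y}
  -- = 2C, while the Chernoff factor e^{-sr/d} for one coordinate is q^{r/(2dA)}.
  set s := -Real.log q / (2 * A) with hs
  have hlog : Real.log q ≤ 0 := Real.log_nonpos hq0.le hq
  have hs0 : 0 ≤ s := div_nonneg (by linarith) (by positivity)
  have hP0 := fun z => truncatedWalk_nonneg W.jumpLaw.nonneg A ht.le z
  -- the exponential moments are bounded for this choice of the tilt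
  have hmom : ∀ s' : ℝ, |s'| = s → t * (s' ^ 2 * Real.exp (|s'| * A) * (C * A ^ (2 - α)))
      ≤ 2 * C := by
    intro s' hs'
    rw [← sq_abs, hs']
    set y := s * A with hy
    have hy0 : 0 ≤ y := by positivity
    have h1 : q = Real.exp (-(2 * y)) := by
      rw [hy, hs, ← Real.exp_log hq0]
      rw [Real.log_exp]
      congr 1
      field_simp
    have h2 : y ^ 2 ≤ 2 * Real.exp y := by
      have := Real.quadratic_le_exp_of_nonneg hy0
      linarith
    have h3 : t * (s ^ 2 * Real.exp y * (C * A ^ (2 - α))) = C * (q * (y ^ 2 * Real.exp y)) := by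
      rw [hqdef, hy, show (2 : ℝ) - α = 2 + -α by ring, Real.rpow_add hA, Real.rpow_two]
      ring
    rw [h3]
    calc C * (q * (y ^ 2 * Real.exp y)) ≤ C * (q * (2 * Real.exp y * Real.exp y)) := by gcongr
      _ = 2 * C * Real.exp (-(2 * y) + y + y) := by
        rw [Real.exp_add, Real.exp_add, ← h1]; ring
      _ = 2 * C := by rw [show -(2 * y) + y + y = 0 by ring, Real.exp_zero, mul_one]
  have hfac : Real.exp (-(s * (r / d))) = q ^ (r / (2 * d * A)) := by
    rw [Real.rpow_def_of_pos hq0, hs]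
    congr 1
    field_simp
  have hpt : ∀ z : Fin d → ℤ, (if r ≤ ‖latticeVec z‖ then truncatedWalk a A t z else 0)
      ≤ ∑ i, Real.exp (-(s * (r / d))) * (truncatedWalk a A t z * Real.exp (s * z i)
        + truncatedWalk a A t z * Real.exp (-s * z i)) := by
    intro z
    have hPz := hP0 z
    have hnn : ∀ i, 0 ≤ Real.exp (-(s * (r / d))) * (truncatedWalk a A t z * Real.exp (s * z i)
        + truncatedWalk a A t z * Real.exp (-s * z i)) := fun i => by positivity
    split_ifs with hz
    · obtain ⟨i, hi⟩ := exists_norm_le_mul_abs_coord W.one_le (latticeVec z)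
      refine le_trans ?_ (Finset.single_le_sum (fun i _ => hnn i) (Finset.mem_univ i))
      have h1 : r / d ≤ |(z i : ℝ)| := by
        rw [div_le_iff₀ hd0, mul_comm]; exact hz.trans hi
      have h2 : Real.exp (s * (r / d)) ≤ Real.exp (s * z i) + Real.exp (-s * z i) := by
        have h3 : Real.exp (s * (r / d)) ≤ Real.exp (s * |(z i : ℝ)|) :=
          Real.exp_le_exp.2 (mul_le_mul_of_nonneg_left h1 hs0)
        rcases abs_cases (z i : ℝ) with ⟨h, -⟩ | ⟨h, -⟩ <;> rw [h] at h3
        · linarith [Real.exp_pos (-s * z i)]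
        · rw [mul_neg, ← neg_mul] at h3
          linarith [Real.exp_pos (s * z i)]
      calc truncatedWalk a A t z
          = Real.exp (-(s * (r / d))) * (truncatedWalk a A t z * Real.exp (s * (r / d))) := by
            rw [mul_left_comm, ← Real.exp_add, neg_add_cancel, Real.exp_zero, mul_one]
        _ ≤ _ := by
            rw [← mul_add]
            gcongr
    · exact Finset.sum_nonneg fun i _ => hnn i
  have hsi : ∀ i : Fin d, Summable fun z => Real.exp (-(s * (r / d))) *
      (truncatedWalk a A t z * Real.exp (s * z i)
        + truncatedWalk a A t z * Real.exp (-s * z i)) := fun i =>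
    ((hb A hA t ht.le s i).1.add (hb A hA t ht.le (-s) i).1).mul_left _
  have hsum := summable_sum (s := Finset.univ) fun i (_ : i ∈ Finset.univ) => hsi i
  have hsl : Summable fun z => (if r ≤ ‖latticeVec z‖ then truncatedWalk a A t z else 0) :=
    (summable_truncatedWalk W.jumpLaw A t).of_nonneg_of_le
      (fun z => by split_ifs; exacts [hP0 z, le_rfl])
      (fun z => by split_ifs; exacts [le_rfl, hP0 z])
  refine (hsl.tsum_le_tsum hpt hsum).trans ?_
  rw [Summable.tsum_finsetSum fun i _ => hsi i]
  have hbound : ∀ i ∈ Finset.univ, ∑' z, Real.exp (-(s * (r / d))) *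
      (truncatedWalk a A t z * Real.exp (s * z i) + truncatedWalk a A t z * Real.exp (-s * z i))
      ≤ q ^ (r / (2 * d * A)) * (2 * Real.exp (2 * C)) := by
    intro i _
    obtain ⟨s1, l1⟩ := hb A hA t ht.le s i
    obtain ⟨s2, l2⟩ := hb A hA t ht.le (-s) i
    rw [tsum_mul_left, s1.tsum_add s2, hfac]
    have m1 := l1.trans (Real.exp_le_exp.2 (hmom s (abs_of_nonneg hs0)))
    have m2 := l2.trans (Real.exp_le_exp.2 (hmom (-s) (by rw [abs_neg, abs_of_nonneg hs0])))
    gcongr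
    linarith
  refine (Finset.sum_le_sum hbound).trans (le_of_eq ?_)
  simp
  ring

/-- Having no big jump up to time t has probability e^{-tΛ}, bounded below when q ≤ 1, so the
truncated law is at most a constant times p and inherits its on-diagonal bound. -/
lemma truncatedWalk_le_sup (W : IsStableWalk α a b a₀) :
    ∃ C > 0, ∀ A : ℝ, 0 < A → ∀ t : ℝ, 0 < t → t * A ^ (-α) ≤ 1 → ∀ x : Fin d → ℤ,
      truncatedWalk a A t x ≤ C * t ^ (-((d : ℝ) / α)) := by
  obtain ⟨C, hC, hb⟩ := W.transitionProb_le
  obtain ⟨C', hC', hb'⟩ := W.tsum_bigJumps_le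
  refine ⟨Real.exp C' * C, by positivity, fun A hA t ht hq x => ?_⟩
  have hna := W.jumpLaw.nonneg
  set Λ := ∑' z, bigJumps a A z with hΛ
  have htΛ : t * Λ ≤ C' := by
    calc t * Λ ≤ t * (C' * A ^ (-α)) := by gcongr; exact hb' A hA
      _ = C' * (t * A ^ (-α)) := by ring
      _ ≤ C' * 1 := by gcongr
      _ = C' := mul_one _
  have hsb := (summable_bigJumps W.jumpLaw A).mul_left t
  have hbn : ∀ z, 0 ≤ t * bigJumps a A z := fun z => mul_nonneg ht.le (bigJumps_nonneg hna A z)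
  have hE0 : 1 ≤ convExp (fun z => t * bigJumps a A z) 0 := by
    have h1 := (convExp_remainder hbn hsb (M := ∑' z, t * bigJumps a A z)
      (fun z => hsb.le_tsum z fun _ _ => hbn _) 0).1
    rw [if_pos rfl] at h1
    linarith [hbn 0]
  have hP0 := fun z => truncatedWalk_nonneg hna A ht.le z
  have hEn := convExp_nonneg hbn
  have h2 : truncatedWalk a A t x ≤ discreteConv (truncatedWalk a A t)
      (convExp fun z => t * bigJumps a A z) x := by
    have h3 := (summable_conv_fiber (summable_truncatedWalk W.jumpLaw A t)
      (summable_convExp hsb) x).le_tsum 0 fun z _ => mul_nonneg (hP0 _) (hEn z)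
    rw [sub_zero] at h3
    exact (le_mul_of_one_le_right (hP0 x) hE0).trans h3
  have h4 := transitionProb_eq_conv W.jumpLaw A t x
  have h5 := hb t ht x
  have htd : 0 < t ^ ((d : ℝ) / α) := by positivity
  have h6 : transitionProb a t x ≤ C * t ^ (-((d : ℝ) / α)) := by
    rw [Real.rpow_neg ht.le, ← div_eq_mul_inv, le_div_iff₀ htd, mul_comm]
    exact h5
  calc truncatedWalk a A t x ≤ discreteConv (truncatedWalk a A t)
        (convExp fun z => t * bigJumps a A z) x := h2
    _ = Real.exp (t * Λ) * transitionProb a t x := by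
        rw [h4, ← mul_assoc, ← Real.exp_add, add_neg_cancel, Real.exp_zero, one_mul]
    _ ≤ Real.exp C' * (C * t ^ (-((d : ℝ) / α))) := by
        have := transitionProb_nonneg hna ht.le x
        gcongr
    _ = _ := by ring

/-- Off-diagonal bound for the truncated walk. -/
lemma truncatedWalk_le (W : IsStableWalk α a b a₀) :
    ∃ C > 0, ∀ A : ℝ, 0 < A → ∀ t : ℝ, 0 < t → t * A ^ (-α) ≤ 1 → ∀ x : Fin d → ℤ,
      truncatedWalk a A t x
        ≤ C * (t ^ (-((d : ℝ) / α)) * (t * A ^ (-α)) ^ (‖latticeVec x‖ / (4 * d * A))) := by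
  obtain ⟨C₁, hC₁, h₁⟩ := W.truncatedWalk_le_sup
  obtain ⟨C₂, hC₂, h₂⟩ := W.truncatedWalk_tail
  have hd0 : (0 : ℝ) < d := by exact_mod_cast W.one_le
  refine ⟨2 * (C₁ * 2 ^ ((d : ℝ) / α)) * C₂, by positivity, fun A hA t ht hq x => ?_⟩
  have hna := W.jumpLaw.nonneg
  set q := t * A ^ (-α) with hqdef
  have hq0 : 0 < q := by positivity
  have ht2 : 0 < t / 2 := by positivity
  have hq2 : t / 2 * A ^ (-α) ≤ q := by
    have : 0 < A ^ (-α) := by positivity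
    rw [hqdef]; gcongr; linarith
  set P := truncatedWalk a A (t / 2) with hP
  have hP0 : ∀ z, 0 ≤ P z := fun z => truncatedWalk_nonneg hna A ht2.le z
  set X := ‖latticeVec x‖ with hX
  set S := C₁ * (t / 2) ^ (-((d : ℝ) / α)) with hS
  have hsup : ∀ z, P z ≤ S := h₁ A hA _ ht2 (hq2.trans hq)
  have hS0 : 0 ≤ S := by positivity
  set T : (Fin d → ℤ) → ℝ := fun z => if X / 2 ≤ ‖latticeVec z‖ then P z else 0 with hT
  have hT0 : ∀ z, 0 ≤ T z := fun z => by
    simp only [hT]; split_ifs; exacts [hP0 z, le_rfl]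
  have hTs : Summable T :=
    (summable_truncatedWalk W.jumpLaw A (t / 2)).of_nonneg_of_le hT0
      (fun z => by simp only [hT]; split_ifs; exacts [le_rfl, hP0 z])
  -- Of the two displacements during the half-times one has length at least X/2; it pays the tail
  -- and the other is bounded by the supremum. This gives the exponent (X/2)/(2dA) = X/(4dA).
  have hpt : ∀ z, P (x - z) * P z ≤ S * T z + S * T (x - z) := by
    intro z
    have htri : X ≤ ‖latticeVec z‖ + ‖latticeVec (x - z)‖ := by
      rw [hX, latticeVec_sub]
      calc ‖latticeVec x‖ = ‖latticeVec z + (latticeVec x - latticeVec z)‖ := by congr 1; abel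
        _ ≤ _ := norm_add_le _ _
    by_cases hz : X / 2 ≤ ‖latticeVec z‖
    · have h3 : T z = P z := by simp only [hT, if_pos hz]
      rw [h3]
      have := mul_nonneg hS0 (hT0 (x - z))
      have := mul_le_mul_of_nonneg_right (hsup (x - z)) (hP0 z)
      linarith
    · have hz' : X / 2 ≤ ‖latticeVec (x - z)‖ := by linarith [not_le.1 hz]
      have h3 : T (x - z) = P (x - z) := by simp only [hT, if_pos hz']
      rw [h3]
      have := mul_nonneg hS0 (hT0 z)
      have := mul_le_mul_of_nonneg_left (hsup z) (hP0 (x - z))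
      linarith
  have hTs' : Summable fun z => T (x - z) := (Equiv.subLeft x).summable_iff.2 hTs
  have hTeq : ∑' z, T (x - z) = ∑' z, T z := (Equiv.subLeft x).tsum_eq T
  have htail : ∑' z, T z ≤ C₂ * q ^ (X / (4 * d * A)) := by
    have h3 := h₂ A hA _ ht2 (hq2.trans hq) (X / 2)
    refine h3.trans ?_
    rw [show X / 2 / (2 * d * A) = X / (4 * d * A) by field_simp; norm_num]
    gcongr
  rw [truncatedWalk_semigroup W.jumpLaw]
  calc discreteConv P P x ≤ ∑' z, (S * T z + S * T (x - z)) :=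
        (summable_conv_fiber (summable_truncatedWalk W.jumpLaw A _)
          (summable_truncatedWalk W.jumpLaw A _) x).tsum_le_tsum hpt
          ((hTs.mul_left S).add (hTs'.mul_left S))
    _ = 2 * S * ∑' z, T z := by
        rw [(hTs.mul_left S).tsum_add (hTs'.mul_left S), tsum_mul_left, tsum_mul_left, hTeq]
        ring
    _ ≤ 2 * S * (C₂ * q ^ (X / (4 * d * A))) := by gcongr
    _ = _ := by
        rw [hS, Real.div_rpow ht.le zero_le_two, Real.rpow_neg zero_le_two]
        field_simp

end IsStableWalk

end TruncatedWalk

/-! ### One big jump -/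

section TailAsymptotics

variable {d : ℕ} {α : ℝ} {a : (Fin d → ℤ) → ℝ} {b : ℕ → EuclideanSpace ℝ (Fin d) → ℝ}
  {a₀ : EuclideanSpace ℝ (Fin d) → ℝ}

/-- Stability of `P * exp(c)` at `x`: it is close to `v` if `c` is close to `v` near `x` and
`P` is concentrated near the origin. -/
lemma abs_discreteConv_convExp_sub_le {P c : (Fin d → ℤ) → ℝ} (hP0 : ∀ z, 0 ≤ P z)
    (hPs : Summable P) (hP1 : ∑' z, P z = 1) (hc0 : ∀ z, 0 ≤ c z) (hcs : Summable c) {M : ℝ}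
    (hM : ∀ z, c z ≤ M) {x : Fin d → ℤ} {v ρ ε : ℝ} (hv : 0 ≤ v) (hε : 0 ≤ ε)
    (hnear : ∀ z, ‖latticeVec z‖ ≤ ρ → |c (x - z) - v| ≤ ε) :
    |discreteConv P (convExp c) x - v| ≤ P x + (ε + M * (Real.exp (∑' z, c z) - 1))
      + (M + v) * ∑' z, (if ρ ≤ ‖latticeVec z‖ then P z else 0) := by
  have hM0 : 0 ≤ M := (hc0 0).trans (hM 0)
  set K := M * (Real.exp (∑' z, c z) - 1) with hK
  have hK0 : 0 ≤ K := (convExp_remainder hc0 hcs hM 0).1.trans (convExp_remainder hc0 hcs hM 0).2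
  have hconv : discreteConv P (convExp c) x = ∑' z, P z * convExp c (x - z) := by
    unfold discreteConv
    rw [← (Equiv.subLeft x).tsum_eq]
    simp
  have hsum : Summable fun z => P z * convExp c (x - z) := by
    have h := summable_conv_fiber hPs (summable_convExp hcs) x
    rw [← (Equiv.subLeft x).summable_iff] at h
    simpa [Function.comp_def] using h
  have htail : Summable fun z => (if ρ ≤ ‖latticeVec z‖ then P z else 0) :=
    hPs.of_nonneg_of_le (fun z => by split_ifs; exacts [hP0 z, le_rfl])
      (fun z => by split_ifs; exacts [le_rfl, hP0 z])
  -- The three pieces of the majorant are: the unit atom of `convExp c` at 0, giving P(x); the local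
  -- error of c plus the second-order remainder; and the mass of P far from 0, where c and v are
  -- bounded trivially.
  have hF : HasSum (fun z => (if z = x then P x else 0) + P z * (ε + K)
      + (M + v) * (if ρ ≤ ‖latticeVec z‖ then P z else 0))
      (P x + 1 * (ε + K) + (M + v) * ∑' z, (if ρ ≤ ‖latticeVec z‖ then P z else 0)) := by
    refine ((hasSum_ite_eq x (P x)).add ?_).add (htail.hasSum.mul_left _)
    rw [← hP1]
    exact hPs.hasSum.mul_right _
  have hdiff : HasSum (fun z => P z * (convExp c (x - z) - v))
      (discreteConv P (convExp c) x - v) := by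
    have h := hsum.hasSum.sub (hPs.hasSum.mul_right v)
    rw [hP1, one_mul, ← hconv] at h
    simpa [mul_sub] using h
  have hpt : ∀ z, ‖P z * (convExp c (x - z) - v)‖ ≤ (if z = x then P x else 0) + P z * (ε + K)
      + (M + v) * (if ρ ≤ ‖latticeVec z‖ then P z else 0) := by
    intro z
    obtain ⟨h1, h2⟩ := convExp_remainder hc0 hcs hM (x - z)
    have hδ : |(convExp c (x - z) - v)| ≤ (if z = x then 1 else 0) + K + |c (x - z) - v| := by
      have h4 := abs_le.1 (le_refl |c (x - z) - v|)
      rcases eq_or_ne z x with rfl | h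
      · rw [if_pos (sub_self z)] at h1 h2
        rw [if_pos rfl]
        exact abs_le.2 ⟨by linarith [h4.1], by linarith [h4.2]⟩
      · rw [if_neg (sub_ne_zero.2 h.symm)] at h1 h2
        rw [if_neg h]
        exact abs_le.2 ⟨by linarith [h4.1], by linarith [h4.2]⟩
    have hcv : |c (x - z) - v| ≤ ε + (M + v) * (if ρ ≤ ‖latticeVec z‖ then 1 else 0) := by
      split_ifs with h
      · have := hc0 (x - z)
        have := hM (x - z)
        exact abs_le.2 ⟨by linarith, by linarith⟩
      · simpa using hnear z (not_le.1 h).le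
    rw [Real.norm_eq_abs, abs_mul, abs_of_nonneg (hP0 z)]
    calc P z * |convExp c (x - z) - v|
        ≤ P z * ((if z = x then 1 else 0) + K
            + (ε + (M + v) * (if ρ ≤ ‖latticeVec z‖ then 1 else 0))) := by
          have := hP0 z
          gcongr
          linarith
      _ = _ := by
          by_cases h : z = x
          · subst h; split_ifs <;> ring
          · simp only [h, if_false]; split_ifs <;> ring
  have := hdiff.norm_le_of_bounded hF hpt
  rw [Real.norm_eq_abs] at this
  linarith

lemma exists_levyDensity_le (ha₀ : ContinuousOn a₀ (Metric.sphere 0 1)) :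
    ∃ B > 0, ∀ y : EuclideanSpace ℝ (Fin d), y ≠ 0 →
      levyDensity α a₀ y ≤ B * ‖y‖ ^ (-((d : ℝ) + α)) := by
  obtain ⟨B, hB⟩ := (isCompact_sphere (0 : EuclideanSpace ℝ (Fin d)) 1).exists_bound_of_continuousOn
    ha₀
  refine ⟨max B 1, by positivity, fun y hy => ?_⟩
  unfold levyDensity
  have h := (le_abs_self _).trans (hB _ (direction_mem_sphere hy))
  gcongr
  exact h.trans (le_max_left _ _)

/-- The Lévy density varies slowly at infinity. -/
lemma exists_levyDensity_sub_le (ha₀ : ContinuousOn a₀ (Metric.sphere 0 1)) {ε : ℝ} (hε : 0 < ε) :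
    ∃ θ > 0, θ ≤ 1 / 2 ∧ ∀ x z : EuclideanSpace ℝ (Fin d), x ≠ 0 → ‖z‖ ≤ θ * ‖x‖ →
      |levyDensity α a₀ (x - z) - levyDensity α a₀ x| ≤ ε * ‖x‖ ^ (-((d : ℝ) + α)) := by
  -- By homogeneity x may be taken of norm 1; this annulus then contains x and every x - z with ‖z‖
  -- ≤ 1/2, and the density is uniformly continuous on it.
  set K : Set (EuclideanSpace ℝ (Fin d)) := Metric.closedBall 0 2 \ Metric.ball 0 (1 / 2) with hK
  have hKc : IsCompact K := (isCompact_closedBall _ _).diff Metric.isOpen_ball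
  have hKne : K ⊆ {0}ᶜ := by
    rintro y ⟨-, hy⟩ rfl
    exact hy (by simp)
  have huc := hKc.uniformContinuousOn_of_continuous
    ((continuousOn_levyDensity (α := α) ha₀).mono hKne)
  obtain ⟨δ, hδ, huc⟩ := Metric.uniformContinuousOn_iff_le.1 huc ε hε
  refine ⟨min δ (1 / 2), by positivity, min_le_right _ _, fun x z hx hz => ?_⟩
  have hX : 0 < ‖x‖ := norm_pos_iff.2 hx
  set u := ‖x‖⁻¹ • x with hu
  set z' := ‖x‖⁻¹ • z with hz'
  have hun : ‖u‖ = 1 := by rw [hu, norm_smul, norm_inv, norm_norm, inv_mul_cancel₀ hX.ne']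
  have hz'n : ‖z'‖ ≤ min δ (1 / 2) := by
    rw [hz', norm_smul, norm_inv, norm_norm, inv_mul_le_iff₀ hX]
    linarith
  have hxu : x = ‖x‖ • u := by rw [hu, smul_inv_smul₀ hX.ne']
  have hzu : x - z = ‖x‖ • (u - z') := by
    rw [smul_sub, hu, hz', smul_inv_smul₀ hX.ne', smul_inv_smul₀ hX.ne']
  have h1 := hz'n.trans (min_le_right _ _)
  have hm1 : u - z' ∈ K := by
    refine ⟨?_, ?_⟩
    · rw [mem_closedBall_zero_iff]
      linarith [norm_sub_le u z']
    · rw [mem_ball_zero_iff, not_lt]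
      linarith [norm_sub_norm_le u z']
  have hm2 : u ∈ K := by
    refine ⟨?_, ?_⟩
    · rw [mem_closedBall_zero_iff]; linarith
    · rw [mem_ball_zero_iff, not_lt]; linarith
  have h := huc _ hm1 _ hm2 (by
    rw [dist_eq_norm]; simpa using hz'n.trans (min_le_left _ _))
  rw [Real.dist_eq] at h
  have e1 : levyDensity α a₀ (x - z) = ‖x‖ ^ (-((d : ℝ) + α)) * levyDensity α a₀ (u - z') := by
    rw [hzu, levyDensity_smul hX]
  have e2 : levyDensity α a₀ x = ‖x‖ ^ (-((d : ℝ) + α)) * levyDensity α a₀ u := by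
    conv_lhs => rw [hxu]
    rw [levyDensity_smul hX]
  rw [e1, e2, ← mul_sub, abs_mul, abs_of_nonneg (by positivity), mul_comm]
  gcongr

namespace IsStableWalk

lemma exists_jump_le (W : IsStableWalk α a b a₀) :
    ∃ C > 0, ∃ R > 0, ∀ z, R ≤ ‖latticeVec z‖ → a z ≤ C * ‖latticeVec z‖ ^ (-((d : ℝ) + α)) := by
  obtain ⟨σ, hσ, C, R, hC, hR, h⟩ := W.jumpLaw_asymptotics
  obtain ⟨B, hB, hw⟩ := exists_levyDensity_le (α := α) W.cont
  refine ⟨C + B, by positivity, max R 1, by positivity, fun z hz => ?_⟩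
  have h1 : 1 ≤ ‖latticeVec z‖ := (le_max_right _ _).trans hz
  have h2 := (abs_le.1 (h z ((le_max_left _ _).trans hz))).2
  have h3 := hw (latticeVec z) (norm_pos_iff.1 (by linarith))
  have h4 : ‖latticeVec z‖ ^ (-((d : ℝ) + α + σ)) ≤ ‖latticeVec z‖ ^ (-((d : ℝ) + α)) :=
    Real.rpow_le_rpow_of_exponent_le h1 (by linarith)
  nlinarith [mul_le_mul_of_nonneg_left h4 hC]

/-- Near x the jump law may be frozen at w(x): the power error applies at x - z because ‖x-z‖ ≥
‖x‖/2, and w varies slowly. -/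
lemma exists_jump_sub_levyDensity_le (W : IsStableWalk α a b a₀) {ε : ℝ} (hε : 0 < ε) :
    ∃ θ > 0, θ ≤ 1 / 2 ∧ ∃ R > 0, ∀ x z : Fin d → ℤ, R ≤ ‖latticeVec x‖ →
      ‖latticeVec z‖ ≤ θ * ‖latticeVec x‖ →
      |a (x - z) - levyDensity α a₀ (latticeVec x)| ≤ ε * ‖latticeVec x‖ ^ (-((d : ℝ) + α)) := by
  obtain ⟨σ, hσ, C, R, hC, hR, h⟩ := W.jumpLaw_asymptotics
  obtain ⟨θ, hθ, hθ2, hw⟩ := exists_levyDensity_sub_le (α := α) W.cont (half_pos hε)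
  have hs := W.dim_add_pos
  have hlim : Filter.Tendsto (fun X : ℝ => C * (1 / 2) ^ (-((d : ℝ) + α + σ)) * X ^ (-σ))
      Filter.atTop (nhds 0) := by
    simpa using (tendsto_rpow_neg_atTop hσ).const_mul (C * (1 / 2) ^ (-((d : ℝ) + α + σ)))
  obtain ⟨R₁, hR₁⟩ := Filter.eventually_atTop.1 (hlim.eventually (gt_mem_nhds (half_pos hε)))
  refine ⟨θ, hθ, hθ2, max R₁ (2 * R), by positivity, fun x z hx hz => ?_⟩
  set X := ‖latticeVec x‖ with hXdef
  have hX1 := (le_max_left _ _).trans hx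
  have hX2 := (le_max_right _ _).trans hx
  have hX : 0 < X := by linarith
  have hxz : X / 2 ≤ ‖latticeVec (x - z)‖ := by
    rw [latticeVec_sub]
    have := norm_sub_norm_le (latticeVec x) (latticeVec z)
    nlinarith
  have e1 := h (x - z) (by linarith)
  have e2 := hw (latticeVec x) (latticeVec z) (norm_pos_iff.1 hX) hz
  rw [← latticeVec_sub] at e2
  have e3 : C * ‖latticeVec (x - z)‖ ^ (-((d : ℝ) + α + σ)) ≤ ε / 2 * X ^ (-((d : ℝ) + α)) := by
    calc C * ‖latticeVec (x - z)‖ ^ (-((d : ℝ) + α + σ))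
        ≤ C * (X / 2) ^ (-((d : ℝ) + α + σ)) := by
          refine mul_le_mul_of_nonneg_left ?_ hC
          exact Real.rpow_le_rpow_of_nonpos (by positivity) hxz (by linarith)
      _ = C * (1 / 2) ^ (-((d : ℝ) + α + σ)) * X ^ (-σ) * X ^ (-((d : ℝ) + α)) := by
          rw [show X / 2 = (1 / 2) * X by ring, Real.mul_rpow (by norm_num) hX.le,
            show -((d : ℝ) + α + σ) = -σ + -((d : ℝ) + α) by ring, Real.rpow_add hX]
          ring
      _ ≤ ε / 2 * X ^ (-((d : ℝ) + α)) := by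
          gcongr
          exact (hR₁ X hX1).le
  calc |a (x - z) - levyDensity α a₀ (latticeVec x)|
      ≤ |a (x - z) - levyDensity α a₀ (latticeVec (x - z))|
        + |levyDensity α a₀ (latticeVec (x - z)) - levyDensity α a₀ (latticeVec x)| :=
        abs_sub_le _ _ _
    _ ≤ ε / 2 * X ^ (-((d : ℝ) + α)) + ε / 2 * X ^ (-((d : ℝ) + α)) :=
        add_le_add (e1.trans e3) e2
    _ = _ := by ring

set_option maxHeartbeats 1000000 in
/-- In the regime `t ≪ |x|^α`, the walk reaches `x` by a single jump. -/
lemma transitionProb_tail (W : IsStableWalk α a b a₀) {ε : ℝ} (hε : 0 < ε) :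
    ∃ R > 0, ∀ t > 0, ∀ x : Fin d → ℤ, R ≤ ‖latticeVec x‖ → t * R ≤ ‖latticeVec x‖ ^ α →
      |transitionProb a t x - t * levyDensity α a₀ (latticeVec x)|
        ≤ ε * (t * ‖latticeVec x‖ ^ (-((d : ℝ) + α))) := by
  obtain ⟨CM, hCM, RM, hRM, hM⟩ := W.exists_jump_le
  obtain ⟨B, hB, hw⟩ := exists_levyDensity_le (α := α) W.cont
  obtain ⟨CT, hCT, hT⟩ := W.truncatedWalk_tail
  obtain ⟨CP, hCP, hP⟩ := W.truncatedWalk_le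
  obtain ⟨CL, hCL, hL⟩ := W.tsum_bigJumps_le
  obtain ⟨θ, hθ, hθ2, RU, hRU, hU⟩ := W.exists_jump_sub_levyDensity_le (half_pos hε)
  have hα := W.pos
  have hα2 := W.lt_two
  have hd1 : (1 : ℝ) ≤ d := by exact_mod_cast W.one_le
  have hd0 : (0 : ℝ) < d := by linarith
  have hs := W.dim_add_pos
  set s : ℝ := (d : ℝ) + α with hsdef
  -- Chosen so that X/(4dA) = d/α+2 for A = ηX. Then t^{-d/α}q^{d/α+2} is a constant times
  -- q·t·X^{-(d+α)}, leaving a spare factor q for the event without big jumps.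
  set η : ℝ := 1 / (4 * d * (d / α + 2)) with hη
  have hη0 : 0 < η := by positivity
  have hη2 : η < 1 / 2 := by
    rw [hη, div_lt_div_iff₀ (by positivity) (by norm_num)]
    have : 0 < (d : ℝ) / α := by positivity
    nlinarith
  have hηe : 1 / (4 * d * η) = d / α + 2 := by rw [hη]; field_simp
  -- The exponent θX/(2dA) in the tail bound of the truncated walk at distance θX.
  set κ : ℝ := θ / (2 * d * η) with hκ
  have hκ0 : 0 < κ := by positivity
  set D : ℝ := CM * η ^ (-s) with hD
  have hD0 : 0 < D := by positivity
  -- Errors relative to t·X^{-(d+α)}: no big jump, several big jumps, a small-jump displacement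
  -- beyond θX, and replacing e^{-tλ} by 1. All vanish as q → 0.
  set g : ℝ → ℝ := fun q => CP * η ^ (-s) * q + D * (Real.exp (CL * q) - 1)
    + (D + B) * (CT * q ^ κ) + CL * B * q with hg
  have hgc : Filter.Tendsto g (nhds 0) (nhds 0) := by
    have hc : Continuous g := by
      have := Real.continuous_rpow_const hκ0.le
      fun_prop
    have h0 : g 0 = 0 := by simp [hg, Real.zero_rpow hκ0.ne']
    simpa [h0] using hc.tendsto 0
  obtain ⟨q₀, hq₀, hgq⟩ := Metric.eventually_nhds_iff.1 (hgc.eventually (gt_mem_nhds (half_pos hε)))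
  -- The first maximum secures X ≥ RU and A ≥ RM; the second turns tR ≤ X^α into q·max(1, 2/q₀) ≤ 1,
  -- hence q ≤ 1 and q < q₀.
  set R := max (max RU (RM / η)) (η ^ (-α) * max 1 (2 / q₀)) with hR
  refine ⟨R, by positivity, fun t ht x hx htx => ?_⟩
  set X := ‖latticeVec x‖ with hXdef
  have hXU : RU ≤ X := ((le_max_left _ _).trans (le_max_left _ _)).trans hx
  have hXM : RM / η ≤ X := ((le_max_right _ _).trans (le_max_left _ _)).trans hx
  have hX : 0 < X := by linarith
  set A := η * X with hA
  have hA0 : 0 < A := by positivity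
  have hRMA : RM ≤ A := by rw [div_le_iff₀ hη0] at hXM; linarith
  set q := t * A ^ (-α) with hq
  have hq0 : 0 < q := by positivity
  have hqmax : q * max 1 (2 / q₀) ≤ 1 := by
    have h1 : t * (η ^ (-α) * max 1 (2 / q₀)) ≤ X ^ α :=
      (mul_le_mul_of_nonneg_left (le_max_right _ _) ht.le).trans htx
    have h2 : q = t * η ^ (-α) / X ^ α := by
      rw [hq, hA, Real.mul_rpow hη0.le hX.le, Real.rpow_neg hX.le]; ring
    rw [h2, div_mul_eq_mul_div, div_le_one (by positivity)]
    linarith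
  have hq1 : q ≤ 1 := by
    have := le_max_left 1 (2 / q₀)
    nlinarith
  have hqq : q < q₀ := by
    have h1 : q * (2 / q₀) ≤ 1 :=
      (mul_le_mul_of_nonneg_left (le_max_right 1 _) hq0.le).trans hqmax
    rw [mul_div_assoc', div_le_one hq₀] at h1
    linarith
  have hgq' : g q < ε / 2 := hgq (by rw [Real.dist_eq, sub_zero, abs_of_pos hq0]; exact hqq)
  set N := X ^ (-s) with hN
  have hN0 : 0 < N := by positivity
  have hAs : A ^ (-s) = η ^ (-s) * N := by rw [hA, Real.mul_rpow hη0.le hX.le]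
  set lam := ∑' z, bigJumps a A z with hlam
  have hlam0 : 0 ≤ lam := tsum_nonneg (bigJumps_nonneg W.jumpLaw.nonneg A)
  have htlam : t * lam ≤ CL * q := by
    have := mul_le_mul_of_nonneg_left (hL A hA0) ht.le
    rw [hq]; linarith
  set w := levyDensity α a₀ (latticeVec x) with hwdef
  have hw0 : 0 ≤ w := levyDensity_nonneg hs W.nonneg_a₀ _
  have hwB : w ≤ B * N := hw _ (norm_pos_iff.1 hX)
  have hbig : ∀ z, bigJumps a A z ≤ D * N := by
    intro z
    unfold bigJumps
    split_ifs with h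
    · positivity
    · have h1 := hM z (hRMA.trans (not_le.1 h).le)
      have h2 : ‖latticeVec z‖ ^ (-s) ≤ A ^ (-s) :=
        Real.rpow_le_rpow_of_nonpos hA0 (not_le.1 h).le (by linarith)
      calc a z ≤ CM * A ^ (-s) := h1.trans (mul_le_mul_of_nonneg_left h2 hCM.le)
        _ = D * N := by rw [hAs, hD]; ring
  have hnear : ∀ z, ‖latticeVec z‖ ≤ θ * X →
      |t * bigJumps a A (x - z) - t * w| ≤ t * (ε / 2 * N) := by
    intro z hz
    -- Since θ ≤ 1/2 and η < 1/2, a jump ending at x from within θX of the origin is longer than A,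
    -- so it counts as big.
    have hxz : A < ‖latticeVec (x - z)‖ := by
      rw [latticeVec_sub]
      have := norm_sub_norm_le (latticeVec x) (latticeVec z)
      nlinarith
    have h1 := hU x z hXU hz
    rw [bigJumps, if_neg (not_le.2 hxz), ← mul_sub, abs_mul, abs_of_pos ht]
    gcongr
  have hmain := abs_discreteConv_convExp_sub_le (P := truncatedWalk a A t)
    (c := fun z => t * bigJumps a A z) (M := t * (D * N)) (x := x) (v := t * w) (ρ := θ * X)
    (ε := t * (ε / 2 * N)) (truncatedWalk_nonneg W.jumpLaw.nonneg A ht.le)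
    (summable_truncatedWalk W.jumpLaw A t) (tsum_truncatedWalk W.jumpLaw A t)
    (fun z => mul_nonneg ht.le (bigJumps_nonneg W.jumpLaw.nonneg A z))
    ((summable_bigJumps W.jumpLaw A).mul_left t)
    (fun z => mul_le_mul_of_nonneg_left (hbig z) ht.le) (by positivity) (by positivity) hnear
  rw [tsum_mul_left, ← hlam] at hmain
  have hexp : Real.exp (t * lam) ≤ Real.exp (CL * q) := Real.exp_le_exp.2 htlam
  have hPx : truncatedWalk a A t x ≤ CP * η ^ (-s) * q * (t * N) := by
    refine (hP A hA0 t ht hq1 x).trans (le_of_eq ?_)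
    rw [← hXdef, ← hq, show X / (4 * d * A) = d / α + 2 by
      rw [← hηe, hA]; field_simp]
    have h1 : t ^ (-((d : ℝ) / α)) * q ^ ((d : ℝ) / α + 2) = η ^ (-s) * q * (t * N) := by
      have e1 : q ^ ((d : ℝ) / α) = t ^ ((d : ℝ) / α) * A ^ (-(d : ℝ)) := by
        rw [hq, Real.mul_rpow ht.le (by positivity), ← Real.rpow_mul hA0.le]
        congr 2
        field_simp
      have e2 : t ^ (-((d : ℝ) / α)) * t ^ ((d : ℝ) / α) = 1 := by
        rw [← Real.rpow_add ht]; simp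
      have e3 : A ^ (-(d : ℝ)) * A ^ (-α) = η ^ (-s) * N := by
        rw [← Real.rpow_add hA0, ← hAs, hsdef]; ring_nf
      rw [Real.rpow_add hq0, e1, Real.rpow_two]
      calc _ = (t ^ (-((d : ℝ) / α)) * t ^ ((d : ℝ) / α)) * A ^ (-(d : ℝ)) * (q * q) := by ring
        _ = q * t * (A ^ (-(d : ℝ)) * A ^ (-α)) := by rw [e2, hq]; ring
        _ = _ := by rw [e3]; ring
    rw [h1]; ring
  have hTx : ∑' z, (if θ * X ≤ ‖latticeVec z‖ then truncatedWalk a A t z else 0) ≤ CT * q ^ κ := by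
    have h1 := hT A hA0 t ht hq1 (θ * X)
    rwa [← hq, show θ * X / (2 * d * A) = κ by rw [hκ, hA]; field_simp] at h1
  have hQ : |discreteConv (truncatedWalk a A t) (convExp fun z => t * bigJumps a A z) x - t * w|
      ≤ t * N * (CP * η ^ (-s) * q + ε / 2 + D * (Real.exp (CL * q) - 1)
        + (D + B) * (CT * q ^ κ)) := by
    refine hmain.trans ?_
    have hT0 : 0 ≤ ∑' z, (if θ * X ≤ ‖latticeVec z‖ then truncatedWalk a A t z else 0) :=
      tsum_nonneg fun z => by
        split_ifs
        exacts [truncatedWalk_nonneg W.jumpLaw.nonneg A ht.le z, le_rfl]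
    calc _ ≤ CP * η ^ (-s) * q * (t * N)
          + (t * (ε / 2 * N) + t * (D * N) * (Real.exp (CL * q) - 1))
          + (t * (D * N) + t * (B * N)) * (CT * q ^ κ) := by
          gcongr
      _ = _ := by ring
  rw [transitionProb_eq_conv W.jumpLaw A t x, ← hlam]
  set Q := discreteConv (truncatedWalk a A t) (convExp fun z => t * bigJumps a A z) x with hQdef
  have he1 : Real.exp (-(t * lam)) ≤ 1 := Real.exp_le_one_iff.2 (by
    have := mul_nonneg ht.le hlam0; linarith)
  -- Dropping the factor e^{-tλ} costs at most tλ, which is O(q).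
  have he2 : 1 - Real.exp (-(t * lam)) ≤ CL * q := by
    have := Real.add_one_le_exp (-(t * lam)); linarith
  calc |Real.exp (-(t * lam)) * Q - t * w|
      = |Real.exp (-(t * lam)) * (Q - t * w) - (1 - Real.exp (-(t * lam))) * (t * w)| := by ring_nf
    _ ≤ |Real.exp (-(t * lam)) * (Q - t * w)| + |(1 - Real.exp (-(t * lam))) * (t * w)| :=
        abs_sub _ _
    _ ≤ 1 * (t * N * (CP * η ^ (-s) * q + ε / 2 + D * (Real.exp (CL * q) - 1)
        + (D + B) * (CT * q ^ κ))) + CL * q * (t * (B * N)) := by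
        rw [abs_mul, abs_mul, abs_of_pos (Real.exp_pos _), abs_of_nonneg (sub_nonneg.2 he1),
          abs_of_nonneg (mul_nonneg ht.le hw0)]
        gcongr
    _ = t * N * (g q + ε / 2) := by simp only [hg]; ring
    _ ≤ t * N * (ε / 2 + ε / 2) := by gcongr
    _ = _ := by ring

end IsStableWalk

end TailAsymptotics

/-! ### The stable density at infinity -/

section StableTail

variable {d : ℕ} {α : ℝ} {a : (Fin d → ℤ) → ℝ} {b : ℕ → EuclideanSpace ℝ (Fin d) → ℝ}
  {a₀ : EuclideanSpace ℝ (Fin d) → ℝ}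

lemma exists_latticeVec_sub_norm_le (hd : 1 ≤ d) (v : EuclideanSpace ℝ (Fin d)) :
    ∃ x : Fin d → ℤ, ‖latticeVec x - v‖ ≤ d := by
  refine ⟨fun i => round (v i), ?_⟩
  obtain ⟨i, hi⟩ := exists_norm_le_mul_abs_coord hd (latticeVec (fun i => round (v i)) - v)
  refine hi.trans ?_
  have h := abs_sub_round (v i)
  rw [abs_sub_comm] at h
  have h2 : (latticeVec (fun i => round (v i)) - v) i = (round (v i) : ℝ) - v i := by
    simp [latticeVec]
  rw [h2]
  have hd0 : (0 : ℝ) ≤ d := by positivity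
  nlinarith

lemma norm_rpow_rescale (hα : 0 < α) {t : ℝ} (ht : 0 < t) (v : EuclideanSpace ℝ (Fin d)) :
    ‖(t ^ (1 / α))⁻¹ • v‖ ^ (-((d : ℝ) + α))
      = t ^ ((d : ℝ) / α) * (t * ‖v‖ ^ (-((d : ℝ) + α))) := by
  have hc : 0 < t ^ (1 / α) := Real.rpow_pos_of_pos ht _
  rw [norm_smul, norm_inv, Real.norm_of_nonneg hc.le, Real.mul_rpow (by positivity) (norm_nonneg _),
    Real.inv_rpow hc.le, ← Real.rpow_neg hc.le, neg_neg, ← Real.rpow_mul ht.le, ← mul_assoc]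
  congr 1
  rw [← Real.rpow_add_one ht.ne']
  congr 1
  field_simp

lemma levyDensity_rescale (hα : 0 < α) {t : ℝ} (ht : 0 < t) (v : EuclideanSpace ℝ (Fin d)) :
    levyDensity α a₀ ((t ^ (1 / α))⁻¹ • v) = t ^ ((d : ℝ) / α) * (t * levyDensity α a₀ v) := by
  have hc : 0 < (t ^ (1 / α))⁻¹ := inv_pos.2 (Real.rpow_pos_of_pos ht _)
  unfold levyDensity
  rw [norm_rpow_rescale hα ht, direction_smul hc]
  ring

namespace IsStableWalk

/-- Rescaled form of the single-jump asymptotics. -/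
lemma transitionProb_tail_rescaled (W : IsStableWalk α a b a₀) {ε : ℝ} (hε : 0 < ε) :
    ∃ R > 0, ∀ t > 0, ∀ x : Fin d → ℤ, R ≤ ‖latticeVec x‖ →
      R ≤ ‖(t ^ (1 / α))⁻¹ • latticeVec x‖ →
      |t ^ ((d : ℝ) / α) * transitionProb a t x
          - levyDensity α a₀ ((t ^ (1 / α))⁻¹ • latticeVec x)|
        ≤ ε * ‖(t ^ (1 / α))⁻¹ • latticeVec x‖ ^ (-((d : ℝ) + α)) := by
  obtain ⟨R, hR, h⟩ := W.transitionProb_tail hε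
  have hα := W.pos
  refine ⟨max R (R ^ (1 / α)), by positivity, fun t ht x hx hy => ?_⟩
  have hc : 0 < t ^ (1 / α) := Real.rpow_pos_of_pos ht _
  have hxt : t * R ≤ ‖latticeVec x‖ ^ α := by
    have h1 := (le_max_right _ _).trans hy
    rw [norm_smul, norm_inv, Real.norm_of_nonneg hc.le, le_inv_mul_iff₀ hc,
      ← Real.mul_rpow ht.le hR.le] at h1
    calc t * R = ((t * R) ^ (1 / α)) ^ α := by
          rw [← Real.rpow_mul (by positivity), one_div_mul_cancel hα.ne', Real.rpow_one]
      _ ≤ _ := Real.rpow_le_rpow (by positivity) h1 hα.le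
  have h2 := h t ht x ((le_max_left _ _).trans hx) hxt
  rw [levyDensity_rescale hα ht, norm_rpow_rescale hα ht, ← mul_sub, abs_mul,
    abs_of_pos (by positivity), mul_left_comm]
  gcongr

/-- Every point of space is a limit of rescaled lattice points. -/
lemma exists_rescaled_tendsto (W : IsStableWalk α a b a₀) (y : EuclideanSpace ℝ (Fin d)) :
    ∃ x : ℝ → Fin d → ℤ, Filter.Tendsto (fun t : ℝ => (t ^ (1 / α))⁻¹ • latticeVec (x t))
      Filter.atTop (nhds y) := by
  choose x hx using fun t : ℝ => exists_latticeVec_sub_norm_le W.one_le (t ^ (1 / α) • y)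
  refine ⟨x, ?_⟩
  have hα := W.pos
  have h0 : Filter.Tendsto (fun t : ℝ => (t ^ (1 / α))⁻¹ * d) Filter.atTop (nhds 0) := by
    have h1 : Filter.Tendsto (fun t : ℝ => t ^ (1 / α)) Filter.atTop Filter.atTop :=
      tendsto_rpow_atTop (by positivity)
    simpa using h1.inv_tendsto_atTop.mul_const (d : ℝ)
  rw [tendsto_iff_norm_sub_tendsto_zero]
  refine squeeze_zero' (Filter.Eventually.of_forall fun _ => norm_nonneg _) ?_ h0
  filter_upwards [Filter.eventually_gt_atTop 0] with t ht
  have hc : 0 < t ^ (1 / α) := Real.rpow_pos_of_pos ht _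
  have e : (t ^ (1 / α))⁻¹ • latticeVec (x t) - y
      = (t ^ (1 / α))⁻¹ • (latticeVec (x t) - t ^ (1 / α) • y) := by
    rw [smul_sub, inv_smul_smul₀ hc.ne']
  rw [e, norm_smul, norm_inv, Real.norm_of_nonneg hc.le]
  gcongr
  exact hx t

/-- By the local limit theorem S(y) is a limit of rescaled probabilities along lattice points with
x/t^{1/α} → y, and S is continuous. -/
lemma stableDensity_nonneg (W : IsStableWalk α a b a₀) (y : EuclideanSpace ℝ (Fin d)) :
    0 ≤ stableDensity α (b 0) y := by
  obtain ⟨x, hx⟩ := W.exists_rescaled_tendsto y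
  have hS := (W.continuous_stableDensity.tendsto y).comp hx
  refine le_of_forall_pos_le_add fun ε hε => ?_
  obtain ⟨T, hT, h⟩ := W.local_limit hε
  have h2 : -ε ≤ stableDensity α (b 0) y := by
    refine ge_of_tendsto hS ?_
    filter_upwards [Filter.eventually_ge_atTop T] with t ht
    have ht0 : 0 < t := hT.trans_le ht
    have h3 := (abs_le.1 (h t ht (x t))).2
    have h4 : 0 ≤ t ^ ((d : ℝ) / α) * transitionProb a t (x t) :=
      mul_nonneg (by positivity) (transitionProb_nonneg W.jumpLaw.nonneg ht0.le _)
    simp only [Function.comp_apply]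
    linarith
  linarith

/-- The stable density is asymptotic to its Lévy density at infinity. -/
lemma stableDensity_tail (W : IsStableWalk α a b a₀) {ε : ℝ} (hε : 0 < ε) :
    ∃ K > 0, ∀ y : EuclideanSpace ℝ (Fin d), K ≤ ‖y‖ →
      |stableDensity α (b 0) y - levyDensity α a₀ y| ≤ ε * ‖y‖ ^ (-((d : ℝ) + α)) := by
  obtain ⟨R, hR, h⟩ := W.transitionProb_tail_rescaled hε
  have hα := W.pos
  refine ⟨R + 1, by positivity, fun y hy => ?_⟩
  have hy0 : y ≠ 0 := norm_pos_iff.1 (by linarith)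
  -- Fix y and let t → ∞ along rescaled lattice points tending to y: the same probabilities are
  -- close to S by the local limit theorem and to w by the single-jump estimate, so the tail of S is
  -- inherited from the walk.
  obtain ⟨x, hx⟩ := W.exists_rescaled_tendsto y
  set Y : ℝ → EuclideanSpace ℝ (Fin d) := fun t => (t ^ (1 / α))⁻¹ • latticeVec (x t) with hY
  have hS := (W.continuous_stableDensity.tendsto y).comp hx
  have hL := ((continuousOn_levyDensity (α := α) W.cont).continuousAt
    (isOpen_compl_singleton.mem_nhds hy0)).tendsto.comp hx
  have hN : Filter.Tendsto (fun t => ε * ‖Y t‖ ^ (-((d : ℝ) + α))) Filter.atTop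
      (nhds (ε * ‖y‖ ^ (-((d : ℝ) + α)))) :=
    ((hx.norm).rpow_const (Or.inl (norm_ne_zero_iff.2 hy0))).const_mul ε
  refine le_of_forall_pos_le_add fun ε' hε' => ?_
  obtain ⟨T, hT, hloc⟩ := W.local_limit hε'
  refine le_of_tendsto_of_tendsto (hS.sub hL).abs (hN.add_const ε') ?_
  have hYR : ∀ᶠ t in Filter.atTop, R < ‖Y t‖ := hx.norm.eventually (lt_mem_nhds (by linarith))
  filter_upwards [Filter.eventually_ge_atTop T, Filter.eventually_ge_atTop 1, hYR] with t ht ht1 hRt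
  have ht0 : 0 < t := hT.trans_le ht
  have h1 : 1 ≤ t ^ (1 / α) := Real.one_le_rpow ht1 (by positivity)
  have hc : 0 < t ^ (1 / α) := by linarith
  have hxR : R ≤ ‖latticeVec (x t)‖ := by
    have h2 : ‖latticeVec (x t)‖ = t ^ (1 / α) * ‖Y t‖ := by
      rw [hY]
      simp only
      rw [norm_smul, norm_inv, Real.norm_of_nonneg hc.le, mul_inv_cancel_left₀ hc.ne']
    rw [h2]
    nlinarith [norm_nonneg (Y t)]
  have e1 := h t ht0 (x t) hxR hRt.le
  have e2 := hloc t ht (x t)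
  simp only [Function.comp_apply]
  calc |stableDensity α (b 0) (Y t) - levyDensity α a₀ (Y t)|
      ≤ |stableDensity α (b 0) (Y t) - t ^ ((d : ℝ) / α) * transitionProb a t (x t)|
        + |t ^ ((d : ℝ) / α) * transitionProb a t (x t) - levyDensity α a₀ (Y t)| :=
        abs_sub_le _ _ _
    _ ≤ ε' + ε * ‖Y t‖ ^ (-((d : ℝ) + α)) := by
        rw [abs_sub_comm (stableDensity α (b 0) (Y t))]
        exact add_le_add e2 e1
    _ = _ := add_comm _ _

lemma integrable_stableDensity (W : IsStableWalk α a b a₀) :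
    Integrable (stableDensity α (b 0)) := by
  obtain ⟨K, hK, h⟩ := W.stableDensity_tail one_pos
  obtain ⟨B, hB, hw⟩ := exists_levyDensity_le (α := α) W.cont
  have hα := W.pos
  have hc := W.continuous_stableDensity
  rw [← integrableOn_univ, ← Set.union_compl_self (Metric.ball (0 : EuclideanSpace ℝ (Fin d)) K)]
  refine IntegrableOn.union ?_ ?_
  · exact (hc.continuousOn.integrableOn_compact (isCompact_closedBall 0 K)).mono_set
      Metric.ball_subset_closedBall
  · refine ((integrableOn_norm_rpow_compl_ball W.one_le (γ := -((d : ℝ) + α)) (by linarith)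
      hK).const_mul (1 + B)).mono' hc.aestronglyMeasurable ?_
    refine (ae_restrict_iff' Metric.isOpen_ball.measurableSet.compl).2
      (Filter.Eventually.of_forall fun y hy => ?_)
    have hy' : K ≤ ‖y‖ := by simpa using hy
    have h1 := (abs_le.1 (h y hy')).2
    have h2 := hw y (norm_pos_iff.1 (hK.trans_le hy'))
    rw [Real.norm_of_nonneg (W.stableDensity_nonneg y)]
    linarith

lemma exists_stableDensity_pos (W : IsStableWalk α a b a₀) :
    ∃ K > 0, ∀ y : EuclideanSpace ℝ (Fin d), K ≤ ‖y‖ → 0 < stableDensity α (b 0) y := by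
  obtain ⟨δ, hδ, hlow⟩ := W.lower
  obtain ⟨K, hK, h⟩ := W.stableDensity_tail hδ
  refine ⟨K, hK, fun y hy => ?_⟩
  have hy0 : 0 < ‖y‖ := hK.trans_le hy
  have h1 := (abs_le.1 (h y hy)).1
  have h2 : δ * ‖y‖ ^ (-((d : ℝ) + α)) < levyDensity α a₀ y := by
    unfold levyDensity
    have := hlow _ (direction_mem_sphere (norm_pos_iff.1 hy0))
    gcongr
  linarith

end IsStableWalk

end StableTail

/-! ### Convolution semigroup, positivity and characteristic function -/

section StableSemigroup

variable {d : ℕ} {α : ℝ} {a : (Fin d → ℤ) → ℝ} {b : ℕ → EuclideanSpace ℝ (Fin d) → ℝ}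
  {a₀ : EuclideanSpace ℝ (Fin d) → ℝ}

namespace IsStableWalk

lemma integrable_stableKernel (W : IsStableWalk α a b a₀) {τ : ℝ} (hτ : 0 < τ) :
    Integrable (stableKernel α a₀ τ) := by
  have h1 : Integrable (stableKernel α a₀ 1) := by
    have : stableKernel α a₀ 1
        = fun y => (2 * (Real.pi : ℂ)) ^ d * (stableDensity α (b 0) y : ℂ) :=
      funext W.stableKernel_one_eq
    rw [this]
    exact W.integrable_stableDensity.ofReal.const_mul _
  rw [funext (W.stableKernel_scaling hτ)]
  exact ((integrable_comp_smul_iff volume (stableKernel α a₀ 1)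
    (Real.rpow_pos_of_pos hτ _).ne').2 h1).const_mul _

lemma integrable_exp_neg_exponent_ofReal (W : IsStableWalk α a b a₀) {τ : ℝ} (hτ : 0 < τ) :
    Integrable fun k => (Real.exp (-(τ * stableExponent α a₀ k)) : ℂ) :=
  (W.integrable_exp_neg_exponent hτ).ofReal

/-- Fourier inversion for the stable kernel. -/
lemma integral_stableKernel_mul_planeWave (W : IsStableWalk α a b a₀) {τ : ℝ} (hτ : 0 < τ)
    (k : EuclideanSpace ℝ (Fin d)) :
    ∫ z, stableKernel α a₀ τ z * planeWave k z
      = (2 * Real.pi) ^ d * (Real.exp (-(τ * stableExponent α a₀ k)) : ℂ) := by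
  have hK : (fun z => ∫ y, planeWave z y * (Real.exp (-(τ * stableExponent α a₀ y)) : ℂ))
      = stableKernel α a₀ τ := by
    funext z
    rw [← stableKernel_neg]
    unfold stableKernel
    refine integral_congr_ae (Filter.Eventually.of_forall fun y => ?_)
    simp only
    rw [neg_neg, mul_comm, planeWave_comm]
  have hcont : Continuous fun k => (Real.exp (-(τ * stableExponent α a₀ k)) : ℂ) := by
    have := W.continuous_stableExponent
    fun_prop
  have h := integral_planeWave_inversion (W.integrable_exp_neg_exponent_ofReal hτ)
    (by rw [hK]; exact W.integrable_stableKernel hτ) (hcont.continuousAt (x := -k))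
  rw [stableExponent_neg, neg_neg] at h
  rw [← h]
  refine integral_congr_ae (Filter.Eventually.of_forall fun z => ?_)
  simp only
  rw [planeWave_comm k z, ← congrFun hK z]

/-- The stable kernels form a convolution semigroup, up to the normalization `(2π)^d`. -/
lemma integral_stableKernel_mul_stableKernel (W : IsStableWalk α a b a₀) {τ σ : ℝ} (hτ : 0 < τ)
    (hσ : 0 < σ) (y : EuclideanSpace ℝ (Fin d)) :
    ∫ z, stableKernel α a₀ σ z * stableKernel α a₀ τ (y - z)
      = (2 * Real.pi) ^ d * stableKernel α a₀ (τ + σ) y := by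
  have hpw : Continuous fun p : EuclideanSpace ℝ (Fin d) × EuclideanSpace ℝ (Fin d) =>
      planeWave p.2 (-(y - p.1)) := by
    unfold planeWave
    fun_prop
  have hint : Integrable (Function.uncurry fun z k : EuclideanSpace ℝ (Fin d) =>
      stableKernel α a₀ σ z * ((Real.exp (-(τ * stableExponent α a₀ k)) : ℂ)
        * planeWave k (-(y - z)))) (volume.prod volume) := by
    have h1 := (W.integrable_stableKernel hσ).mul_prod (W.integrable_exp_neg_exponent_ofReal hτ)
    refine (h1.mul_bdd (c := 1) hpw.aestronglyMeasurable
      (Filter.Eventually.of_forall fun p => (norm_planeWave _ _).le)).congr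
      (Filter.Eventually.of_forall fun p => ?_)
    simp only [Function.uncurry]
    ring
  calc ∫ z, stableKernel α a₀ σ z * stableKernel α a₀ τ (y - z)
      = ∫ z, ∫ k, stableKernel α a₀ σ z * ((Real.exp (-(τ * stableExponent α a₀ k)) : ℂ)
        * planeWave k (-(y - z))) := by
        refine integral_congr_ae (Filter.Eventually.of_forall fun z => ?_)
        simp only
        rw [integral_const_mul]
        rfl
    _ = ∫ k, ∫ z, stableKernel α a₀ σ z * ((Real.exp (-(τ * stableExponent α a₀ k)) : ℂ)
        * planeWave k (-(y - z))) := integral_integral_swap hint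
    _ = ∫ k, (2 * Real.pi) ^ d * ((Real.exp (-((τ + σ) * stableExponent α a₀ k)) : ℂ)
        * planeWave k (-y)) := by
        refine integral_congr_ae (Filter.Eventually.of_forall fun k => ?_)
        simp only
        have e : ∀ z, stableKernel α a₀ σ z * ((Real.exp (-(τ * stableExponent α a₀ k)) : ℂ)
            * planeWave k (-(y - z))) = ((Real.exp (-(τ * stableExponent α a₀ k)) : ℂ)
            * planeWave k (-y)) * (stableKernel α a₀ σ z * planeWave k z) := by
          intro z
          rw [show -(y - z) = -y + z by abel, planeWave_add_right]
          ring
        simp_rw [e]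
        rw [integral_const_mul, W.integral_stableKernel_mul_planeWave hσ k,
          show -((τ + σ) * stableExponent α a₀ k)
            = -(τ * stableExponent α a₀ k) + -(σ * stableExponent α a₀ k) by ring, Real.exp_add]
        push_cast
        ring
    _ = _ := by rw [integral_const_mul, stableKernel]

/-- By the semigroup at two half-times, S(y) is a positive multiple of ∫ S(cz)S(c(y-z))dz with c =
2^{1/α}. The integrand is continuous and nonnegative, and it is positive at a point e so remote that
both ce and c(y-e) lie where the tail already gives positivity. -/
lemma stableDensity_pos (W : IsStableWalk α a b a₀) (y : EuclideanSpace ℝ (Fin d)) :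
    0 < stableDensity α (b 0) y := by
  have hd := W.one_le
  obtain ⟨K, hK, hpos⟩ := W.exists_stableDensity_pos
  set c : ℝ := ((1 / 2 : ℝ) ^ (-(1 / α))) with hc
  have hc0 : 0 < c := by positivity
  set S := stableDensity α (b 0) with hS
  have hSc : Continuous S := W.continuous_stableDensity
  have hS0 : ∀ z, 0 ≤ S z := W.stableDensity_nonneg
  set G : EuclideanSpace ℝ (Fin d) → ℝ := fun z => S (c • z) * S (c • (y - z)) with hG
  have hkernel : ∀ z, stableKernel α a₀ (1 / 2) z =
      ((c ^ d * (2 * Real.pi) ^ d * S (c • z) : ℝ) : ℂ) := by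
    intro z
    rw [W.stableKernel_scaling one_half_pos, W.stableKernel_one_eq]
    push_cast
    ring
  have hmain := W.integral_stableKernel_mul_stableKernel one_half_pos one_half_pos y
  rw [add_halves, W.stableKernel_one_eq] at hmain
  simp_rw [hkernel, ← Complex.ofReal_mul] at hmain
  rw [integral_complex_ofReal] at hmain
  have hreal : ∫ z, c ^ d * (2 * Real.pi) ^ d * S (c • z)
      * (c ^ d * (2 * Real.pi) ^ d * S (c • (y - z)))
      = (2 * Real.pi) ^ d * ((2 * Real.pi) ^ d * S y) := by
    exact_mod_cast hmain
  have hGi : ∫ z, c ^ d * (2 * Real.pi) ^ d * S (c • z)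
      * (c ^ d * (2 * Real.pi) ^ d * S (c • (y - z)))
      = (c ^ d * (2 * Real.pi) ^ d) ^ 2 * ∫ z, G z := by
    rw [← integral_const_mul]
    refine integral_congr_ae (Filter.Eventually.of_forall fun z => ?_)
    simp only [hG]
    ring
  have hGc : Continuous G := by fun_prop
  have hG0 : ∀ z, 0 ≤ G z := fun z => mul_nonneg (hS0 _) (hS0 _)
  have hGint : Integrable G := by
    -- S is bounded by the L¹ norm of its characteristic function divided by (2π)^d; a bounded
    -- factor times an integrable one is integrable.
    obtain ⟨M, hM⟩ : ∃ M, ∀ z, ‖S z‖ ≤ M := by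
      refine ⟨‖((2 * Real.pi) ^ d : ℝ)‖⁻¹ * ∫ k, Real.exp (-(1 * stableExponent α a₀ k)),
        fun z => ?_⟩
      have h1 : ‖stableKernel α a₀ 1 z‖ ≤ ∫ k, Real.exp (-(1 * stableExponent α a₀ k)) := by
        refine (norm_integral_le_integral_norm _).trans (le_of_eq ?_)
        refine integral_congr_ae (Filter.Eventually.of_forall fun k => ?_)
        simp only [norm_mul, norm_planeWave, mul_one, Complex.norm_real, Real.norm_eq_abs,
          Real.abs_exp]
      rw [W.stableKernel_one_eq] at h1
      rw [le_inv_mul_iff₀ (norm_pos_iff.2 (by positivity))]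
      refine le_trans (le_of_eq ?_) h1
      rw [← norm_mul, ← Complex.norm_real]
      push_cast
      rfl
    refine ((integrable_comp_smul_iff volume S hc0.ne').2 W.integrable_stableDensity).mul_bdd
      (c := M) (by fun_prop) (Filter.Eventually.of_forall fun z => hM _)
  have hGpos : 0 < ∫ z, G z := by
    rw [integral_pos_iff_support_of_nonneg hG0 hGint]
    refine (hGc.isOpen_support).measure_pos volume ?_
    set L : ℝ := ‖y‖ + c⁻¹ * K with hL
    have hL0 : 0 < L := by positivity
    set e : EuclideanSpace ℝ (Fin d) := EuclideanSpace.single ⟨0, hd⟩ L with he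
    have hen : ‖e‖ = L := by simp [he, abs_of_pos hL0]
    have hfar : ∀ z : EuclideanSpace ℝ (Fin d), c⁻¹ * K ≤ ‖z‖ → 0 < S (c • z) := by
      intro z hz
      refine hpos _ ?_
      rw [norm_smul, Real.norm_of_nonneg hc0.le]
      rwa [inv_mul_le_iff₀ hc0] at hz
    refine ⟨e, (mul_pos (hfar e ?_) (hfar (y - e) ?_)).ne'⟩
    · rw [hen, hL]; linarith [norm_nonneg y]
    · rw [norm_sub_rev]
      have := norm_sub_norm_le e y
      linarith
  have : 0 < (2 * Real.pi) ^ d * ((2 * Real.pi) ^ d * S y) := by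
    rw [← hreal, hGi]
    positivity
  have hp : (0 : ℝ) < (2 * Real.pi) ^ d := by positivity
  exact (mul_pos_iff_of_pos_left hp).1 ((mul_pos_iff_of_pos_left hp).1 this)

/-- The characteristic function of the stable law. -/
lemma integral_planeWave_mul_stableDensity (W : IsStableWalk α a b a₀)
    (k : EuclideanSpace ℝ (Fin d)) :
    ∫ y, planeWave k y * (stableDensity α (b 0) y : ℂ)
      = (Real.exp (-stableExponent α a₀ k) : ℂ) := by
  have h := W.integral_stableKernel_mul_planeWave one_pos k
  simp_rw [W.stableKernel_one_eq, mul_assoc] at h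
  rw [integral_const_mul, one_mul] at h
  have hp : (2 * (Real.pi : ℂ)) ^ d ≠ 0 := by simp [Real.pi_ne_zero]
  rw [← mul_left_cancel₀ hp h]
  simp_rw [mul_comm]

end IsStableWalk

end StableSemigroup

/-! ### Relative errors, uniformly in space and time -/

section UniformAsymptotics

variable {d : ℕ} {α : ℝ} {a : (Fin d → ℤ) → ℝ} {b : ℕ → EuclideanSpace ℝ (Fin d) → ℝ}
  {a₀ : EuclideanSpace ℝ (Fin d) → ℝ}

namespace IsStableWalk

/-- The local limit theorem with a relative error, uniform in `|x| + t → ∞`. -/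
lemma transitionProb_asymptotics (W : IsStableWalk α a b a₀) {ε : ℝ} (hε : 0 < ε) :
    ∃ R : ℝ, ∀ (t : ℝ) (x : Fin d → ℤ), 0 < t → R ≤ ‖latticeVec x‖ + t →
      |t ^ ((d : ℝ) / α) * transitionProb a t x
          - stableDensity α (b 0) ((t ^ (1 / α))⁻¹ • latticeVec x)|
        ≤ ε * stableDensity α (b 0) ((t ^ (1 / α))⁻¹ • latticeVec x) := by
  obtain ⟨δ, hδ, hlow⟩ := W.lower
  have hα := W.pos
  -- The bound δ/2 keeps S ≥ (δ/2)‖y‖^{-(d+α)} in the tail; two errors of size εδ/4 then add up to ε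
  -- times that lower bound.
  set ε₁ := min (δ / 2) (ε * δ / 4) with hε₁
  have hε₁0 : 0 < ε₁ := by positivity
  obtain ⟨K₁, hK₁, h1⟩ := W.transitionProb_tail_rescaled hε₁0
  obtain ⟨K₂, hK₂, h2⟩ := W.stableDensity_tail hε₁0
  set K := max K₁ K₂ with hK
  have hK0 : 0 < K := by positivity
  obtain ⟨y₀, -, hy₀⟩ := (isCompact_closedBall (0 : EuclideanSpace ℝ (Fin d)) K).exists_isMinOn
    ⟨0, by simp [hK0.le]⟩ W.continuous_stableDensity.continuousOn
  set m := stableDensity α (b 0) y₀ with hm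
  have hm0 : 0 < m := W.stableDensity_pos y₀
  obtain ⟨T, hT, h3⟩ := W.local_limit (mul_pos hε hm0)
  -- If ‖y‖ ≥ K and ‖x‖ < K₁, then t ≤ (K₁/K)^α, so ‖x‖+t < R₁. If ‖y‖ < K and t < T, then ‖x‖ ≤
  -- K·T^{1/α}, so ‖x‖+t < R₂. Both are thus excluded.
  set R₁ := K₁ + (K₁ / K) ^ α with hR₁
  set R₂ := K * T ^ (1 / α) + T with hR₂
  refine ⟨max R₁ R₂, fun t x ht hx => ?_⟩
  have hc : 0 < t ^ (1 / α) := Real.rpow_pos_of_pos ht _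
  set y := (t ^ (1 / α))⁻¹ • latticeVec x with hy
  have hxy : ‖latticeVec x‖ = t ^ (1 / α) * ‖y‖ := by
    rw [hy, norm_smul, norm_inv, Real.norm_of_nonneg hc.le, mul_inv_cancel_left₀ hc.ne']
  -- For ‖y‖ ≥ K, compare both sides with the Lévy density. For ‖y‖ < K, t is large and S is at
  -- least its minimum m over the ball.
  rcases le_or_gt K ‖y‖ with hKy | hKy
  · have hxK : K₁ ≤ ‖latticeVec x‖ := by
      by_contra! hlt
      have h4 : t ≤ (K₁ / K) ^ α := by
        have h5 : t ^ (1 / α) ≤ K₁ / K := by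
          rw [le_div_iff₀ hK0]
          nlinarith
        calc t = (t ^ (1 / α)) ^ α := by
              rw [← Real.rpow_mul ht.le, one_div_mul_cancel hα.ne', Real.rpow_one]
          _ ≤ _ := Real.rpow_le_rpow hc.le h5 hα.le
      have := (le_max_left R₁ R₂).trans hx
      linarith
    have hy0 : 0 < ‖y‖ := hK0.trans_le hKy
    have e1 := h1 t ht x hxK ((le_max_left _ _).trans hKy)
    have e2 := h2 y ((le_max_right _ _).trans hKy)
    set N := ‖y‖ ^ (-((d : ℝ) + α)) with hN
    have hN0 : 0 < N := by positivity
    have e3 : δ * N ≤ levyDensity α a₀ y := by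
      unfold levyDensity
      have := (hlow _ (direction_mem_sphere (norm_pos_iff.1 hy0))).le
      gcongr
    have e4 : δ / 2 * N ≤ stableDensity α (b 0) y := by
      have h5 := (abs_le.1 e2).1
      have h6 : ε₁ * N ≤ δ / 2 * N := by gcongr; exact min_le_left _ _
      linarith
    calc |t ^ ((d : ℝ) / α) * transitionProb a t x - stableDensity α (b 0) y|
        ≤ |t ^ ((d : ℝ) / α) * transitionProb a t x - levyDensity α a₀ y|
          + |levyDensity α a₀ y - stableDensity α (b 0) y| := abs_sub_le _ _ _
      _ ≤ ε₁ * N + ε₁ * N := by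
          rw [abs_sub_comm (levyDensity α a₀ y)]
          exact add_le_add e1 e2
      _ ≤ ε * δ / 4 * N + ε * δ / 4 * N := by
          have : ε₁ ≤ ε * δ / 4 := min_le_right _ _
          gcongr
      _ = ε * (δ / 2 * N) := by ring
      _ ≤ _ := by gcongr
  · have hTt : T ≤ t := by
      by_contra! hlt
      have h4 : t ^ (1 / α) ≤ T ^ (1 / α) := Real.rpow_le_rpow ht.le hlt.le (by positivity)
      have h5 : ‖latticeVec x‖ ≤ K * T ^ (1 / α) := by
        rw [hxy, mul_comm K]
        gcongr
      have := (le_max_right R₁ R₂).trans hx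
      linarith
    have h6 : m ≤ stableDensity α (b 0) y := hy₀ (by simpa using hKy.le)
    exact (h3 t hTt x).trans (by gcongr)

/-- The single-jump asymptotics with a relative error. -/
lemma transitionProb_asymptotics_levyDensity (W : IsStableWalk α a b a₀) {ε : ℝ} (hε : 0 < ε) :
    ∃ R : ℝ, ∀ (t : ℝ) (x : Fin d → ℤ), 0 < t → 1 ≤ ‖latticeVec x‖ →
      R ≤ ‖latticeVec x‖ + t → R ≤ ‖latticeVec x‖ / t ^ (1 / α) →
      |transitionProb a t x - t * levyDensity α a₀ (latticeVec x)|
        ≤ ε * (t * levyDensity α a₀ (latticeVec x)) := by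
  obtain ⟨δ, hδ, hlow⟩ := W.lower
  have hα := W.pos
  obtain ⟨K, hK, h⟩ := W.transitionProb_tail (mul_pos hε hδ)
  -- K^{1/α} bounds the ratio so that tK ≤ X^α. The other two force X ≥ K: if X < K, the ratio bound
  -- K+1 gives t^{1/α} ≤ K, and then X+t < K+K^α.
  refine ⟨max (K + 1) (max (K ^ (1 / α)) (K + K ^ α)), fun t x ht hx hR hR' => ?_⟩
  have hc : 0 < t ^ (1 / α) := Real.rpow_pos_of_pos ht _
  set X := ‖latticeVec x‖ with hX
  have hX0 : 0 < X := by linarith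
  have hroot : ∀ u : ℝ, 0 ≤ u → (u ^ (1 / α)) ^ α = u := fun u hu => by
    rw [← Real.rpow_mul hu, one_div_mul_cancel hα.ne', Real.rpow_one]
  have hKX : K ≤ X := by
    by_contra! hlt
    have h1 := (le_max_left _ _).trans hR'
    rw [le_div_iff₀ hc] at h1
    have h2 : t ^ (1 / α) ≤ K := by nlinarith
    have h3 : t ≤ K ^ α := by
      rw [← hroot t ht.le]
      exact Real.rpow_le_rpow hc.le h2 hα.le
    have h4 := ((le_max_right _ _).trans (le_max_right _ _)).trans hR
    linarith
  have htK : t * K ≤ X ^ α := by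
    have h1 := ((le_max_left _ _).trans (le_max_right _ _)).trans hR'
    rw [le_div_iff₀ hc, ← Real.mul_rpow hK.le ht.le] at h1
    rw [mul_comm, ← hroot (K * t) (by positivity)]
    exact Real.rpow_le_rpow (by positivity) h1 hα.le
  refine (h t ht x hKX htK).trans ?_
  have e3 : δ * X ^ (-((d : ℝ) + α)) ≤ levyDensity α a₀ (latticeVec x) := by
    unfold levyDensity
    have := (hlow _ (direction_mem_sphere (norm_pos_iff.1 hX0))).le
    gcongr
  calc ε * δ * (t * X ^ (-((d : ℝ) + α))) = ε * (t * (δ * X ^ (-((d : ℝ) + α)))) := by ring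
    _ ≤ _ := by gcongr

end IsStableWalk

end UniformAsymptotics

/-! ### The main theorem -/

theorem theorem1 (d : ℕ) (hd : 1 ≤ d) (α : ℝ) (hα₀ : 0 < α) (hα₂ : α < 2)
    (a : (Fin d → ℤ) → ℝ) (ha : IsSymmetricJumpLaw a)
    (b : ℕ → EuclideanSpace ℝ (Fin d) → ℝ)
    (hexp : HasFourierExpansion α a b)
    (a₀ : EuclideanSpace ℝ (Fin d) → ℝ)
    (ha₀_cont : ContinuousOn a₀ (Metric.sphere 0 1))
    (ha₀_even : ∀ x ∈ Metric.sphere (0 : EuclideanSpace ℝ (Fin d)) 1, a₀ (-x) = a₀ x)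
    (ha₀_pos : ∃ δ : ℝ, 0 < δ ∧ ∀ x ∈ Metric.sphere (0 : EuclideanSpace ℝ (Fin d)) 1, δ < a₀ x)
    (hb₀ : ∀ k ∈ Metric.sphere (0 : EuclideanSpace ℝ (Fin d)) 1, b 0 k = stableExponent α a₀ k)
    (hlt : ∀ k : EuclideanSpace ℝ (Fin d), (∀ i, |k i| ≤ Real.pi) → k ≠ 0 → jumpFourier a k < 1) :
    -- `S` is given by an absolutely convergent real integral, is positive everywhere, and is the
    -- probability density with characteristic function `exp (-b₀(k/|k|)|k|^α)`
    (Integrable (fun k : EuclideanSpace ℝ (Fin d) => Real.exp (-(b 0 (direction k) * ‖k‖ ^ α))) ∧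
      (∀ y, stableFourierIntegral α (b 0) y = (stableDensity α (b 0) y : ℂ)) ∧
      (∀ y, 0 < stableDensity α (b 0) y) ∧
      Integrable (stableDensity α (b 0)) ∧
      ∀ k : EuclideanSpace ℝ (Fin d),
        ∫ y, Complex.exp (Complex.I * ((inner ℝ k y : ℝ) : ℂ)) * (stableDensity α (b 0) y : ℂ)
          = (Real.exp (-(b 0 (direction k) * ‖k‖ ^ α)) : ℂ)) ∧
    -- (1) the asymptotics uniform in `|x| + t → ∞`
    (∀ ε : ℝ, 0 < ε → ∃ R : ℝ, ∀ (t : ℝ) (x : Fin d → ℤ), 0 < t → R ≤ ‖latticeVec x‖ + t →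
      |transitionProb a t x
          - 1 / t ^ ((d : ℝ) / α) * stableDensity α (b 0) ((t ^ (1 / α))⁻¹ • latticeVec x)|
        ≤ ε * (1 / t ^ ((d : ℝ) / α)
            * stableDensity α (b 0) ((t ^ (1 / α))⁻¹ • latticeVec x))) ∧
    -- (2) the sharper form when moreover `|x| / t^{1/α} → ∞`, `|x| ≥ 1`
    (∀ ε : ℝ, 0 < ε → ∃ R : ℝ, ∀ (t : ℝ) (x : Fin d → ℤ), 0 < t → 1 ≤ ‖latticeVec x‖ →
      R ≤ ‖latticeVec x‖ + t → R ≤ ‖latticeVec x‖ / t ^ (1 / α) →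
      a₀ (direction (latticeVec x)) / t ^ ((d : ℝ) / α)
            * (t ^ (1 / α) / ‖latticeVec x‖) ^ ((d : ℝ) + α)
          = a₀ (direction (latticeVec x)) * t / ‖latticeVec x‖ ^ ((d : ℝ) + α) ∧
      |transitionProb a t x
          - a₀ (direction (latticeVec x)) * t / ‖latticeVec x‖ ^ ((d : ℝ) + α)|
        ≤ ε * (a₀ (direction (latticeVec x)) * t / ‖latticeVec x‖ ^ ((d : ℝ) + α))) := by
  have W : IsStableWalk α a b a₀ :=
    ⟨hd, hα₀, hα₂, ha, hexp, ha₀_cont, ha₀_even, ha₀_pos, hb₀, hlt⟩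
  refine ⟨⟨?_, W.stableDensity_ofReal, W.stableDensity_pos, W.integrable_stableDensity, ?_⟩,
    fun ε hε => ?_, fun ε hε => ?_⟩
  · simpa [W.exponent_eq] using W.integrable_exp_neg_exponent one_pos
  · intro k
    rw [W.exponent_eq]
    exact W.integral_planeWave_mul_stableDensity k
  · obtain ⟨R, hR⟩ := W.transitionProb_asymptotics hε
    refine ⟨R, fun t x ht hx => ?_⟩
    have hc : 0 < t ^ ((d : ℝ) / α) := Real.rpow_pos_of_pos ht _
    have h := mul_le_mul_of_nonneg_left (hR t x ht hx) (one_div_pos.2 hc).le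
    rw [← abs_of_pos (one_div_pos.2 hc), ← abs_mul, abs_of_pos (one_div_pos.2 hc), mul_sub,
      ← mul_assoc, one_div_mul_cancel hc.ne', one_mul, mul_left_comm] at h
    exact h
  · obtain ⟨R, hR⟩ := W.transitionProb_asymptotics_levyDensity hε
    refine ⟨R, fun t x ht hx1 hx hxt => ?_⟩
    have hX : 0 < ‖latticeVec x‖ := by linarith
    have hw : t * levyDensity α a₀ (latticeVec x)
        = a₀ (direction (latticeVec x)) * t / ‖latticeVec x‖ ^ ((d : ℝ) + α) := by
      rw [levyDensity, Real.rpow_neg hX.le]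
      ring
    refine ⟨?_, by simpa [hw] using hR t x ht hx1 hx hxt⟩
    have hc : 0 < t ^ ((d : ℝ) / α) := Real.rpow_pos_of_pos ht _
    have e : (t ^ (1 / α)) ^ ((d : ℝ) + α) = t ^ ((d : ℝ) / α) * t := by
      rw [← Real.rpow_mul ht.le, ← Real.rpow_add_one ht.ne']
      congr 1
      field_simp
    rw [Real.div_rpow (by positivity) hX.le, e]
    field_simp
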